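/- **Setting.** Let $d\ge 1$. For $T>0$ let $F_1,F_2:[0,T]\times\mathbb R^d\times\mathbb R^d\to\mathbb R^d$ and $\sigma:[0,T]\times\mathbb R^d\times\mathbb R^d\to\mathbb R^{d\times d}$ be coefficients, put $F=(F_1,F_2)$, $a=\sigma\sigma^*$, and let $D_1$ be the derivative in the variable $x_1$, where $x=(x_1,x_2)$. Assume **(HR)**: * (H1) There are $\beta_1^1,\beta_1^2,\beta_2^2\in(2/3,1)$ and $C_1,C_2,C_\sigma>0$ such that for all $t\in[0,T]$ and $x,y\in\mathbb R^{2d}$: $|F_1(t,x)-F_1(t,y)|\le C_1(|x_1-y_1|^{\beta_1^1}+|x_2-y_2|^{\beta_1^2})$, $|F_2(t,x)-F_2(t,y)|\le C_2(|x_1-y_1|+|x_2-y_2|^{\beta_2^2})$, $|\sigma(t,x)-\sigma(t,y)|\le C_\sigma(|x_1-y_1|+|x_2-y_2|)$; and $F_1,F_2,\sigma$ are continuous in $t$. * (H2) There is $\Lambda>1$ with $\Lambda^{-1}|\zeta|^2\le a(t,x)\zeta\cdot\zeta\le\Lambda|\zeta|^2$ for all $\zeta\in\mathbb R^d$, $t\in[0,T]$,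 $x\in\mathbb R^{2d}$. * (H3-a) $x_1\mapsto F_2(t,x_1,x_2)$ is $C^1$, and $|D_1F_2(t,x_1,x_2)-D_1F_2(t,y_1,x_2)|\le\bar C_2|x_1-y_1|^{\alpha^1}$ with $\bar C_2>0$, $\alpha^1\in(0,1)$. * (H3-b) There is a closed convex set $\mathcal E$ of real $d\times d$ matrices (closed in the space of all such matrices), all of whose elements are invertible, with $D_1F_2(t,x)\in\mathcal E$ for all $t\in[0,T]$, $x\in\mathbb R^{2d}$. * $F_1,F_2,a$ are infinitely differentiable on $[0,T]\times\mathbb R^{2d}$ and their space derivatives of every order $\ge1$ are bounded. The *known parameters* are $d,C_1,C_2,C_\sigma,\beta_1^1,\beta_1^2,\beta_2^2,\Lambda,\bar C_2,\alpha^1,\mathcal E$. For $(\tau,\xi)\in[0,T]\times\mathbb R^{2d}$ the transport $\theta_{\tau,\cdot}(\xi)$ is the solution on $[\tau,T]$ of $$\tfrac{d}{ds}\theta_{\tau,s}(\xi)=F(s,\theta_{\tau,s}(\xi)),\qquad\theta_{\tau,\tau}(\xi)=\xi,\tag{3.2}$$ extended by $\theta_{\tau,s}(\xi)=0$ for $s<\tau$.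 The frozen system with initial condition $x\in\mathbb R^{2d}$ at time $t\in[0,T]$, driven by a $d$-dimensional Brownian motion $W$ on a probability space, is, for $s\in[t,T]$, $$\begin{aligned}d\tilde X^1_s&=F_1(s,\theta_{\tau,s}(\xi))\,ds+\sigma(s,\theta_{\tau,s}(\xi))\,dW_s,\\ d\tilde X^2_s&=\big[F_2(s,\theta_{\tau,s}(\xi))+D_1F_2(s,\theta_{\tau,s}(\xi))(\tilde X^1_s-\theta^1_{\tau,s}(\xi))\big]ds,\end{aligned}\qquad\tilde X_t=x.\tag{3.1}$$ **Proposition 3.1.** There are constants $\kappa,c,C>0$, depending only on the known parameters (not on $T$, $\tau$, $\xi$ nor on the bounds on the derivatives), such that under (HR), for every $(\tau,\xi)\in[0,T]\times\mathbb R^{2d}$, the transport $\theta_{\tau,\cdot}(\xi)$ exists and is unique, and the following holds. Write $\theta_r=\theta_{\tau,r}(\xi)$. (i) For all $t\in[0,T]$ and $x\in\mathbb R^{2d}$ and every such $W$, (3.1) has a strong solution $\tilde X$ (continuous, adapted to the completed filtration of $W$), and every continuous solution with the same $W$ is indistinguishable from it. For $s\in[t,T]$, $\tilde X_s$ is square integrable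 with mean $m_{t,s}(x)=(m^1_{t,s}(x),m^2_{t,s}(x))$, $$\begin{aligned}m^1_{t,s}(x)&=x_1+\int_t^sF_1(r,\theta_r)\,dr,\\ m^2_{t,s}(x)&=x_2+\int_t^s\Big[F_2(r,\theta_r)+D_1F_2(r,\theta_r)(x_1-\theta^1_r)+D_1F_2(r,\theta_r)\int_t^rF_1(v,\theta_v)\,dv\Big]dr,\end{aligned}\tag{3.3}$$ and covariance matrix, with $R_{r,s}=\int_r^sD_1F_2(v,\theta_v)\,dv$, $$\tilde\Sigma_{t,s}=\begin{pmatrix}\int_t^sa(r,\theta_r)\,dr&\int_t^sa(r,\theta_r)R_{r,s}^*\,dr\\ \int_t^sR_{r,s}\,a(r,\theta_r)\,dr&\int_t^sR_{r,s}\,a(r,\theta_r)R_{r,s}^*\,dr\end{pmatrix},\tag{3.4}$$ which is uniformly non-degenerate: for $0\le t<s\le T$ and $\zeta=(\zeta_1,\zeta_2)\in\mathbb R^{2d}$, $$\tilde\Sigma_{t,s}\zeta\cdot\zeta\ge\kappa\big((s-t)|\zeta_1|^2+(s-t)^3|\zeta_2|^2\big).$$ (ii) $\tilde X$ is a Gaussian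 process on $[t,T]$ with transition density $$\tilde q(t,x;s,y)=\frac1{(2\pi)^d}(\det\tilde\Sigma_{t,s})^{-1/2}\exp\Big(-\tfrac12\big|\tilde\Sigma_{t,s}^{-1/2}(y-m_{t,s}(x))\big|^2\Big),\qquad t<s\le T,\tag{3.5}$$ that is, for $t\le r<s\le T$ the conditional law of $\tilde X_s$ given $(W_u)_{u\le r}$ has density $\tilde q(r,\tilde X_r;s,\cdot)$. (iii) $\tilde q$ is a fundamental solution on $[0,T]$ of $\partial_t+\tilde{\mathcal L}_t$, where $$\tilde{\mathcal L}_t=\tfrac12\mathrm{Tr}\big[a(t,\theta_t)D_{x_1}^2\big]+F_1(t,\theta_t)\cdot D_{x_1}+\big[F_2(t,\theta_t)+D_1F_2(t,\theta_t)(x_1-\theta^1_t)\big]\cdot D_{x_2}.\tag{3.6}$$ That is, for all $s\in(0,T]$ and $y\in\mathbb R^{2d}$, $\tilde q(\cdot,\cdot;s,y)$ is smooth in $x$, is jointly continuous in $(t,x)\in[0,s)\times\mathbb R^{2d}$ together with its first and second derivatives in $x$, and satisfies $\partial_t\tilde q+\tilde{\mathcal L}_t\tilde q=0$ on $[0,s)\times\mathbb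 R^{2d}$ ($\partial_t$ being the right derivative at $t=0$ and at $t=\tau$, where the frozen coefficients may jump); $\tilde q(t,x;s,\cdot)$ is integrable for $0\le t<s$; and for every bounded continuous $f$ and every $x_0$, $\int\tilde q(t,x;s,y)f(y)\,dy\to f(x_0)$ as $t\uparrow s$, $x\to x_0$. (iv) For $0\le t<s\le T$, $\tilde q(t,x;s,y)$ is smooth in $(x,y)$ and, with $$\hat q_c(t,x;s,y)=\frac c{(s-t)^{2d}}\exp\Big(-c\Big(\frac{|y_1-m^1_{t,s}(x)|^2}{s-t}+\frac{|y_2-m^2_{t,s}(x)|^2}{(s-t)^3}\Big)\Big),$$ one has, for all $x,y\in\mathbb R^{2d}$ and all integers $0\le N^{x_1},N^{x_2},N^{y_1}\le2$, $$\tilde q(t,x;s,y)\le C\,\hat q_c(t,x;s,y),\tag{3.7}$$ $$\big|D_{x_1}^{N^{x_1}}D_{x_2}^{N^{x_2}}D_{y_1}^{N^{y_1}}\tilde q(t,x;s,y)\big|\le C(s-t)^{-[3N^{x_2}+N^{x_1}+N^{y_1}]/2}\,\hat q_c(t,x;s,y).\tag{3.8}$$ -/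

import Mathlib

open MeasureTheory ProbabilityTheory Filter Set
open scoped Topology NNReal ENNReal BoundedContinuousFunction

noncomputable section

namespace FrozenSystem

/-- The space `ℝ^d` with its Euclidean norm. -/
abbrev Vec (d : ℕ) := EuclideanSpace ℝ (Fin d)

/-- The state space `ℝ^d × ℝ^d`, with points `x = (x₁, x₂)`. -/
abbrev State (d : ℕ) := Vec d × Vec d

/-- Real `d × d` matrices, as linear maps of the Euclidean space `ℝ^d`, with the operator norm. -/
abbrev Mat (d : ℕ) := Vec d →L[ℝ] Vec d

/-- The coefficients `F₁`, `F₂`, `σ` of the system; only times in `[0, T]` matter. -/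
structure Coefficients (d : ℕ) where
  F₁ : ℝ → State d → Vec d
  F₂ : ℝ → State d → Vec d
  σ : ℝ → State d → Mat d

/-- The known parameters: Hölder and Lipschitz constants and exponents, the ellipticity constant,
and the closed convex set of invertible matrices which contains the values of `D₁F₂`. -/
structure KnownParameters (d : ℕ) where
  C₁ : ℝ
  C₂ : ℝ
  Cσ : ℝ
  β₁₁ : ℝ
  β₁₂ : ℝ
  β₂₂ : ℝ
  Λ : ℝ
  Cbar₂ : ℝ
  α₁ : ℝ
  𝓔 : Set (Mat d)

namespace Coefficients

variable {d : ℕ} (b : Coefficients d)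

/-- The full drift `F = (F₁, F₂)`. -/
def F (t : ℝ) (x : State d) : State d := (b.F₁ t x, b.F₂ t x)

/-- The diffusion matrix `a = σ σ*`. -/
def a (t : ℝ) (x : State d) : Mat d := b.σ t x ∘L (b.σ t x).adjoint

/-- The derivative `D₁F₂` of `F₂` in the variable `x₁`. -/
def D₁F₂ (t : ℝ) (x : State d) : Mat d := fderiv ℝ (fun z : Vec d => b.F₂ t (z, x.2)) x.1

end Coefficients

/-- Hypotheses (H) on the coefficients, with given known parameters. -/
structure AssumptionH {d : ℕ} (p : KnownParameters d) (T : ℝ) (b : Coefficients d) : Prop where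
  C₁_pos : 0 < p.C₁
  C₂_pos : 0 < p.C₂
  Cσ_pos : 0 < p.Cσ
  β₁₁_mem : p.β₁₁ ∈ Ioo (2 / 3 : ℝ) 1
  β₁₂_mem : p.β₁₂ ∈ Ioo (2 / 3 : ℝ) 1
  β₂₂_mem : p.β₂₂ ∈ Ioo (2 / 3 : ℝ) 1
  F₁_holder : ∀ t ∈ Icc 0 T, ∀ x y : State d,
    ‖b.F₁ t x - b.F₁ t y‖ ≤ p.C₁ * (‖x.1 - y.1‖ ^ p.β₁₁ + ‖x.2 - y.2‖ ^ p.β₁₂)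
  F₂_holder : ∀ t ∈ Icc 0 T, ∀ x y : State d,
    ‖b.F₂ t x - b.F₂ t y‖ ≤ p.C₂ * (‖x.1 - y.1‖ + ‖x.2 - y.2‖ ^ p.β₂₂)
  σ_lipschitz : ∀ t ∈ Icc 0 T, ∀ x y : State d,
    ‖b.σ t x - b.σ t y‖ ≤ p.Cσ * (‖x.1 - y.1‖ + ‖x.2 - y.2‖)
  F₁_time : ∀ x, ContinuousOn (fun t => b.F₁ t x) (Icc 0 T)
  F₂_time : ∀ x, ContinuousOn (fun t => b.F₂ t x) (Icc 0 T)
  σ_time : ∀ x, ContinuousOn (fun t => b.σ t x) (Icc 0 T)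
  Λ_gt : 1 < p.Λ
  elliptic : ∀ t ∈ Icc 0 T, ∀ (x : State d) (ζ : Vec d),
    p.Λ⁻¹ * ‖ζ‖ ^ 2 ≤ inner ℝ (b.a t x ζ) ζ ∧ inner ℝ (b.a t x ζ) ζ ≤ p.Λ * ‖ζ‖ ^ 2
  F₂_diff : ∀ t ∈ Icc 0 T, ∀ x₂ : Vec d, ContDiff ℝ 1 (fun x₁ : Vec d => b.F₂ t (x₁, x₂))
  α₁_mem : p.α₁ ∈ Ioo (0 : ℝ) 1
  Cbar₂_pos : 0 < p.Cbar₂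
  D₁F₂_holder : ∀ t ∈ Icc 0 T, ∀ x₁ y₁ x₂ : Vec d,
    ‖b.D₁F₂ t (x₁, x₂) - b.D₁F₂ t (y₁, x₂)‖ ≤ p.Cbar₂ * ‖x₁ - y₁‖ ^ p.α₁
  𝓔_closed : IsClosed p.𝓔
  𝓔_convex : Convex ℝ p.𝓔
  𝓔_invertible : ∀ A ∈ p.𝓔, IsUnit A
  D₁F₂_mem : ∀ t ∈ Icc 0 T, ∀ x : State d, b.D₁F₂ t x ∈ p.𝓔

/-- A function on `[0, T] × ℝ^d × ℝ^d` is infinitely differentiable, and its space derivatives of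
every order `k ≥ 1` are bounded. -/
structure SmoothBoundedDerivs {d : ℕ} {G : Type*} [NormedAddCommGroup G] [NormedSpace ℝ G]
    (T : ℝ) (f : ℝ → State d → G) : Prop where
  smooth : ContDiffOn ℝ (⊤ : ℕ∞) (fun z : ℝ × State d => f z.1 z.2) (Icc 0 T ×ˢ univ)
  bounded : ∀ k : ℕ, 1 ≤ k → ∃ M : ℝ, ∀ t ∈ Icc 0 T, ∀ x, ‖iteratedFDeriv ℝ k (f t) x‖ ≤ M

/-- Hypotheses (HR): hypotheses (H), and `F₁`, `F₂`, `a` are smooth with bounded derivatives. The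
bounds on these derivatives are not among the known parameters. -/
structure AssumptionHR {d : ℕ} (p : KnownParameters d) (T : ℝ) (b : Coefficients d) : Prop
    extends AssumptionH p T b where
  F₁_smooth : SmoothBoundedDerivs T b.F₁
  F₂_smooth : SmoothBoundedDerivs T b.F₂
  a_smooth : SmoothBoundedDerivs T b.a

/-- `θ` is the transport `s ↦ θ_{τ,s}(ξ)`: the solution on `[τ, T]` of `θ' = F(s, θ)` with
`θ_τ = ξ`, extended by `0` to the times before `τ`. -/
structure IsTransport {d : ℕ} (b : Coefficients d) (T τ : ℝ) (ξ : State d) (θ : ℝ → State d) :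
    Prop where
  init : θ τ = ξ
  ode : ∀ s ∈ Icc τ T, HasDerivWithinAt θ (b.F s (θ s)) (Icc τ T) s
  before : ∀ s < τ, θ s = 0

section Gaussian

variable {d : ℕ} (b : Coefficients d) (θ : ℝ → State d)

/-- The first component `m¹_{t,s}(x)` of the mean. -/
def mean₁ (t s : ℝ) (x : State d) : Vec d := x.1 + ∫ r in t..s, b.F₁ r (θ r)

/-- The second component `m²_{t,s}(x)` of the mean. -/
def mean₂ (t s : ℝ) (x : State d) : Vec d :=
  x.2 + ∫ r in t..s, (b.F₂ r (θ r) + b.D₁F₂ r (θ r) (x.1 - (θ r).1)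
    + b.D₁F₂ r (θ r) (∫ v in t..r, b.F₁ v (θ v)))

/-- `R_{r,s} = ∫_r^s D₁F₂(v, θ_v) dv`. -/
def R (r s : ℝ) : Mat d := ∫ v in r..s, b.D₁F₂ v (θ v)

/-- The array of coefficients of a linear map of `ℝ^d` in the canonical basis. -/
def entries (A : Mat d) : Matrix (Fin d) (Fin d) ℝ :=
  Matrix.of fun i j => A (EuclideanSpace.single j 1) i

/-- The coordinates of a point of `ℝ^d × ℝ^d`, as a vector with `2d` entries. -/
def coords (z : State d) : Fin d ⊕ Fin d → ℝ := Sum.elim (fun i => z.1 i) (fun i => z.2 i)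

/-- The covariance matrix `Σ_{t,s}`, with `R = R_{r,s}` and `a = a(r, θ_r)` in the integrals. -/
def covMatrix (t s : ℝ) : Matrix (Fin d ⊕ Fin d) (Fin d ⊕ Fin d) ℝ :=
  Matrix.fromBlocks
    (entries (∫ r in t..s, b.a r (θ r)))
    (entries (∫ r in t..s, b.a r (θ r) ∘L (R b θ r s).adjoint))
    (entries (∫ r in t..s, R b θ r s ∘L b.a r (θ r)))
    (entries (∫ r in t..s, R b θ r s ∘L b.a r (θ r) ∘L (R b θ r s).adjoint))

/-- The deviation `y - m_{t,s}(x)`, as a vector with `2d` entries. -/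
def deviation (t : ℝ) (x : State d) (s : ℝ) (y : State d) : Fin d ⊕ Fin d → ℝ :=
  coords (y.1 - mean₁ b θ t s x, y.2 - mean₂ b θ t s x)

/-- The Gaussian density with mean `m_{t,s}(x)` and covariance `Σ_{t,s}` on `ℝ^d × ℝ^d`. -/
def density (t : ℝ) (x : State d) (s : ℝ) (y : State d) : ℝ :=
  ((2 * Real.pi) ^ d)⁻¹ * (Real.sqrt (covMatrix b θ t s).det)⁻¹ *
    Real.exp (-(1 / 2) *
      (deviation b θ t x s y ⬝ᵥ ((covMatrix b θ t s)⁻¹).mulVec (deviation b θ t x s y)))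

/-- The degenerate Gaussian kernel `q̂_c` that serves as the upper bound. -/
def boundKernel (c t : ℝ) (x : State d) (s : ℝ) (y : State d) : ℝ :=
  c / (s - t) ^ (2 * d) *
    Real.exp (-c * (‖y.1 - mean₁ b θ t s x‖ ^ 2 / (s - t)
      + ‖y.2 - mean₂ b θ t s x‖ ^ 2 / (s - t) ^ 3))

/-- The frozen operator at time `t`, applied to `g` at `x`. -/
def frozenOperator (t : ℝ) (g : State d → ℝ) (x : State d) : ℝ :=
  (1 / 2) * (∑ i, ∑ j, entries (b.a t (θ t)) i j *
      iteratedFDeriv ℝ 2 (fun z : Vec d => g (z, x.2)) x.1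
        ![EuclideanSpace.single i 1, EuclideanSpace.single j 1])
    + fderiv ℝ (fun z : Vec d => g (z, x.2)) x.1 (b.F₁ t (θ t))
    + fderiv ℝ (fun z : Vec d => g (x.1, z)) x.2
        (b.F₂ t (θ t) + b.D₁F₂ t (θ t) (x.1 - (θ t).1))

end Gaussian

/-- The norm of the mixed derivative `D_{x₁}^{k₁} D_{x₂}^{k₂} D_{y₁}^{l₁} q(x₁, x₂; y₁, y₂)`. -/
def mixedDerivNorm {d : ℕ} (k₁ k₂ l₁ : ℕ) (q : State d → State d → ℝ) (x y : State d) : ℝ :=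
  ‖iteratedFDeriv ℝ k₁ (fun x₁ : Vec d =>
    iteratedFDeriv ℝ k₂ (fun x₂ : Vec d =>
      iteratedFDeriv ℝ l₁ (fun y₁ : Vec d => q (x₁, x₂) (y₁, y.2)) y.1) x.2) x.1‖

/-- `q` is a fundamental solution of `∂_t + L_t` on `[0, T]`, where the coefficients of `L` may jump
at the time `τ`: for every `s ∈ (0, T]` and `y`, the function `(t, x) ↦ q(t, x; s, y)` is a classical
solution of `∂_t q + L_t q = 0` on `[0, s)` (with the right derivative in time at the times `0` and
`τ`), and `q(t, x; s, y) dy` converges to the Dirac mass at `x₀` as `(t, x) → (s-, x₀)`. -/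
structure IsFundamentalSolution {d : ℕ} (T τ : ℝ) (L : ℝ → (State d → ℝ) → State d → ℝ)
    (q : ℝ → State d → ℝ → State d → ℝ) : Prop where
  smooth : ∀ s ∈ Ioc 0 T, ∀ y, ∀ t ∈ Ico 0 s, ContDiff ℝ (⊤ : ℕ∞) (fun x => q t x s y)
  continuous : ∀ s ∈ Ioc 0 T, ∀ y, ∀ k : ℕ, k ≤ 2 →
    ContinuousOn (fun z : ℝ × State d => iteratedFDeriv ℝ k (fun x => q z.1 x s y) z.2)
      (Ico 0 s ×ˢ univ)
  pde_right : ∀ s ∈ Ioc 0 T, ∀ y, ∀ t ∈ Ico 0 s, ∀ x,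
    HasDerivWithinAt (fun t' => q t' x s y) (-(L t (fun x' => q t x' s y) x)) (Ici t) t
  pde : ∀ s ∈ Ioc 0 T, ∀ y, ∀ t ∈ Ioo 0 s, t ≠ τ → ∀ x,
    HasDerivAt (fun t' => q t' x s y) (-(L t (fun x' => q t x' s y) x)) t
  integrable : ∀ s ∈ Ioc 0 T, ∀ t ∈ Ico 0 s, ∀ x, Integrable (fun y => q t x s y)
  terminal : ∀ s ∈ Ioc 0 T, ∀ (f : State d →ᵇ ℝ) (x₀ : State d),
    Tendsto (fun z : ℝ × State d => ∫ y, q z.1 z.2 s y * f y) (𝓝[<] s ×ˢ 𝓝 x₀) (𝓝 (f x₀))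

section Stochastic

variable {d : ℕ} {Ω : Type*} {mΩ : MeasurableSpace Ω}

/-- `W` is a `d`-dimensional Brownian motion: its coordinates are independent real Brownian
motions. -/
structure IsBrownian (W : ℝ≥0 → Ω → Vec d) (P : Measure Ω) : Prop where
  measurable : ∀ s, Measurable (W s)
  coord : ∀ i, IsBrownianReal (fun s ω => W s ω i) P
  indep : iIndepFun (fun (i : Fin d) (ω : Ω) (s : ℝ≥0) => W s ω i) P

/-- The σ-algebra generated by `W` up to time `s`. -/
@[reducible] def history (W : ℝ≥0 → Ω → Vec d) (s : ℝ) : MeasurableSpace Ω :=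
  ⨆ (u : ℝ≥0) (_ : (u : ℝ) ≤ s), MeasurableSpace.comap (W u) inferInstance

/-- The step function with value `A i` on `(π i, π (i + 1)]` for `i < n`. -/
def stepFun (n : ℕ) (π : ℕ → ℝ) (A : ℕ → Mat d) (r : ℝ) : Mat d :=
  ∑ i ∈ Finset.range n, (Ioc (π i) (π (i + 1))).indicator (fun _ => A i) r

/-- The stochastic integral of a step function. -/
def stepIntegral (W : ℝ≥0 → Ω → Vec d) (n : ℕ) (π : ℕ → ℝ) (A : ℕ → Mat d) (ω : Ω) : Vec d :=
  ∑ i ∈ Finset.range n, A i (W (π (i + 1)).toNNReal ω - W (π i).toNNReal ω)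

/-- `I` is (a version of) the stochastic integral `∫_α^β g(r) dW_r` of the deterministic matrix
function `g`: the limit in `L²(P)` of the integrals of step functions on `(α, β]` which converge to
`g` in `L²(α, β)`. -/
def IsWienerIntegral (P : Measure Ω) (W : ℝ≥0 → Ω → Vec d) (g : ℝ → Mat d) (α β : ℝ)
    (I : Ω → Vec d) : Prop :=
  AEStronglyMeasurable I P ∧
  ∃ (n : ℕ → ℕ) (π : ℕ → ℕ → ℝ) (A : ℕ → ℕ → Mat d),
    (∀ k, Monotone (π k) ∧ π k 0 = α ∧ π k (n k) = β) ∧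
    Tendsto (fun k => eLpNorm (fun r => stepFun (n k) (π k) (A k) r - g r) 2
      (volume.restrict (Ioc α β))) atTop (𝓝 0) ∧
    Tendsto (fun k => eLpNorm (fun ω => stepIntegral W (n k) (π k) (A k) ω - I ω) 2 P)
      atTop (𝓝 0)

/-- `X` is a continuous process on `[t, T]` which solves the frozen system, driven by `W`, with
initial condition `x` at time `t`. -/
structure IsSolution (b : Coefficients d) (θ : ℝ → State d) (T : ℝ) (P : Measure Ω)
    (W : ℝ≥0 → Ω → Vec d) (t : ℝ) (x : State d) (X : ℝ → Ω → State d) : Prop where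
  continuous : ∀ᵐ ω ∂P, ContinuousOn (fun s => X s ω) (Icc t T)
  init : ∀ᵐ ω ∂P, X t ω = x
  eq₁ : ∀ s ∈ Icc t T, IsWienerIntegral P W (fun r => b.σ r (θ r)) t s
    (fun ω => (X s ω).1 - x.1 - ∫ r in t..s, b.F₁ r (θ r))
  eq₂ : ∀ᵐ ω ∂P, ∀ s ∈ Icc t T, (X s ω).2 = x.2 +
    ∫ r in t..s, (b.F₂ r (θ r) + b.D₁F₂ r (θ r) ((X r ω).1 - (θ r).1))

/-- A strong solution: moreover, `X` is adapted to the history of `W` completed by the null sets. -/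
structure IsStrongSolution (b : Coefficients d) (θ : ℝ → State d) (T : ℝ) (P : Measure Ω)
    (W : ℝ≥0 → Ω → Vec d) (t : ℝ) (x : State d) (X : ℝ → Ω → State d) : Prop
    extends IsSolution b θ T P W t x X where
  adapted : ∀ s ∈ Icc t T, AEStronglyMeasurable[history W s] (X s) P

/-- `X` is a Markov process on `[t, T]` with transition density `q`: given the history up to time
`r`, the law of `X_s` has the density `q(r, X_r; s, ·)`. -/
def HasTransitionDensity (T : ℝ) (P : Measure Ω) (W : ℝ≥0 → Ω → Vec d) (t : ℝ)
    (X : ℝ → Ω → State d) (q : ℝ → State d → ℝ → State d → ℝ) : Prop :=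
  ∀ r s, t ≤ r → r < s → s ≤ T → ∀ B : Set (State d), MeasurableSet B →
    P[(X s ⁻¹' B).indicator (fun _ => (1 : ℝ)) | history W r]
      =ᵐ[P] fun ω => ∫ y in B, q r (X r ω) s y

end Stochastic

end FrozenSystem

end

open FrozenSystem

noncomputable section

namespace FrozenSystem

/-! ### Global solutions of Lipschitz differential equations -/

/-! Along a fixed path `θ` the frozen system is linear with deterministic coefficients, so every
assertion is a Gaussian computation. Two things need an idea: a covariance bound whose constant
depends on the known parameters only, and the stochastic calculus of deterministic integrands, which
is built by hand.

Covariance. By `covMatrix_form` the quadratic form of Σ_{t,s} at ζ is ∫_t^s |σ_r^*φ_r|² dr with φ_r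
= ζ₁ + R_{r,s}^*ζ₂, so ellipticity reduces the problem to a lower bound for ∫|φ_r|². Comparing φ at
r and at r + (s-t)/2 eliminates ζ₁ and leaves R^*ζ₂ over an interval of length (s-t)/2. Now R is the
length of the interval times an average of D₁F₂. That average lies in the closed convex set 𝓔 and in
the ball of radius C₂, a compact set of invertible matrices, so R^* is bounded below by c₀ times the
length (`exists_frozenReg`). Without convexity an average of invertible matrices could be singular.
This yields (s-t)³|ζ₂|², and ζ₁ follows by the triangle inequality (`le_covMatrix`).

Gaussian bounds. Put q = √(s-t) and rescale the deviation by (q⁻¹, q⁻³). The inverse covariance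
becomes comparable to the identity and det Σ ≥ κ^{2d}q^{8d}. A derivative in x₁ or y₁ costs q⁻¹ and
one in x₂ costs q⁻³; the polynomial factors are absorbed by halving the exponential rate
(`mixedDerivNorm_le`).

Backward equation. Up to a product term in the mean, t enters only as an endpoint of integrals, so Σ
and the mean have explicit time derivatives, and Jacobi's formula turns them into the frozen
operator (`hasDerivWithinAt_density`). The path jumps at τ, so only right derivatives are claimed
there. The terminal condition is dominated convergence for f(m + √Σ Z) with Z standard Gaussian.

Stochastic part. The covariance of two coordinates of `W` is the L² inner product of the
corresponding indicator functions. Hence `W` extends to an isometry `J` of L²((0,∞); ℝ^d) into L²(P)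
with centred Gaussian values (`exists_isWienerMap`). Every Wiener integral defined by approximation
is a value of `J`, whence uniqueness. Existence uses Kolmogorov's criterion for a continuous version
of the noise, and Riemann sums exchange dr with dW in the second component. All linear functionals
of X_s are then constants plus values of `J` (`IsNoiseForm`), which gives moments, Gaussianity and
adaptedness. Cutting (t, s] at r writes X_s as m_{r,s}(X_r) plus a noise independent of the history
up to r, and this is the transition density. -/

theorem integral_mul_exp_le (K a t : ℝ) :
    ∫ s in a..t, K * Real.exp (2 * K * (s - a)) ≤ (1 / 2) * Real.exp (2 * K * (t - a)) := by
  have h : ∀ s ∈ uIcc a t, HasDerivAt (fun s => (1 / 2) * Real.exp (2 * K * (s - a)))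
      (K * Real.exp (2 * K * (s - a))) s := by
    intro s _
    have h1 : HasDerivAt (fun s => 2 * K * (s - a)) (2 * K * 1) s :=
      ((hasDerivAt_id s).sub_const a).const_mul (2 * K)
    have h2 := h1.exp.const_mul (1 / 2 : ℝ)
    exact h2.congr_deriv (by ring)
  rw [intervalIntegral.integral_eq_sub_of_hasDerivAt h
    (Continuous.intervalIntegrable (by fun_prop) _ _)]
  have := Real.exp_pos (2 * K * (a - a))
  linarith

/-- Picard iteration in a weighted norm. With θ = w·u and w(s) = exp(2K(s-a)), the integral equation
is a contraction of ratio 1/2 in the sup norm of u on the whole of [a, b], so no short-time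
solutions have to be glued. -/
theorem exists_solution_of_lipschitz {E : Type*} [NormedAddCommGroup E] [NormedSpace ℝ E]
    [CompleteSpace E] {v : ℝ → E → E} (hv : Continuous fun z : ℝ × E => v z.1 z.2) {K : ℝ}
    (hK : 0 < K) (hlip : ∀ t x y, ‖v t x - v t y‖ ≤ K * ‖x - y‖) {a b : ℝ} (hab : a ≤ b) (ξ : E) :
    ∃ θ : ℝ → E, θ a = ξ ∧ ∀ s ∈ Icc a b, HasDerivWithinAt θ (v s (θ s)) (Icc a b) s := by
  let w : ℝ → ℝ := fun s => Real.exp (2 * K * (s - a))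
  have hw : Continuous w := by fun_prop
  have hwpos : ∀ s, 0 < w s := fun s => Real.exp_pos _
  let ext : C(Icc a b, E) → ℝ → E := fun u => IccExtend hab u
  have hext : ∀ u, Continuous (ext u) := fun u => u.continuous.Icc_extend'
  have hint : ∀ u, Continuous fun s => v s (w s • ext u s) := fun u =>
    hv.comp (continuous_id.prodMk (hw.smul (hext u)))
  have hprim : ∀ u, Continuous fun t => ∫ s in a..t, v s (w s • ext u s) := fun u =>
    intervalIntegral.continuous_primitive (fun _ _ => (hint u).intervalIntegrable _ _) a
  let ψ : C(Icc a b, E) → C(Icc a b, E) := fun u =>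
    ⟨fun t => (w t)⁻¹ • (ξ + ∫ s in a..t, v s (w s • ext u s)), by
      have h1 : Continuous fun t : ℝ => (w t)⁻¹ • (ξ + ∫ s in a..t, v s (w s • ext u s)) :=
        (hw.inv₀ fun s => (hwpos s).ne').smul (continuous_const.add (hprim u))
      exact h1.comp continuous_subtype_val⟩
  have hψ : ContractingWith (1 / 2 : ℝ≥0) ψ := by
    refine ⟨by norm_num, LipschitzWith.of_dist_le_mul fun u u' => ?_⟩
    rw [ContinuousMap.dist_le (by positivity)]
    intro t
    have hat : a ≤ (t : ℝ) := t.2.1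
    have key : ‖∫ s in a..t, (v s (w s • ext u s) - v s (w s • ext u' s))‖
        ≤ ∫ s in a..t, dist u u' * (K * w s) := by
      refine intervalIntegral.norm_integral_le_of_norm_le hat (ae_of_all _ fun s hs => ?_)
        (Continuous.intervalIntegrable (by fun_prop) _ _)
      refine (hlip _ _ _).trans ?_
      rw [← smul_sub, norm_smul, Real.norm_of_nonneg (hwpos s).le]
      have : ‖ext u s - ext u' s‖ ≤ dist u u' := by
        rw [← dist_eq_norm]
        exact ContinuousMap.dist_apply_le_dist _
      calc K * (w s * ‖ext u s - ext u' s‖) ≤ K * (w s * dist u u') := by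
            have := (hwpos s).le
            gcongr
        _ = _ := by ring
    rw [intervalIntegral.integral_const_mul] at key
    have h2 := key.trans (mul_le_mul_of_nonneg_left (integral_mul_exp_le K a t) dist_nonneg)
    rw [intervalIntegral.integral_sub ((hint u).intervalIntegrable _ _)
      ((hint u').intervalIntegrable _ _)] at h2
    change dist ((w t)⁻¹ • (ξ + ∫ s in a..t, v s (w s • ext u s)))
      ((w t)⁻¹ • (ξ + ∫ s in a..t, v s (w s • ext u' s))) ≤ _
    rw [dist_eq_norm, ← smul_sub, norm_smul, add_sub_add_left_eq_sub,
      Real.norm_of_nonneg (inv_nonneg.2 (hwpos t).le)]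
    calc (w t)⁻¹ * _ ≤ (w t)⁻¹ * (dist u u' * (1 / 2 * w t)) :=
          mul_le_mul_of_nonneg_left h2 (inv_nonneg.2 (hwpos t).le)
      _ = (1 / 2 : ℝ≥0) * dist u u' := by
          have := (hwpos t).ne'
          push_cast
          field_simp
  obtain ⟨u, hu, -⟩ := hψ.exists_fixedPoint (0 : C(Icc a b, E)) (edist_ne_top _ _)
  have hu' : ∀ t (ht : t ∈ Icc a b), w t • ext u t = ξ + ∫ s in a..t, v s (w s • ext u s) := by
    intro t ht
    have h1 : ext u t = u ⟨t, ht⟩ := IccExtend_of_mem hab u ht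
    have h2 : ψ u ⟨t, ht⟩ = u ⟨t, ht⟩ := by rw [hu]
    rw [h1, ← h2]
    change w t • ((w t)⁻¹ • (ξ + ∫ s in a..t, v s (w s • ext u s))) = _
    rw [smul_smul, mul_inv_cancel₀ (hwpos t).ne', one_smul]
  refine ⟨fun t => w t • ext u t, ?_, fun s hs => ?_⟩
  · have := hu' a ⟨le_rfl, hab⟩
    simpa using this
  · have h1 : HasDerivAt (fun t => ξ + ∫ s in a..t, v s (w s • ext u s)) (v s (w s • ext u s)) s :=
      (intervalIntegral.integral_hasDerivAt_right ((hint u).intervalIntegrable _ _)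
        (hint u).stronglyMeasurable.stronglyMeasurableAtFilter (hint u).continuousAt).const_add ξ
    exact h1.hasDerivWithinAt.congr_of_mem (fun t ht => hu' t ht) hs

/-! ### Piecewise continuous functions of time -/

/-- `k` coincides with a continuous function on `[0, τ)` and with another one on `[τ, T]`. -/
def PW {E : Type*} [TopologicalSpace E] (T τ : ℝ) (k : ℝ → E) : Prop :=
  ∃ g h : ℝ → E, Continuous g ∧ Continuous h ∧ EqOn k g (Ico 0 τ) ∧ EqOn k h (Icc τ T)

namespace PW

variable {E G H : Type*} [TopologicalSpace G] [TopologicalSpace H] {T τ : ℝ}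

theorem comp {k : ℝ → G} (hk : PW T τ k) {φ : G → H} (hφ : Continuous φ) :
    PW T τ fun r => φ (k r) := by
  obtain ⟨g, h, hg, hh, h1, h2⟩ := hk
  exact ⟨_, _, hφ.comp hg, hφ.comp hh, fun r hr => congrArg φ (h1 hr), fun r hr => congrArg φ (h2 hr)⟩

theorem prodMk {k : ℝ → G} {l : ℝ → H} (hk : PW T τ k) (hl : PW T τ l) :
    PW T τ fun r => (k r, l r) := by
  obtain ⟨g, h, hg, hh, h1, h2⟩ := hk
  obtain ⟨g', h', hg', hh', h1', h2'⟩ := hl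
  exact ⟨_, _, hg.prodMk hg', hh.prodMk hh', fun r hr => Prod.ext (h1 hr) (h1' hr),
    fun r hr => Prod.ext (h2 hr) (h2' hr)⟩

theorem of_continuousOn {k : ℝ → G} (hT : 0 ≤ T) (hk : ContinuousOn k (Icc 0 T))
    (hτ : τ ∈ Icc 0 T) : PW T τ k := by
  refine ⟨IccExtend hT ((Icc 0 T).domRestrict k), IccExtend hT ((Icc 0 T).domRestrict k),
    hk.domRestrict.Icc_extend', hk.domRestrict.Icc_extend', fun r hr => ?_, fun r hr => ?_⟩
  · rw [IccExtend_of_mem hT _ ⟨hr.1, hr.2.le.trans hτ.2⟩]; rfl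
  · rw [IccExtend_of_mem hT _ ⟨hτ.1.trans hr.1, hr.2⟩]; rfl

/-- A representative of a piecewise continuous function, defined on the whole line. -/
theorem exists_piecewise {k : ℝ → G} (hk : PW T τ k) : ∃ g h : ℝ → G, Continuous g ∧ Continuous h ∧
    EqOn k ((Iio τ).piecewise g h) (Icc 0 T) := by
  obtain ⟨g, h, hg, hh, h1, h2⟩ := hk
  refine ⟨g, h, hg, hh, fun r hr => ?_⟩
  by_cases hrτ : r < τ
  · rw [piecewise_eq_of_mem _ _ _ (mem_Iio.2 hrτ)]; exact h1 ⟨hr.1, hrτ⟩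
  · rw [piecewise_eq_of_notMem _ _ _ (by simpa using hrτ)]; exact h2 ⟨not_lt.1 hrτ, hr.2⟩

/-- The value at τ belongs to the right branch, so right continuity holds at τ as well, while left
continuity may fail there. All statements about right derivatives rest on this. -/
theorem continuousWithinAt {k : ℝ → G} (hk : PW T τ k) {t : ℝ} (h0 : 0 ≤ t) (hT : t < T) :
    ContinuousWithinAt k (Ici t) t := by
  obtain ⟨g, h, hg, hh, h1, h2⟩ := hk
  by_cases htτ : t < τ
  · refine hg.continuousAt.continuousWithinAt.congr_of_eventuallyEq ?_ (h1 ⟨h0, htτ⟩)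
    filter_upwards [self_mem_nhdsWithin, nhdsWithin_le_nhds (Iio_mem_nhds htτ)] with r hr hr'
    exact h1 ⟨h0.trans hr, hr'⟩
  · have htτ := not_lt.1 htτ
    refine hh.continuousAt.continuousWithinAt.congr_of_eventuallyEq ?_ (h2 ⟨htτ, hT.le⟩)
    filter_upwards [self_mem_nhdsWithin, nhdsWithin_le_nhds (Iio_mem_nhds hT)] with r hr hr'
    exact h2 ⟨htτ.trans hr, le_of_lt hr'⟩

theorem continuousAt {k : ℝ → G} (hk : PW T τ k) {t : ℝ} (h0 : 0 < t) (hT : t < T) (ht : t ≠ τ) :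
    ContinuousAt k t := by
  obtain ⟨g, h, hg, hh, h1, h2⟩ := hk
  rcases lt_or_gt_of_ne ht with htτ | htτ
  · refine hg.continuousAt.congr ?_
    filter_upwards [Ioi_mem_nhds h0, Iio_mem_nhds htτ] with r hr hr'
    exact (h1 ⟨le_of_lt hr, hr'⟩).symm
  · refine hh.continuousAt.congr ?_
    filter_upwards [Ioi_mem_nhds htτ, Iio_mem_nhds hT] with r hr hr'
    exact (h2 ⟨le_of_lt hr, le_of_lt hr'⟩).symm

variable [NormedAddCommGroup E]

theorem exists_bound {k : ℝ → E} (hk : PW T τ k) : ∃ M, 0 ≤ M ∧ ∀ r ∈ Icc 0 T, ‖k r‖ ≤ M := by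
  obtain ⟨g, h, hg, hh, he⟩ := hk.exists_piecewise
  obtain ⟨M, hM⟩ := (isCompact_Icc (a := (0 : ℝ)) (b := T)).exists_bound_of_continuousOn
    hg.continuousOn
  obtain ⟨M', hM'⟩ := (isCompact_Icc (a := (0 : ℝ)) (b := T)).exists_bound_of_continuousOn
    hh.continuousOn
  refine ⟨max 0 (max M M'), le_max_left _ _, fun r hr => ?_⟩
  rw [he hr]
  by_cases hrτ : r < τ
  · rw [piecewise_eq_of_mem _ _ _ (mem_Iio.2 hrτ)]
    exact (hM r hr).trans (by simp)
  · rw [piecewise_eq_of_notMem _ _ _ (by simpa using hrτ)]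
    exact (hM' r hr).trans (by simp)

theorem aestronglyMeasurable {k : ℝ → E} (hk : PW T τ k) :
    AEStronglyMeasurable k (volume.restrict (Icc 0 T)) := by
  obtain ⟨g, h, hg, hh, he⟩ := hk.exists_piecewise
  refine AEStronglyMeasurable.congr (f := (Iio τ).piecewise g h) ?_ ?_
  · exact (StronglyMeasurable.piecewise measurableSet_Iio hg.stronglyMeasurable
      hh.stronglyMeasurable).aestronglyMeasurable
  · filter_upwards [ae_restrict_mem measurableSet_Icc] with r hr
    exact (he hr).symm

theorem integrableOn {k : ℝ → E} (hk : PW T τ k) : IntegrableOn k (Icc 0 T) := by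
  obtain ⟨M, -, hM⟩ := hk.exists_bound
  refine Integrable.of_bound hk.aestronglyMeasurable M ?_
  filter_upwards [ae_restrict_mem measurableSet_Icc] with r hr using hM r hr

theorem intervalIntegrable {k : ℝ → E} (hk : PW T τ k) {t s : ℝ} (ht : t ∈ Icc 0 T)
    (hs : s ∈ Icc 0 T) : IntervalIntegrable k volume t s := by
  rw [intervalIntegrable_iff]
  exact hk.integrableOn.mono_set (uIoc_subset_uIcc.trans (uIcc_subset_Icc ht hs))

variable [NormedSpace ℝ E]

theorem continuousOn_integral_right {k : ℝ → E} (hk : PW T τ k) (t : ℝ) (ht : t ∈ Icc 0 T) :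
    ContinuousOn (fun s => ∫ r in t..s, k r) (Icc 0 T) := by
  have hT : (0 : ℝ) ≤ T := ht.1.trans ht.2
  have := intervalIntegral.continuousOn_primitive_interval' (μ := volume) (f := k) (a := t)
    (b₁ := 0) (b₂ := T) (hk.intervalIntegrable ⟨le_rfl, hT⟩ ⟨hT, le_rfl⟩)
    (by rwa [uIcc_of_le hT])
  rwa [uIcc_of_le hT] at this

theorem continuousOn_integral_left {k : ℝ → E} (hk : PW T τ k) (s : ℝ) (hs : s ∈ Icc 0 T) :
    ContinuousOn (fun t => ∫ r in t..s, k r) (Icc 0 T) := by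
  refine (hk.continuousOn_integral_right s hs).neg.congr fun t _ => ?_
  exact intervalIntegral.integral_symm s t

theorem hasDerivWithinAt_integral_left [CompleteSpace E] {k : ℝ → E} (hk : PW T τ k) {t s : ℝ}
    (h0 : 0 ≤ t) (hts : t < s) (hsT : s ≤ T) :
    HasDerivWithinAt (fun t => ∫ r in t..s, k r) (-k t) (Ici t) t := by
  have hT := h0.trans (hts.le.trans hsT)
  refine intervalIntegral.integral_hasDerivWithinAt_left
    (hk.intervalIntegrable ⟨h0, hts.le.trans hsT⟩ ⟨h0.trans hts.le, hsT⟩) (t := Ioi t) ?_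
    ((hk.continuousWithinAt h0 (hts.trans_le hsT)).mono Ioi_subset_Ici_self)
  refine ⟨Icc 0 T, ?_, hk.aestronglyMeasurable⟩
  filter_upwards [self_mem_nhdsWithin, nhdsWithin_le_nhds (Iio_mem_nhds (hts.trans_le hsT))]
    with r hr hr'
  exact ⟨h0.trans (le_of_lt hr), le_of_lt hr'⟩

theorem hasDerivAt_integral_left [CompleteSpace E] {k : ℝ → E} (hk : PW T τ k) {t s : ℝ}
    (h0 : 0 < t) (hts : t < s) (hsT : s ≤ T) (ht : t ≠ τ) :
    HasDerivAt (fun t => ∫ r in t..s, k r) (-k t) t := by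
  refine intervalIntegral.integral_hasDerivAt_left
    (hk.intervalIntegrable ⟨h0.le, hts.le.trans hsT⟩ ⟨h0.le.trans hts.le, hsT⟩) ?_
    (hk.continuousAt h0 (hts.trans_le hsT) ht)
  exact ⟨Icc 0 T, Icc_mem_nhds h0 (hts.trans_le hsT), hk.aestronglyMeasurable⟩

end PW

/-! ### Regularity of the coefficients -/

section Regularity

variable {d : ℕ} {G : Type*} [NormedAddCommGroup G] [NormedSpace ℝ G] {T : ℝ}
  {f : ℝ → State d → G}

theorem SmoothBoundedDerivs.contDiff (hf : SmoothBoundedDerivs T f) {t : ℝ} (ht : t ∈ Icc 0 T) :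
    ContDiff ℝ (⊤ : ℕ∞) (f t) := by
  rw [← contDiffOn_univ]
  exact hf.smooth.comp (g := fun z : ℝ × State d => f z.1 z.2) (f := fun x => (t, x))
    (contDiff_prodMk_right t).contDiffOn fun x _ => ⟨ht, mem_univ x⟩

theorem SmoothBoundedDerivs.exists_lipschitz (hf : SmoothBoundedDerivs T f) :
    ∃ K : ℝ≥0, ∀ t ∈ Icc 0 T, LipschitzWith K (f t) := by
  obtain ⟨M, hM⟩ := hf.bounded 1 le_rfl
  refine ⟨M.toNNReal, fun t ht => lipschitzWith_of_nnnorm_fderiv_le (𝕜 := ℝ)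
    ((hf.contDiff ht).differentiable (by simp)) fun x => ?_⟩
  rw [← NNReal.coe_le_coe, coe_nnnorm, ← norm_iteratedFDeriv_one]
  exact (hM t ht x).trans (Real.le_coe_toNNReal M)

/-- Smoothness in time is one-sided at 0 and T, so the joint derivative is taken within the slab,
where T > 0 gives unique differentiability. Composing it with the inclusion `ι` of the x₁ directions
gives the partial derivative. -/
theorem continuousOn_fderiv_fst {f : ℝ → State d → G} (hT : 0 < T)
    (hf : SmoothBoundedDerivs T f) :
    ContinuousOn (fun z : ℝ × State d => fderiv ℝ (fun y : Vec d => f z.1 (y, z.2.2)) z.2.1)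
      (Icc 0 T ×ˢ univ) := by
  let φ : ℝ × State d → G := fun z => f z.1 z.2
  have hu : UniqueDiffOn ℝ (Icc 0 T ×ˢ (univ : Set (State d))) :=
    (uniqueDiffOn_Icc hT).prod uniqueDiffOn_univ
  have h1 : ContinuousOn (fderivWithin ℝ φ (Icc 0 T ×ˢ univ)) (Icc 0 T ×ˢ univ) :=
    hf.smooth.continuousOn_fderivWithin hu (by simp)
  let ι : Vec d →L[ℝ] ℝ × State d :=
    (ContinuousLinearMap.inr ℝ ℝ (State d)).comp (ContinuousLinearMap.inl ℝ (Vec d) (Vec d))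
  refine (h1.clm_comp (continuousOn_const (c := ι))).congr fun z hz => ?_
  have h2 : HasFDerivWithinAt φ (fderivWithin ℝ φ (Icc 0 T ×ˢ univ) z) (Icc 0 T ×ˢ univ) z :=
    (hf.smooth.differentiableOn (by simp) z hz).hasFDerivWithinAt
  have h3 : HasFDerivAt (fun y : Vec d => ((z.1, (y, z.2.2)) : ℝ × State d)) ι z.2.1 := by
    have := (hasFDerivAt_const z.1 z.2.1).prodMk
      ((hasFDerivAt_id (𝕜 := ℝ) z.2.1).prodMk (hasFDerivAt_const z.2.2 z.2.1))
    convert! this using 1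
  have h4 := HasFDerivWithinAt.comp (t := Icc 0 T ×ˢ univ) (g := φ) z.2.1 h2
    (h3.hasFDerivWithinAt (s := univ)) fun y _ => ⟨hz.1, mem_univ _⟩
  exact (hasFDerivWithinAt_univ.1 h4).fderiv

end Regularity

/-! ### The transport -/

section Transport

variable {d : ℕ} {b : Coefficients d} {p : KnownParameters d} {T τ : ℝ} {ξ : State d}
  {θ θ' : ℝ → State d}

theorem AssumptionHR.exists_lipschitz (h : AssumptionHR p T b) :
    ∃ K : ℝ≥0, 0 < K ∧ ∀ t ∈ Icc 0 T, LipschitzWith K (b.F t) := by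
  obtain ⟨K₁, h₁⟩ := h.F₁_smooth.exists_lipschitz
  obtain ⟨K₂, h₂⟩ := h.F₂_smooth.exists_lipschitz
  refine ⟨max K₁ K₂ + 1, by positivity, fun t ht => ?_⟩
  exact ((h₁ t ht).prodMk (h₂ t ht)).weaken (by simp)

theorem AssumptionHR.continuousOn_F (h : AssumptionHR p T b) :
    ContinuousOn (fun z : ℝ × State d => b.F z.1 z.2) (Icc 0 T ×ˢ univ) :=
  h.F₁_smooth.smooth.continuousOn.prodMk h.F₂_smooth.smooth.continuousOn

/-- Only a = σσ* is assumed smooth. For σ itself, continuity in time and a Lipschitz constant in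
space that is uniform in time together give joint continuity. -/
theorem AssumptionHR.continuousOn_σ (h : AssumptionHR p T b) :
    ContinuousOn (fun z : ℝ × State d => b.σ z.1 z.2) (Icc 0 T ×ˢ univ) := by
  refine continuousOn_prod_of_continuousOn_lipschitzOnWith' _ (2 * p.Cσ).toNNReal
    (fun t ht => (LipschitzWith.of_dist_le_mul fun x y => ?_).lipschitzOnWith)
    fun x _ => h.σ_time x
  rw [dist_eq_norm, dist_eq_norm]
  refine (h.σ_lipschitz t ht x y).trans ?_
  have h1 : ‖x.1 - y.1‖ ≤ ‖x - y‖ := norm_fst_le (x - y)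
  have h2 : ‖x.2 - y.2‖ ≤ ‖x - y‖ := norm_snd_le (x - y)
  have h3 := h.Cσ_pos
  rw [Real.coe_toNNReal _ (by positivity)]
  nlinarith

theorem exists_isTransport (hT : 0 < T) (h : AssumptionHR p T b) (hτ : τ ∈ Icc 0 T) (ξ : State d) :
    ∃ θ, IsTransport b T τ ξ θ := by
  obtain ⟨K, hK, hlip⟩ := h.exists_lipschitz
  -- Projecting time onto [0, T] makes the field continuous and Lipschitz for all times; on [τ, T]
  -- the projection is the identity.
  let v : ℝ → State d → State d := fun t => b.F (projIcc 0 T hT.le t)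
  have hv : Continuous fun z : ℝ × State d => v z.1 z.2 := by
    have h1 : Continuous fun z : ℝ × State d => (((projIcc 0 T hT.le z.1 : ℝ), z.2) : ℝ × State d) :=
      (continuous_subtype_val.comp (continuous_projIcc.comp continuous_fst)).prodMk continuous_snd
    exact h.continuousOn_F.comp_continuous h1 fun z => ⟨(projIcc 0 T hT.le z.1).2, mem_univ _⟩
  obtain ⟨θ, h0, hθ⟩ := exists_solution_of_lipschitz hv (NNReal.coe_pos.2 hK)
    (fun t x y => by
      simpa [dist_eq_norm] using (hlip _ (projIcc 0 T hT.le t).2).dist_le_mul x y) hτ.2 ξ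
  refine ⟨fun s => if s < τ then 0 else θ s, by simpa using h0, fun s hs => ?_,
    fun s hs => by simp [hs]⟩
  have h1 := hθ s hs
  have h2 : v s (θ s) = b.F s (θ s) := by
    simp only [v]
    rw [projIcc_of_mem hT.le ⟨hτ.1.trans hs.1, hs.2⟩]
  rw [h2] at h1
  rw [if_neg (not_lt.2 hs.1)]
  refine h1.congr_of_mem (fun r hr => ?_) hs
  rw [if_neg (not_lt.2 hr.1)]

theorem IsTransport.eqOn (h : AssumptionHR p T b) (hτ : τ ∈ Icc 0 T)
    (hθ : IsTransport b T τ ξ θ) (hθ' : IsTransport b T τ ξ θ') : EqOn θ θ' (Iic T) := by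
  obtain ⟨K, -, hlip⟩ := h.exists_lipschitz
  have hr : ∀ {η : ℝ → State d}, IsTransport b T τ ξ η → ∀ t ∈ Ico τ T,
      HasDerivWithinAt η (b.F t (η t)) (Ici t) t := fun hη t ht =>
    (hη.ode t ⟨ht.1, ht.2.le⟩).mono_of_mem_nhdsWithin <| by
      filter_upwards [self_mem_nhdsWithin, nhdsWithin_le_nhds (Iio_mem_nhds ht.2)] with s hs hs'
      exact ⟨ht.1.trans hs, le_of_lt hs'⟩
  have key : EqOn θ θ' (Icc τ T) :=
    ODE_solution_unique_of_mem_Icc_right (v := b.F) (s := fun _ => univ) (K := K)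
      (fun t ht => (hlip t ⟨hτ.1.trans ht.1, ht.2.le⟩).lipschitzOnWith)
      (fun t ht => (hθ.ode t ht).continuousWithinAt) (hr hθ) (fun _ _ => mem_univ _)
      (fun t ht => (hθ'.ode t ht).continuousWithinAt) (hr hθ') (fun _ _ => mem_univ _)
      (hθ.init.trans hθ'.init.symm)
  intro s hs
  rcases lt_or_ge s τ with hsτ | hsτ
  · rw [hθ.before s hsτ, hθ'.before s hsτ]
  · exact key ⟨hsτ, hs⟩

/-- Before τ the path is 0 and from τ on it is continuous, so a jointly continuous coefficient has
the two continuous branches k(·, 0) and k(·, θ). -/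
theorem IsTransport.pw_comp {H : Type*} [TopologicalSpace H] (hT : 0 < T) (hτ : τ ∈ Icc 0 T)
    (hθ : IsTransport b T τ ξ θ) {k : ℝ → State d → H}
    (hk : ContinuousOn (fun z : ℝ × State d => k z.1 z.2) (Icc 0 T ×ˢ univ)) :
    PW T τ fun r => k r (θ r) := by
  have hc : ContinuousOn θ (Icc τ T) := fun t ht => (hθ.ode t ht).continuousWithinAt
  have hproj : Continuous fun r : ℝ => (projIcc 0 T hT.le r : ℝ) :=
    continuous_subtype_val.comp continuous_projIcc
  refine ⟨fun r => k (projIcc 0 T hT.le r) 0,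
    fun r => k (projIcc 0 T hT.le r) (IccExtend hτ.2 ((Icc τ T).domRestrict θ) r),
    hk.comp_continuous (hproj.prodMk continuous_const) fun r => ⟨Subtype.mem _, mem_univ _⟩,
    hk.comp_continuous (hproj.prodMk hc.domRestrict.Icc_extend')
      fun r => ⟨Subtype.mem _, mem_univ _⟩, fun r hr => ?_, fun r hr => ?_⟩
  · dsimp only
    rw [projIcc_of_mem hT.le ⟨hr.1, hr.2.le.trans hτ.2⟩, hθ.before r hr.2]
  · dsimp only
    rw [projIcc_of_mem hT.le ⟨hτ.1.trans hr.1, hr.2⟩, IccExtend_of_mem hτ.2 _ hr]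
    rfl

end Transport

/-! ### Frozen coefficients -/

/-- The properties of the coefficients frozen along `θ` on which the results depend. -/
structure FrozenReg {d : ℕ} (b : Coefficients d) (θ : ℝ → State d) (T τ Λ C c₀ : ℝ) : Prop where
  T_pos : 0 < T
  τ_mem : τ ∈ Icc 0 T
  Λ_pos : 0 < Λ
  C_pos : 0 < C
  c₀_pos : 0 < c₀
  pw_F₁ : PW T τ fun r => b.F₁ r (θ r)
  pw_F₂ : PW T τ fun r => b.F₂ r (θ r)
  pw_D : PW T τ fun r => b.D₁F₂ r (θ r)
  pw_σ : PW T τ fun r => b.σ r (θ r)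
  pw_θ : PW T τ θ
  elliptic : ∀ r ∈ Icc 0 T, ∀ ζ : Vec d,
    Λ⁻¹ * ‖ζ‖ ^ 2 ≤ inner ℝ (b.a r (θ r) ζ) ζ ∧ inner ℝ (b.a r (θ r) ζ) ζ ≤ Λ * ‖ζ‖ ^ 2
  D_le : ∀ r ∈ Icc 0 T, ‖b.D₁F₂ r (θ r)‖ ≤ C
  R_lower : ∀ u v, 0 ≤ u → u ≤ v → v ≤ T → ∀ η : Vec d,
    c₀ * (v - u) * ‖η‖ ≤ ‖(R b θ u v).adjoint η‖

/-- The adjoints of the matrices of a compact set of invertible matrices are uniformly bounded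
below. -/
theorem exists_adjoint_lower_bound {d : ℕ} {S : Set (Mat d)} (hS : IsClosed S)
    (hinv : ∀ A ∈ S, IsUnit A) (C : ℝ) :
    ∃ c > 0, ∀ A ∈ S, ‖A‖ ≤ C → ∀ η : Vec d, c * ‖η‖ ≤ ‖A.adjoint η‖ := by
  have : ProperSpace (Mat d) := FiniteDimensional.proper ℝ _
  have hK : IsCompact (S ∩ Metric.closedBall 0 C) :=
    (isCompact_closedBall 0 C).inter_left hS
  have hcont : ContinuousOn (Ring.inverse : Mat d → Mat d) (S ∩ Metric.closedBall 0 C) := by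
    intro A hA
    obtain ⟨u, rfl⟩ := hinv A hA.1
    exact (NormedRing.inverse_continuousAt u).continuousWithinAt
  obtain ⟨M, hM⟩ := hK.exists_bound_of_continuousOn hcont
  -- The compact set may be empty and `M` may be nonpositive, so |M| + 1 is the bound that can be
  -- inverted.
  have hM' : 0 < |M| + 1 := by positivity
  refine ⟨(|M| + 1)⁻¹, by positivity, fun A hA hAC η => ?_⟩
  obtain ⟨u, hu⟩ := hinv A hA
  have h1 : ‖Ring.inverse A‖ ≤ |M| + 1 :=
    (hM A ⟨hA, by simpa using hAC⟩).trans ((le_abs_self M).trans (by linarith))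
  have h2 : A ∘L Ring.inverse A = ContinuousLinearMap.id ℝ (Vec d) :=
    Ring.mul_inverse_cancel A (hinv A hA)
  have h3 : (Ring.inverse A).adjoint (A.adjoint η) = η := by
    have h4 := congrArg ContinuousLinearMap.adjoint h2
    rw [ContinuousLinearMap.adjoint_comp] at h4
    have h5 := congrArg (fun B : Mat d => B η) h4
    simpa [show ContinuousLinearMap.adjoint (ContinuousLinearMap.id ℝ (Vec d)) = 1 from star_one (Mat d)]
      using h5
  rw [inv_mul_le_iff₀ hM']
  calc ‖η‖ = ‖(Ring.inverse A).adjoint (A.adjoint η)‖ := by rw [h3]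
    _ ≤ ‖(Ring.inverse A).adjoint‖ * ‖A.adjoint η‖ := ContinuousLinearMap.le_opNorm _ _
    _ ≤ (|M| + 1) * ‖A.adjoint η‖ := by
        rw [LinearIsometryEquiv.norm_map]
        gcongr

/-- For x₂ fixed the regularity of F₂ is a C₂-Lipschitz condition in x₁, since the other term is 0
to a positive power. -/
theorem AssumptionHR.norm_D₁F₂_le {d : ℕ} {b : Coefficients d} {p : KnownParameters d} {T : ℝ}
    (h : AssumptionHR p T b) {t : ℝ} (ht : t ∈ Icc 0 T) (x : State d) : ‖b.D₁F₂ t x‖ ≤ p.C₂ := by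
  refine norm_fderiv_le_of_lip' ℝ h.C₂_pos.le (Eventually.of_forall fun y => ?_)
  have := h.F₂_holder t ht (y, x.2) (x.1, x.2)
  have h0 : p.β₂₂ ≠ 0 := by
    have := h.β₂₂_mem.1
    intro h
    rw [h] at this
    norm_num at this
  simpa [Real.zero_rpow h0] using this

/-- The constant `c₀` depends only on the known parameters. -/
theorem exists_frozenReg {d : ℕ} (p : KnownParameters d) (h𝓔 : IsClosed p.𝓔)
    (hinv : ∀ A ∈ p.𝓔, IsUnit A) :
    ∃ c₀ : ℝ, ∀ (T : ℝ) (b : Coefficients d), 0 < T → AssumptionHR p T b → ∀ τ ∈ Icc 0 T,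
      ∀ (ξ : State d) (θ : ℝ → State d), IsTransport b T τ ξ θ →
        FrozenReg b θ T τ p.Λ p.C₂ c₀ := by
  obtain ⟨c₀, hc₀, hlow⟩ := exists_adjoint_lower_bound h𝓔 hinv p.C₂
  refine ⟨c₀, fun T b hT h τ hτ ξ θ hθ => ?_⟩
  have pwD : PW T τ fun r => b.D₁F₂ r (θ r) :=
    hθ.pw_comp hT hτ (continuousOn_fderiv_fst hT h.F₂_smooth)
  refine
    { T_pos := hT
      τ_mem := hτ
      Λ_pos := zero_lt_one.trans h.Λ_gt
      C_pos := h.C₂_pos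
      c₀_pos := hc₀
      pw_F₁ := hθ.pw_comp hT hτ h.F₁_smooth.smooth.continuousOn
      pw_F₂ := hθ.pw_comp hT hτ h.F₂_smooth.smooth.continuousOn
      pw_D := pwD
      pw_σ := hθ.pw_comp hT hτ h.continuousOn_σ
      pw_θ := hθ.pw_comp (k := fun _ x => x) hT hτ continuous_snd.continuousOn
      elliptic := fun r hr ζ => h.elliptic r hr (θ r) ζ
      D_le := fun r hr => h.norm_D₁F₂_le hr (θ r)
      R_lower := fun u v hu huv hv η => ?_ }
  rcases huv.eq_or_lt with rfl | huv
  · simp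
  have hsub : Ioc u v ⊆ Icc 0 T := fun r hr => ⟨hu.trans hr.1.le, hr.2.trans hv⟩
  have hint : IntegrableOn (fun r => b.D₁F₂ r (θ r)) (Ioc u v) := pwD.integrableOn.mono_set hsub
  have h0 : volume (Ioc u v) ≠ 0 := by simp [huv]
  -- Here convexity and closedness of 𝓔 are used: the average of D₁F₂ over (u, v] stays in 𝓔 and in
  -- the ball of radius C₂, where adjoints are bounded below by c₀. R is v - u times this average.
  have hmem : (⨍ r in Ioc u v, b.D₁F₂ r (θ r)) ∈ p.𝓔 ∩ Metric.closedBall 0 p.C₂ := by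
    refine (h.𝓔_convex.inter (convex_closedBall 0 p.C₂)).set_average_mem
      (h𝓔.inter Metric.isClosed_closedBall) h0 (by simp) ?_ hint
    filter_upwards [ae_restrict_mem measurableSet_Ioc] with r hr
    exact ⟨h.D₁F₂_mem r (hsub hr) _, by simpa using h.norm_D₁F₂_le (hsub hr) _⟩
  have hR : R b θ u v = (v - u) • ⨍ r in Ioc u v, b.D₁F₂ r (θ r) := by
    rw [setAverage_eq, R, intervalIntegral.integral_of_le huv.le, smul_smul]
    have : (v - u) * (volume.real (Ioc u v))⁻¹ = 1 := by
      rw [Real.volume_real_Ioc_of_le huv.le, mul_inv_cancel₀ (sub_pos.2 huv).ne']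
    rw [this, one_smul]
  have h1 := hlow _ hmem.1 (by simpa using hmem.2) η
  rw [hR, map_smulₛₗ]
  simp only [conj_trivial, smul_apply, norm_smul, Real.norm_eq_abs]
  rw [abs_of_pos (sub_pos.2 huv)]
  have h2 : 0 < v - u := sub_pos.2 huv
  nlinarith

/-! ### The quadratic form of the covariance matrix -/

section Covariance

variable {d : ℕ}

theorem dotProduct_entries_mulVec (A : Mat d) (u v : Vec d) :
    (fun i => u i) ⬝ᵥ (entries A).mulVec (fun i => v i) = inner ℝ u (A v) := by
  have hv : v = ∑ j, v j • EuclideanSpace.single j (1 : ℝ) := by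
    ext i
    simp [Pi.single_apply]
  have hA : ∀ i, (A v) i = ∑ j, v j * (A (EuclideanSpace.single j 1)) i := by
    intro i
    conv_lhs => rw [hv]
    simp [map_sum]
  simp only [dotProduct, Matrix.mulVec, entries, Matrix.of_apply, PiLp.inner_apply, hA]
  simp [mul_comm]

theorem coords_dotProduct (u v : State d) :
    coords u ⬝ᵥ coords v = inner ℝ u.1 v.1 + inner ℝ u.2 v.2 := by
  simp [coords, dotProduct, Fintype.sum_sum_type, PiLp.inner_apply, mul_comm]

variable (b : Coefficients d) (θ : ℝ → State d)

/-- The integrand of the stochastic integral which represents the component of `X_s` in the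
direction `ζ`. -/
def noise (s : ℝ) (ζ : State d) (r : ℝ) : Vec d :=
  (b.σ r (θ r)).adjoint (ζ.1 + (R b θ r s).adjoint ζ.2)

variable {b θ} {T τ Λ C c₀ : ℝ}

namespace FrozenReg

variable (h : FrozenReg b θ T τ Λ C c₀)
include h

theorem continuousOn_R {s : ℝ} (hs : s ∈ Icc 0 T) :
    ContinuousOn (fun r => R b θ r s) (Icc 0 T) := h.pw_D.continuousOn_integral_left s hs

theorem pw_R {s : ℝ} (hs : s ∈ Icc 0 T) : PW T τ fun r => R b θ r s :=
  PW.of_continuousOn h.T_pos.le (h.continuousOn_R hs) h.τ_mem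

theorem pw_a : PW T τ fun r => b.a r (θ r) :=
  h.pw_σ.comp (φ := fun A : Mat d => A ∘L A.adjoint)
    (continuous_id.clm_comp (LinearIsometryEquiv.continuous _))

theorem pw_R_adjoint {s : ℝ} (hs : s ∈ Icc 0 T) : PW T τ fun r => (R b θ r s).adjoint :=
  (h.pw_R hs).comp (LinearIsometryEquiv.continuous ContinuousLinearMap.adjoint)

theorem pw_noise {s : ℝ} (hs : s ∈ Icc 0 T) (ζ : State d) : PW T τ (noise b θ s ζ) :=
  ((h.pw_σ.comp (LinearIsometryEquiv.continuous ContinuousLinearMap.adjoint)).prodMk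
    (h.pw_R_adjoint hs)).comp (φ := fun z : Mat d × Mat d => z.1 (ζ.1 + z.2 ζ.2)) (by fun_prop)

theorem R_sub {u v s : ℝ} (hu : u ∈ Icc 0 T) (hv : v ∈ Icc 0 T) (hs : s ∈ Icc 0 T) :
    R b θ u s - R b θ v s = R b θ u v := by
  have := intervalIntegral.integral_add_adjacent_intervals
    (h.pw_D.intervalIntegrable hu hv) (h.pw_D.intervalIntegrable hv hs)
  rw [R, R, R, ← this]
  abel

theorem norm_R_le {u v : ℝ} (hu : 0 ≤ u) (huv : u ≤ v) (hv : v ≤ T) :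
    ‖R b θ u v‖ ≤ C * (v - u) := by
  have := intervalIntegral.norm_integral_le_of_norm_le_const (a := u) (b := v) (C := C)
    (f := fun r => b.D₁F₂ r (θ r)) fun r hr => by
      rw [uIoc_of_le huv] at hr
      exact h.D_le r ⟨hu.trans hr.1.le, hr.2.trans hv⟩
  rwa [abs_of_nonneg (sub_nonneg.2 huv)] at this

omit h in
theorem inner_noise (s : ℝ) (ζ ζ' : State d) (r : ℝ) :
    inner ℝ (noise b θ s ζ r) (noise b θ s ζ' r) =
      inner ℝ (ζ.1 + (R b θ r s).adjoint ζ.2) (b.a r (θ r) (ζ'.1 + (R b θ r s).adjoint ζ'.2)) := by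
  rw [noise, noise, ContinuousLinearMap.adjoint_inner_left]
  rfl

/-- The bilinear form of the covariance matrix. -/
theorem covMatrix_form {t s : ℝ} (ht : t ∈ Icc 0 T) (hs : s ∈ Icc 0 T) (ζ ζ' : State d) :
    coords ζ ⬝ᵥ (covMatrix b θ t s).mulVec (coords ζ') =
      ∫ r in t..s, inner ℝ (noise b θ s ζ r) (noise b θ s ζ' r) := by
  have key : ∀ {A : ℝ → Mat d} (_ : PW T τ A) (u v : Vec d),
      inner ℝ u ((∫ r in t..s, A r) v) = ∫ r in t..s, inner ℝ u (A r v) := by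
    intro A hA u v
    exact (((innerSL ℝ u).comp (ContinuousLinearMap.apply ℝ (Vec d) v)).intervalIntegral_comp_comm
      (hA.intervalIntegrable ht hs)).symm
  have hR := h.pw_R hs
  have hR' := h.pw_R_adjoint hs
  have ha := h.pw_a
  have h12 : PW T τ fun r => b.a r (θ r) ∘L (R b θ r s).adjoint :=
    (ha.prodMk hR').comp (φ := fun z : Mat d × Mat d => z.1 ∘L z.2)
      (continuous_fst.clm_comp continuous_snd)
  have h21 : PW T τ fun r => R b θ r s ∘L b.a r (θ r) :=
    (hR.prodMk ha).comp (φ := fun z : Mat d × Mat d => z.1 ∘L z.2)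
      (continuous_fst.clm_comp continuous_snd)
  have h22 : PW T τ fun r => R b θ r s ∘L b.a r (θ r) ∘L (R b θ r s).adjoint :=
    (hR.prodMk h12).comp (φ := fun z : Mat d × Mat d => z.1 ∘L z.2)
      (continuous_fst.clm_comp continuous_snd)
  have hi : ∀ {A : ℝ → Mat d} (_ : PW T τ A) (u v : Vec d),
      IntervalIntegrable (fun r => inner ℝ u (A r v)) volume t s := fun hA u v =>
    (hA.comp (φ := fun A : Mat d => inner ℝ u (A v)) (by fun_prop)).intervalIntegrable ht hs
  rw [covMatrix, coords, coords, Matrix.fromBlocks_mulVec, sumElim_dotProduct_sumElim]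
  simp only [Sum.elim_comp_inl, Sum.elim_comp_inr, dotProduct_add, dotProduct_entries_mulVec]
  rw [key ha, key h12, key h21, key h22, ← intervalIntegral.integral_add (hi ha _ _) (hi h12 _ _),
    ← intervalIntegral.integral_add (hi h21 _ _) (hi h22 _ _),
    ← intervalIntegral.integral_add ((hi ha _ _).add (hi h12 _ _))
      ((hi h21 _ _).add (hi h22 _ _))]
  refine intervalIntegral.integral_congr fun r _ => ?_
  simp only [inner_noise, ContinuousLinearMap.comp_apply, inner_add_left, inner_add_right, map_add,
    ContinuousLinearMap.adjoint_inner_left]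
  ring

/-- |σ*v|² = ⟨a v, v⟩, so ellipticity of a suffices. -/
theorem norm_noise_sq_bounds {r : ℝ} (hr : r ∈ Icc 0 T) (s : ℝ) (ζ : State d) :
    Λ⁻¹ * ‖ζ.1 + (R b θ r s).adjoint ζ.2‖ ^ 2 ≤ ‖noise b θ s ζ r‖ ^ 2 ∧
      ‖noise b θ s ζ r‖ ^ 2 ≤ Λ * ‖ζ.1 + (R b θ r s).adjoint ζ.2‖ ^ 2 := by
  rw [← real_inner_self_eq_norm_sq (noise b θ s ζ r), inner_noise, real_inner_comm]
  exact h.elliptic r hr _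

theorem norm_R_adjoint_le {u v : ℝ} (hu : 0 ≤ u) (huv : u ≤ v) (hv : v ≤ T) (η : Vec d) :
    ‖(R b θ u v).adjoint η‖ ≤ C * (v - u) * ‖η‖ := by
  refine (ContinuousLinearMap.le_opNorm _ _).trans ?_
  rw [LinearIsometryEquiv.norm_map]
  exact mul_le_mul_of_nonneg_right (h.norm_R_le hu huv hv) (norm_nonneg _)

theorem pw_phi {s : ℝ} (hs : s ∈ Icc 0 T) (ζ : State d) :
    PW T τ fun r => ‖ζ.1 + (R b θ r s).adjoint ζ.2‖ ^ 2 :=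
  (h.pw_R_adjoint hs).comp (φ := fun A : Mat d => ‖ζ.1 + A ζ.2‖ ^ 2) (by fun_prop)

/-- R_{r,s} has norm at most C(s-t); squaring and integrating over [t, s] produces the power (s-t)³
in front of |ζ₂|². -/
theorem covMatrix_le {t s : ℝ} (h0 : 0 ≤ t) (hts : t ≤ s) (hsT : s ≤ T) (ζ : State d) :
    coords ζ ⬝ᵥ (covMatrix b θ t s).mulVec (coords ζ) ≤
      2 * Λ * (1 + C ^ 2) * ((s - t) * ‖ζ.1‖ ^ 2 + (s - t) ^ 3 * ‖ζ.2‖ ^ 2) := by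
  have ht : t ∈ Icc 0 T := ⟨h0, hts.trans hsT⟩
  have hs : s ∈ Icc 0 T := ⟨h0.trans hts, hsT⟩
  rw [h.covMatrix_form ht hs]
  have h1 : ∫ r in t..s, inner ℝ (noise b θ s ζ r) (noise b θ s ζ r) ≤
      ∫ _ in t..s, 2 * Λ * (‖ζ.1‖ ^ 2 + C ^ 2 * (s - t) ^ 2 * ‖ζ.2‖ ^ 2) := by
    refine intervalIntegral.integral_mono_on hts
      (((h.pw_noise hs ζ).comp (φ := fun v : Vec d => inner ℝ v v)
        (by fun_prop)).intervalIntegrable ht hs) (by simp) fun r hr => ?_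
    rw [real_inner_self_eq_norm_sq]
    refine (h.norm_noise_sq_bounds ⟨h0.trans hr.1, hr.2.trans hsT⟩ s ζ).2.trans ?_
    have h2 := h.norm_R_adjoint_le (h0.trans hr.1) hr.2 hsT ζ.2
    have h3 := norm_add_le ζ.1 ((R b θ r s).adjoint ζ.2)
    have h4 : ‖(R b θ r s).adjoint ζ.2‖ ≤ C * (s - t) * ‖ζ.2‖ := h2.trans <| by
      have := h.C_pos.le
      have := hr.1
      gcongr
    have h5 : ‖ζ.1 + (R b θ r s).adjoint ζ.2‖ ^ 2 ≤ (‖ζ.1‖ + C * (s - t) * ‖ζ.2‖) ^ 2 := by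
      gcongr
      linarith
    have h6 : ‖ζ.1 + (R b θ r s).adjoint ζ.2‖ ^ 2 ≤
        2 * (‖ζ.1‖ ^ 2 + C ^ 2 * (s - t) ^ 2 * ‖ζ.2‖ ^ 2) := by
      nlinarith [sq_nonneg (‖ζ.1‖ - C * (s - t) * ‖ζ.2‖)]
    calc _ ≤ Λ * (2 * (‖ζ.1‖ ^ 2 + C ^ 2 * (s - t) ^ 2 * ‖ζ.2‖ ^ 2)) :=
          mul_le_mul_of_nonneg_left h6 h.Λ_pos.le
      _ = _ := by ring
  refine h1.trans ?_
  rw [intervalIntegral.integral_const, smul_eq_mul]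
  have h7 := h.Λ_pos
  have h8 : 0 ≤ s - t := sub_nonneg.2 hts
  have h9 : 0 ≤ 2 * Λ * (C ^ 2 * ((s - t) * ‖ζ.1‖ ^ 2) + (s - t) ^ 3 * ‖ζ.2‖ ^ 2) := by positivity
  linarith

/-- The uniform non-degeneracy of the covariance matrix. -/
theorem le_covMatrix {t s : ℝ} (h0 : 0 ≤ t) (hts : t ≤ s) (hsT : s ≤ T) (ζ : State d) :
    Λ⁻¹ * (2 + (32 * C ^ 2 + 16) / c₀ ^ 2)⁻¹ * ((s - t) * ‖ζ.1‖ ^ 2 + (s - t) ^ 3 * ‖ζ.2‖ ^ 2) ≤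
      coords ζ ⬝ᵥ (covMatrix b θ t s).mulVec (coords ζ) := by
  have ht : t ∈ Icc 0 T := ⟨h0, hts.trans hsT⟩
  have hs : s ∈ Icc 0 T := ⟨h0.trans hts, hsT⟩
  have hc₀ := h.c₀_pos
  have hh : 0 ≤ s - t := sub_nonneg.2 hts
  rw [h.covMatrix_form ht hs]
  set φ : ℝ → Vec d := fun r => ζ.1 + (R b θ r s).adjoint ζ.2 with hφ
  have hpw : PW T τ fun r => ‖φ r‖ ^ 2 := h.pw_phi hs ζ
  set I := ∫ r in t..s, ‖φ r‖ ^ 2 with hI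
  have hI1 : Λ⁻¹ * I ≤ ∫ r in t..s, inner ℝ (noise b θ s ζ r) (noise b θ s ζ r) := by
    rw [hI, ← intervalIntegral.integral_const_mul]
    refine intervalIntegral.integral_mono_on hts ((hpw.intervalIntegrable ht hs).const_mul _)
      (((h.pw_noise hs ζ).comp (φ := fun v : Vec d => inner ℝ v v)
        (by fun_prop)).intervalIntegrable ht hs) fun r hr => ?_
    rw [real_inner_self_eq_norm_sq]
    exact (h.norm_noise_sq_bounds ⟨h0.trans hr.1, hr.2.trans hsT⟩ s ζ).1
  -- The values of φ at r and r + (s-t)/2 differ by R^*ζ₂ over an interval of length (s-t)/2, free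
  -- of ζ₁. So their squares add up to at least ½(c₀(s-t)|ζ₂|/2)², and integration over the half
  -- interval [t, m] gives c₀²(s-t)³|ζ₂|²/16.
  have hI2 : (s - t) ^ 3 * ‖ζ.2‖ ^ 2 ≤ 16 / c₀ ^ 2 * I := by
    set m := t + (s - t) / 2 with hm
    have hmI : m ∈ Icc 0 T := ⟨by positivity, by rw [hm]; linarith⟩
    have hsplit : I = ∫ r in t..m, (‖φ r‖ ^ 2 + ‖φ (r + (s - t) / 2)‖ ^ 2) := by
      have h1 : IntervalIntegrable (fun r => ‖φ (r + (s - t) / 2)‖ ^ 2) volume t m := by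
        have := (hpw.intervalIntegrable hmI hs).comp_add_right ((s - t) / 2)
        convert this using 1 <;> rw [hm] <;> ring
      rw [intervalIntegral.integral_add (hpw.intervalIntegrable ht hmI) h1,
        intervalIntegral.integral_comp_add_right (fun r => ‖φ r‖ ^ 2),
        show m + (s - t) / 2 = s by rw [hm]; ring,
        intervalIntegral.integral_add_adjacent_intervals (hpw.intervalIntegrable ht hmI)
          (hpw.intervalIntegrable hmI hs)]
    have hge : ∫ _ in t..m, (1 / 2) * (c₀ * ((s - t) / 2) * ‖ζ.2‖) ^ 2 ≤ I := by
      rw [hsplit]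
      refine intervalIntegral.integral_mono_on (by rw [hm]; linarith) (by simp) ?_ fun r hr => ?_
      · have h1 : IntervalIntegrable (fun r => ‖φ (r + (s - t) / 2)‖ ^ 2) volume t m := by
          have := (hpw.intervalIntegrable hmI hs).comp_add_right ((s - t) / 2)
          convert this using 1 <;> rw [hm] <;> ring
        exact (hpw.intervalIntegrable ht hmI).add h1
      · have hr2 : r + (s - t) / 2 ≤ s := by
          have := hr.2
          rw [hm] at this
          linarith
        have hr0 : 0 ≤ r := h0.trans hr.1
        have h2 := h.R_lower r (r + (s - t) / 2) hr0 (by linarith) (hr2.trans hsT) ζ.2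
        rw [← h.R_sub ⟨hr0, by linarith⟩ ⟨by linarith, hr2.trans hsT⟩ hs, map_sub] at h2
        have h3 : ‖((R b θ r s).adjoint - (R b θ (r + (s - t) / 2) s).adjoint) ζ.2‖ ≤
            ‖φ r‖ + ‖φ (r + (s - t) / 2)‖ := by
          have : ((R b θ r s).adjoint - (R b θ (r + (s - t) / 2) s).adjoint) ζ.2 =
              φ r - φ (r + (s - t) / 2) := by
            simp [hφ]
          rw [this]
          exact norm_sub_le _ _
        have h4 := h2.trans h3
        rw [add_sub_cancel_left] at h4
        have h5 : (c₀ * ((s - t) / 2) * ‖ζ.2‖) ^ 2 ≤ (‖φ r‖ + ‖φ (r + (s - t) / 2)‖) ^ 2 := by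
          gcongr
        nlinarith [sq_nonneg (‖φ r‖ - ‖φ (r + (s - t) / 2)‖)]
    rw [intervalIntegral.integral_const, smul_eq_mul, hm] at hge
    rw [div_mul_eq_mul_div, le_div_iff₀ (by positivity)]
    linarith
  -- ζ₁ = φ_r - R_{r,s}^*ζ₂ with R of size C(s-t), so what is lost is the ζ₂ term already controlled
  -- by `hI2`.
  have hI3 : (s - t) * ‖ζ.1‖ ^ 2 ≤ 2 * I + 2 * C ^ 2 * ((s - t) ^ 3 * ‖ζ.2‖ ^ 2) := by
    have h1 : ∫ _ in t..s, ‖ζ.1‖ ^ 2 ≤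
        ∫ r in t..s, (2 * ‖φ r‖ ^ 2 + 2 * C ^ 2 * ((s - t) ^ 2 * ‖ζ.2‖ ^ 2)) := by
      refine intervalIntegral.integral_mono_on hts (by simp)
        (((hpw.intervalIntegrable ht hs).const_mul 2).add (by simp)) fun r hr => ?_
      have h2 : ‖(R b θ r s).adjoint ζ.2‖ ≤ C * (s - t) * ‖ζ.2‖ :=
        (h.norm_R_adjoint_le (h0.trans hr.1) hr.2 hsT ζ.2).trans <| by
          have := h.C_pos.le
          have := hr.1
          gcongr
      have h3 : ‖ζ.1‖ ≤ ‖φ r‖ + C * (s - t) * ‖ζ.2‖ := by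
        have : ζ.1 = φ r - (R b θ r s).adjoint ζ.2 := by simp [hφ]
        rw [this]
        exact (norm_sub_le _ _).trans (by linarith)
      have h4 : ‖ζ.1‖ ^ 2 ≤ (‖φ r‖ + C * (s - t) * ‖ζ.2‖) ^ 2 := by gcongr
      nlinarith [sq_nonneg (‖φ r‖ - C * (s - t) * ‖ζ.2‖)]
    rw [intervalIntegral.integral_add ((hpw.intervalIntegrable ht hs).const_mul 2) (by simp),
      intervalIntegral.integral_const_mul, intervalIntegral.integral_const,
      intervalIntegral.integral_const, smul_eq_mul, smul_eq_mul, ← hI] at h1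
    linarith
  refine le_trans ?_ hI1
  rw [mul_assoc]
  refine mul_le_mul_of_nonneg_left ?_ (inv_nonneg.2 h.Λ_pos.le)
  rw [inv_mul_le_iff₀ (by positivity)]
  have hC2 : 2 * C ^ 2 * ((s - t) ^ 3 * ‖ζ.2‖ ^ 2) ≤ 2 * C ^ 2 * (16 / c₀ ^ 2 * I) :=
    mul_le_mul_of_nonneg_left hI2 (by positivity)
  have : (2 + (32 * C ^ 2 + 16) / c₀ ^ 2) * I =
      2 * I + 2 * C ^ 2 * (16 / c₀ ^ 2 * I) + 16 / c₀ ^ 2 * I := by ring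
  linarith

end FrozenReg

end Covariance

/-! ### Iterated derivatives -/

section Calculus

variable {E F G : Type*} [NormedAddCommGroup E] [NormedSpace ℝ E] [NormedAddCommGroup F]
  [NormedSpace ℝ F] [NormedAddCommGroup G] [NormedSpace ℝ G]

/-- The two derivatives differ by currying, which is an isometry. -/
theorem norm_iteratedFDeriv_iteratedFDeriv (f : E → F) (k n : ℕ) (x : E) :
    ‖iteratedFDeriv ℝ k (iteratedFDeriv ℝ n f) x‖ = ‖iteratedFDeriv ℝ (k + n) f x‖ := by
  induction n generalizing k x with
  | zero =>
    rw [iteratedFDeriv_zero_eq_comp, LinearIsometryEquiv.norm_iteratedFDeriv_comp_left]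
    rfl
  | succ n ih =>
    let I : (E →L[ℝ] E [×n]→L[ℝ] F) ≃ₗᵢ[ℝ] (E [×(n + 1)]→L[ℝ] F) :=
      (continuousMultilinearCurryLeftEquiv ℝ (fun _ => E) F).symm
    have h : iteratedFDeriv ℝ (n + 1) f = I ∘ fderiv ℝ (iteratedFDeriv ℝ n f) := rfl
    have h' := LinearIsometryEquiv.norm_iteratedFDeriv_comp_left (𝕜 := ℝ)
      (F := E →L[ℝ] E [×n]→L[ℝ] F) (G := E [×(n + 1)]→L[ℝ] F) I
      (fderiv ℝ (iteratedFDeriv ℝ n f)) x k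
    rw [h, h', norm_iteratedFDeriv_fderiv, ih, add_right_comm, add_assoc]

theorem iteratedFDeriv_comp_affine {f : F → G} (hf : ContDiff ℝ (⊤ : ℕ∞) f) (w : F) (ι : E →L[ℝ] F)
    (k : ℕ) (v : E) :
    iteratedFDeriv ℝ k (fun v => f (w + ι v)) v =
      (iteratedFDeriv ℝ k f (w + ι v)).compContinuousLinearMap fun _ => ι := by
  have h1 : ContDiff ℝ (⊤ : ℕ∞) fun z => f (w + z) := hf.comp (contDiff_const.add contDiff_id)
  have h2 := ι.iteratedFDeriv_comp_right h1 v (i := k) (by exact_mod_cast le_top)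
  rw [iteratedFDeriv_comp_add_left] at h2
  exact h2

theorem contDiff_iteratedFDeriv {f : F → G} (hf : ContDiff ℝ (⊤ : ℕ∞) f) (k : ℕ) :
    ContDiff ℝ (⊤ : ℕ∞) (iteratedFDeriv ℝ k f) :=
  hf.iteratedFDeriv_right (by exact_mod_cast le_top)

/-- The `k`-th derivative of `f` in the directions of the range of `ι`. -/
def partialDeriv (f : F → G) (ι : E →L[ℝ] F) (k : ℕ) (w : F) : E [×k]→L[ℝ] G :=
  (iteratedFDeriv ℝ k f w).compContinuousLinearMap fun _ => ι

theorem contDiff_partialDeriv {f : F → G} (hf : ContDiff ℝ (⊤ : ℕ∞) f) (ι : E →L[ℝ] F) (k : ℕ) :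
    ContDiff ℝ (⊤ : ℕ∞) (partialDeriv f ι k) :=
  (ContinuousMultilinearMap.compContinuousLinearMapL (𝕜 := ℝ) (F := G)
    (fun _ : Fin k => ι)).contDiff.comp (contDiff_iteratedFDeriv hf k)

theorem norm_iteratedFDeriv_partialDeriv_le {f : F → G} (hf : ContDiff ℝ (⊤ : ℕ∞) f)
    (ι : E →L[ℝ] F) (k n : ℕ) (w : F) :
    ‖iteratedFDeriv ℝ n (partialDeriv f ι k) w‖ ≤ ‖ι‖ ^ k * ‖iteratedFDeriv ℝ (n + k) f w‖ := by
  have h1 := (ContinuousMultilinearMap.compContinuousLinearMapL (𝕜 := ℝ) (F := G)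
    (fun _ : Fin k => ι)).norm_iteratedFDeriv_comp_left (N := (⊤ : ℕ∞)) (n := n)
    (contDiff_iteratedFDeriv hf k).contDiffAt (x := w) (by exact_mod_cast le_top)
  have h2 := ContinuousMultilinearMap.norm_compContinuousLinearMapL_le (𝕜 := ℝ) G
      (fun _ : Fin k => ι)
  rw [norm_iteratedFDeriv_iteratedFDeriv] at h1
  refine h1.trans (mul_le_mul_of_nonneg_right (h2.trans_eq (by simp)) (norm_nonneg _))

/-- Partial derivatives of `g` along affine maps are controlled by its full derivatives. -/
theorem norm_nested_iteratedFDeriv_le {g : F → G} (hg : ContDiff ℝ (⊤ : ℕ∞) g) (ι₁ ι₂ ι₃ : E →L[ℝ] F)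
    (z : F) (k₁ k₂ l : ℕ) (x₁ x₂ y₁ : E) :
    ‖iteratedFDeriv ℝ k₁ (fun x₁ => iteratedFDeriv ℝ k₂ (fun x₂ => iteratedFDeriv ℝ l
        (fun y₁ => g (z + ι₁ x₁ + ι₂ x₂ + ι₃ y₁)) y₁) x₂) x₁‖ ≤
      ‖ι₁‖ ^ k₁ * ‖ι₂‖ ^ k₂ * ‖ι₃‖ ^ l *
        ‖iteratedFDeriv ℝ (k₁ + k₂ + l) g (z + ι₁ x₁ + ι₂ x₂ + ι₃ y₁)‖ := by
  have hg₃ := contDiff_partialDeriv hg ι₃ l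
  have hg₂ := contDiff_partialDeriv hg₃ ι₂ k₂
  -- Differentiating in one variable gives a smooth function evaluated at the same point z + ι₁x₁ +
  -- ι₂x₂ + ι₃y₁, so each further variable is handled like the first.
  have e₃ : ∀ x₁ x₂, iteratedFDeriv ℝ l (fun y₁ => g (z + ι₁ x₁ + ι₂ x₂ + ι₃ y₁)) y₁ =
      partialDeriv g ι₃ l ((z + ι₁ x₁ + ι₃ y₁) + ι₂ x₂) := by
    intro x₁ x₂
    rw [iteratedFDeriv_comp_affine hg, add_right_comm]
    rfl
  have e₂ : ∀ x₁, iteratedFDeriv ℝ k₂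
      (fun x₂ => partialDeriv g ι₃ l ((z + ι₁ x₁ + ι₃ y₁) + ι₂ x₂)) x₂ =
      partialDeriv (partialDeriv g ι₃ l) ι₂ k₂ ((z + ι₃ y₁ + ι₂ x₂) + ι₁ x₁) := by
    intro x₁
    rw [iteratedFDeriv_comp_affine hg₃,
      show z + ι₁ x₁ + ι₃ y₁ + ι₂ x₂ = z + ι₃ y₁ + ι₂ x₂ + ι₁ x₁ by abel]
    rfl
  simp only [e₃, e₂]
  rw [iteratedFDeriv_comp_affine hg₂,
    show z + ι₃ y₁ + ι₂ x₂ + ι₁ x₁ = z + ι₁ x₁ + ι₂ x₂ + ι₃ y₁ by abel]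
  set w := z + ι₁ x₁ + ι₂ x₂ + ι₃ y₁
  refine (ContinuousMultilinearMap.norm_compContinuousLinearMap_le _ _).trans ?_
  have h2 := norm_iteratedFDeriv_partialDeriv_le hg₃ ι₂ k₂ k₁ w
  have h3 := norm_iteratedFDeriv_partialDeriv_le hg ι₃ l (k₁ + k₂) w
  rw [Finset.prod_const, Finset.card_univ, Fintype.card_fin]
  refine (mul_le_mul_of_nonneg_right (h2.trans (mul_le_mul_of_nonneg_left h3
    (by positivity))) (by positivity)).trans_eq ?_
  ring

/-- Cauchy–Schwarz for a nonnegative symmetric form: B(x,y)² ≤ B(x,x)B(y,y). -/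
theorem norm_le_of_nonneg_of_le {B : E →L[ℝ] E →L[ℝ] ℝ} {M : ℝ} (hM : 0 ≤ M)
    (hsymm : ∀ x y, B x y = B y x) (hpos : ∀ x, 0 ≤ B x x) (hle : ∀ x, B x x ≤ M * ‖x‖ ^ 2) :
    ‖B‖ ≤ M := by
  refine ContinuousLinearMap.opNorm_le_bound₂ _ hM fun x y => ?_
  have h1 := LinearMap.BilinForm.apply_mul_apply_le_of_forall_zero_le B.toBilinForm hpos x y
  simp only [ContinuousLinearMap.toBilinForm_apply] at h1
  rw [hsymm y x, ← sq] at h1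
  rw [Real.norm_eq_abs]
  refine abs_le_of_sq_le_sq (h1.trans ?_) (by positivity)
  calc B x x * B y y ≤ (M * ‖x‖ ^ 2) * (M * ‖y‖ ^ 2) :=
        mul_le_mul (hle x) (hle y) (hpos y) (by positivity)
    _ = _ := by ring

/-- Faà di Bruno for the exponential of a quadratic. The exponent has first and second derivatives
bounded by M‖z‖ and M, and no others, so its i-th derivative is at most ((M+1)(1+‖z‖))^i; the added
1's keep the base above 1, so that the second derivative fits the pattern. -/
theorem norm_iteratedFDeriv_gaussian_le {B : E →L[ℝ] E →L[ℝ] ℝ} {M : ℝ} (hM : 0 ≤ M)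
    (hsymm : ∀ x y, B x y = B y x) (hpos : ∀ x, 0 ≤ B x x) (hle : ∀ x, B x x ≤ M * ‖x‖ ^ 2)
    (n : ℕ) (z : E) :
    ‖iteratedFDeriv ℝ n (fun z => Real.exp (-(1 / 2) * B z z)) z‖ ≤
      n.factorial * Real.exp (-(1 / 2) * B z z) * ((M + 1) * (1 + ‖z‖)) ^ n := by
  have hB : ‖B‖ ≤ M := norm_le_of_nonneg_of_le hM hsymm hpos hle
  set f : E → ℝ := fun z => -(1 / 2) * B z z with hf
  have hder : fderiv ℝ f = fun z => (-B) z := by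
    ext z v
    have h1 : HasFDerivAt (fun z => B z z) (B z + B.flip z) z := by
      have := B.hasFDerivAt_of_bilinear (hasFDerivAt_id (𝕜 := ℝ) z) (hasFDerivAt_id (𝕜 := ℝ) z)
      refine this.congr_fderiv ?_
      ext v
      simp
    have h2 := (h1.const_mul (-(1 / 2 : ℝ))).fderiv
    rw [hf, h2]
    simp [hsymm v z]
    ring
  have hsm : ContDiff ℝ (⊤ : ℕ∞) f := by fun_prop
  have hone : 1 ≤ (M + 1) * (1 + ‖z‖) := by nlinarith [norm_nonneg z]
  refine norm_iteratedFDeriv_comp_le (g := Real.exp) (f := f) (N := (⊤ : ℕ∞)) Real.contDiff_exp hsm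
    (by exact_mod_cast le_top) z (fun i _ => ?_) fun i hi _ => ?_
  · rw [norm_iteratedFDeriv_eq_norm_iteratedDeriv, iteratedDeriv_eq_iterate, Real.iter_deriv_exp,
      Real.norm_of_nonneg (Real.exp_pos _).le]
  · obtain ⟨j, rfl⟩ : ∃ j, i = j + 1 := ⟨i - 1, by omega⟩
    rw [← norm_iteratedFDeriv_fderiv, hder]
    have hBz : ‖(-B) z‖ ≤ (M + 1) * (1 + ‖z‖) := by
      refine ((-B).le_opNorm z).trans ?_
      rw [norm_neg]
      nlinarith [norm_nonneg z, norm_nonneg B]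
    rcases j with _ | j
    · simpa using hBz
    · rw [← norm_iteratedFDeriv_fderiv]
      have hd : fderiv ℝ (fun z => (-B) z) = fun _ => -B := by
        ext1 x
        exact (-B).fderiv
      rw [hd]
      rcases j with _ | j
      · rw [norm_iteratedFDeriv_zero, norm_neg]
        have h1 : M ≤ (M + 1) * (1 + ‖z‖) := by nlinarith [norm_nonneg z]
        exact (hB.trans h1).trans (le_self_pow₀ hone (by omega))
      · rw [iteratedFDeriv_const_of_ne (by omega)]
        simp only [Pi.zero_apply, norm_zero]
        positivity

end Calculus

/-! ### Quadratic forms in coordinates -/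

section Forms

variable {d : ℕ}

/-- The coordinates of points of `ℝ^d × ℝ^d`, as a linear equivalence. -/
def coordsEquiv (d : ℕ) : State d ≃ₗ[ℝ] (Fin d ⊕ Fin d → ℝ) where
  toFun := coords
  invFun v := (WithLp.toLp 2 fun i => v (Sum.inl i), WithLp.toLp 2 fun i => v (Sum.inr i))
  map_add' u v := by ext (i | i) <;> rfl
  map_smul' c v := by ext (i | i) <;> rfl
  left_inv u := rfl
  right_inv v := by ext (i | i) <;> rfl

@[simp] theorem coordsEquiv_apply (u : State d) : coordsEquiv d u = coords u := rfl

@[simp] theorem coords_coordsEquiv_symm (v : Fin d ⊕ Fin d → ℝ) :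
    coords ((coordsEquiv d).symm v) = v := (coordsEquiv d).apply_symm_apply v

theorem coords_sub (u v : State d) : coords (u - v) = coords u - coords v :=
  map_sub (coordsEquiv d) u v

/-- The `i`-th coordinate. -/
def coordL (d : ℕ) (i : Fin d ⊕ Fin d) : State d →L[ℝ] ℝ :=
  LinearMap.toContinuousLinearMap ((LinearMap.proj i).comp (coordsEquiv d).toLinearMap)

@[simp] theorem coordL_apply (i : Fin d ⊕ Fin d) (u : State d) : coordL d i u = coords u i := rfl

/-- The bilinear form of a matrix. -/
def gaussForm (P : Matrix (Fin d ⊕ Fin d) (Fin d ⊕ Fin d) ℝ) : State d →L[ℝ] State d →L[ℝ] ℝ :=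
  ∑ i, ∑ j, P i j • (coordL d i).smulRight (coordL d j)

theorem gaussForm_apply (P : Matrix (Fin d ⊕ Fin d) (Fin d ⊕ Fin d) ℝ) (u v : State d) :
    gaussForm P u v = coords u ⬝ᵥ P.mulVec (coords v) := by
  simp only [gaussForm, sum_apply, smul_apply, ContinuousLinearMap.smulRight_apply, coordL_apply,
    smul_eq_mul, dotProduct, Matrix.mulVec, Finset.mul_sum]
  exact Finset.sum_congr rfl fun i _ => Finset.sum_congr rfl fun j _ => by ring

/-- Two-sided bounds on a symmetric matrix, homogeneous for the scaling `(q, q³)`. -/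
structure ScaledBounds (S : Matrix (Fin d ⊕ Fin d) (Fin d ⊕ Fin d) ℝ) (κ K q : ℝ) : Prop where
  κ_pos : 0 < κ
  K_pos : 0 < K
  q_pos : 0 < q
  symm : S.IsHermitian
  lower : ∀ ζ : State d, κ * (q ^ 2 * ‖ζ.1‖ ^ 2 + q ^ 6 * ‖ζ.2‖ ^ 2) ≤
    coords ζ ⬝ᵥ S.mulVec (coords ζ)
  upper : ∀ ζ : State d, coords ζ ⬝ᵥ S.mulVec (coords ζ) ≤
    K * (q ^ 2 * ‖ζ.1‖ ^ 2 + q ^ 6 * ‖ζ.2‖ ^ 2)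

namespace ScaledBounds

variable {S : Matrix (Fin d ⊕ Fin d) (Fin d ⊕ Fin d) ℝ} {κ K q : ℝ}

theorem posDef (h : ScaledBounds S κ K q) : S.PosDef := by
  refine Matrix.PosDef.of_dotProduct_mulVec_pos h.symm fun v hv => ?_
  obtain ⟨ζ, rfl⟩ := (coordsEquiv d).surjective v
  have hζ : ζ ≠ 0 := fun h0 => hv (by rw [h0, map_zero])
  refine lt_of_lt_of_le ?_ (h.lower ζ)
  have hκ := h.κ_pos
  have hq := h.q_pos
  have : ζ.1 ≠ 0 ∨ ζ.2 ≠ 0 := by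
    by_contra! h0
    exact hζ (Prod.ext h0.1 h0.2)
  rcases this with h1 | h1
  · have : 0 < ‖ζ.1‖ := norm_pos_iff.2 h1
    positivity
  · have : 0 < ‖ζ.2‖ := norm_pos_iff.2 h1
    positivity

theorem mulVec_inv (h : ScaledBounds S κ K q) (v : Fin d ⊕ Fin d → ℝ) :
    S.mulVec (S⁻¹.mulVec v) = v := by
  rw [Matrix.mulVec_mulVec, Matrix.mul_nonsing_inv _ h.posDef.det_pos.ne'.isUnit, Matrix.one_mulVec]

theorem dot_symm (h : ScaledBounds S κ K q) (u v : Fin d ⊕ Fin d → ℝ) :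
    u ⬝ᵥ S.mulVec v = v ⬝ᵥ S.mulVec u := by
  have hS : S.IsSymm := by simpa using h.symm
  conv_lhs => rw [← hS.eq]
  rw [Matrix.mulVec_transpose, dotProduct_comm, ← Matrix.dotProduct_mulVec]

theorem inv_symm (h : ScaledBounds S κ K q) (u v : State d) :
    gaussForm S⁻¹ u v = gaussForm S⁻¹ v u := by
  rw [gaussForm_apply, gaussForm_apply]
  have := h.dot_symm (S⁻¹.mulVec (coords u)) (S⁻¹.mulVec (coords v))
  rw [h.mulVec_inv, h.mulVec_inv] at this
  rw [dotProduct_comm (coords u), dotProduct_comm (coords v), this]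

/-- With w = S⁻¹u, the form ⟨S⁻¹u, u⟩ is both ⟨Sw, w⟩ and ⟨u, w⟩. Playing these two expressions
against each other gives the bounds on the inverse without inverting anything. -/
theorem exists_inv (h : ScaledBounds S κ K q) (u : State d) :
    ∃ w : State d, S.mulVec (coords w) = coords u ∧
      gaussForm S⁻¹ u u = coords w ⬝ᵥ S.mulVec (coords w) ∧
      gaussForm S⁻¹ u u = inner ℝ u.1 w.1 + inner ℝ u.2 w.2 := by
  refine ⟨(coordsEquiv d).symm (S⁻¹.mulVec (coords u)), ?_, ?_, ?_⟩
  · rw [coords_coordsEquiv_symm, h.mulVec_inv]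
  · rw [coords_coordsEquiv_symm, h.mulVec_inv, gaussForm_apply, dotProduct_comm]
  · rw [← coords_dotProduct, coords_coordsEquiv_symm, gaussForm_apply]

/-- Young's inequality with weights κq² and κq⁶ bounds 2⟨u, w⟩ by the desired quantity plus the
lower bound of ⟨Sw, w⟩ = ⟨u, w⟩, and one copy cancels. -/
theorem inv_upper (h : ScaledBounds S κ K q) (u : State d) :
    gaussForm S⁻¹ u u ≤ κ⁻¹ * (‖u.1‖ ^ 2 / q ^ 2 + ‖u.2‖ ^ 2 / q ^ 6) := by
  obtain ⟨w, -, h2, h3⟩ := h.exists_inv u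
  have h4 := h.lower w
  have hκ := h.κ_pos
  have hq := h.q_pos
  have e1 : ∀ (a b : Vec d) (r : ℝ), 0 < r →
      2 * inner ℝ a b ≤ κ⁻¹ * (‖a‖ ^ 2 / r) + κ * (r * ‖b‖ ^ 2) := by
    intro a b r hr
    have h5 := real_inner_le_norm a b
    have h6 : κ⁻¹ * (‖a‖ ^ 2 / r) + κ * (r * ‖b‖ ^ 2) - 2 * (‖a‖ * ‖b‖) =
        (κ * r)⁻¹ * (‖a‖ - κ * r * ‖b‖) ^ 2 := by
      field_simp
      ring
    have h7 : 0 ≤ (κ * r)⁻¹ * (‖a‖ - κ * r * ‖b‖) ^ 2 := by positivity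
    linarith
  have h5 := e1 u.1 w.1 (q ^ 2) (by positivity)
  have h6 := e1 u.2 w.2 (q ^ 6) (by positivity)
  linarith

/-- Expand ⟨S(w-ζ), w-ζ⟩ ≥ 0 at the vector ζ which maximises 2⟨u, ζ⟩ - K(q²|ζ₁|² + q⁶|ζ₂|²), namely
ζ = K⁻¹(u₁/q², u₂/q⁶). -/
theorem inv_lower (h : ScaledBounds S κ K q) (u : State d) :
    K⁻¹ * (‖u.1‖ ^ 2 / q ^ 2 + ‖u.2‖ ^ 2 / q ^ 6) ≤ gaussForm S⁻¹ u u := by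
  obtain ⟨w, h1, h2, h3⟩ := h.exists_inv u
  have hK := h.K_pos
  have hq := h.q_pos
  let ζ : State d := ((K⁻¹ / q ^ 2) • u.1, (K⁻¹ / q ^ 6) • u.2)
  have h4 : 0 ≤ coords (w - ζ) ⬝ᵥ S.mulVec (coords (w - ζ)) := by
    refine le_trans ?_ (h.lower _)
    have := h.κ_pos
    positivity
  rw [coords_sub, Matrix.mulVec_sub, sub_dotProduct, dotProduct_sub, dotProduct_sub,
    h.dot_symm (coords w) (coords ζ), h1] at h4
  simp only [coords_dotProduct] at h4
  rw [real_inner_comm, real_inner_comm u.2 w.2, ← h3] at h4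
  have h5 := h.upper ζ
  have e1 : inner ℝ ζ.1 u.1 = K⁻¹ * (‖u.1‖ ^ 2 / q ^ 2) := by
    simp only [ζ]
    rw [real_inner_smul_left, real_inner_self_eq_norm_sq]
    ring
  have e2 : inner ℝ ζ.2 u.2 = K⁻¹ * (‖u.2‖ ^ 2 / q ^ 6) := by
    simp only [ζ]
    rw [real_inner_smul_left, real_inner_self_eq_norm_sq]
    ring
  have e3 : K * (q ^ 2 * ‖ζ.1‖ ^ 2 + q ^ 6 * ‖ζ.2‖ ^ 2) =
      K⁻¹ * (‖u.1‖ ^ 2 / q ^ 2 + ‖u.2‖ ^ 2 / q ^ 6) := by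
    simp only [ζ, norm_smul, Real.norm_eq_abs, mul_pow, sq_abs]
    field_simp
  rw [e3] at h5
  rw [e1, e2] at h4
  linarith

/-- Conjugation by D = diag(q⁻¹, q⁻³) makes the lower bound isotropic, so all 2d eigenvalues of DSD
are at least κ; and det D = q^{-(d+3d)}. -/
theorem det_lower (h : ScaledBounds S κ K q) : κ ^ (2 * d) * q ^ (8 * d) ≤ S.det := by
  have hκ := h.κ_pos
  have hq := h.q_pos
  let D : Matrix (Fin d ⊕ Fin d) (Fin d ⊕ Fin d) ℝ :=
    Matrix.diagonal (Sum.elim (fun _ => q⁻¹) fun _ => (q ^ 3)⁻¹)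
  have hDt : D.conjTranspose = D := by simp [D]
  have hH : (D * S * D).IsHermitian := by
    have := Matrix.isHermitian_mul_mul_conjTranspose D h.symm
    rwa [hDt] at this
  have hev : ∀ i, κ ≤ hH.eigenvalues i := by
    intro i
    set v := hH.eigenvectorBasis i with hv
    have h1 : ∑ j, v j ^ 2 = 1 := by
      have := hH.eigenvectorBasis.orthonormal.1 i
      rw [← hv] at this
      have h2 := EuclideanSpace.real_norm_sq_eq v
      rw [this, one_pow] at h2
      exact h2.symm
    rw [hH.eigenvalues_eq i, ← hv]
    have h2 := h.lower ((coordsEquiv d).symm (D.mulVec v))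
    have e1 : ((coordsEquiv d).symm (D.mulVec v)).1 = WithLp.toLp 2 fun i => q⁻¹ * v (Sum.inl i) := by
      ext i
      change (D.mulVec v) (Sum.inl i) = _
      simp [D, Matrix.mulVec_diagonal]
    have e2 : ((coordsEquiv d).symm (D.mulVec v)).2 =
        WithLp.toLp 2 fun i => (q ^ 3)⁻¹ * v (Sum.inr i) := by
      ext i
      change (D.mulVec v) (Sum.inr i) = _
      simp [D, Matrix.mulVec_diagonal]
    rw [e1, e2, coords_coordsEquiv_symm, EuclideanSpace.real_norm_sq_eq,
      EuclideanSpace.real_norm_sq_eq] at h2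
    simp only [mul_pow, ← Finset.mul_sum] at h2
    have e3 : q ^ 2 * (q⁻¹ ^ 2 * ∑ i, v (Sum.inl i) ^ 2) +
        q ^ 6 * ((q ^ 3)⁻¹ ^ 2 * ∑ i, v (Sum.inr i) ^ 2) = 1 := by
      rw [← h1, Fintype.sum_sum_type]
      field_simp
    rw [e3, mul_one] at h2
    refine h2.trans_eq ?_
    have hDt' : D.transpose = D := by simp [D]
    have e4 : D.mulVec v ⬝ᵥ S.mulVec (D.mulVec v) = v ⬝ᵥ D.mulVec (S.mulVec (D.mulVec v)) := by
      rw [Matrix.dotProduct_mulVec v D, ← Matrix.mulVec_transpose, hDt']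
    rw [e4, Matrix.mulVec_mulVec, Matrix.mulVec_mulVec]
    simp [Matrix.mul_assoc]
  have hdet : κ ^ (2 * d) ≤ (D * S * D).det := by
    rw [hH.det_eq_prod_eigenvalues]
    calc κ ^ (2 * d) = ∏ _ : Fin d ⊕ Fin d, κ := by simp [two_mul]
      _ ≤ _ := Finset.prod_le_prod (fun _ _ => hκ.le) fun i _ => hev i
  have hD : D.det = (q ^ (4 * d))⁻¹ := by
    simp only [D, Matrix.det_diagonal, Fintype.prod_sum_type, Sum.elim_inl, Sum.elim_inr,
      Finset.prod_const, Finset.card_univ, Fintype.card_fin]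
    rw [← inv_pow, ← inv_pow, ← pow_mul, ← pow_add]
    congr 1
    ring
  rw [Matrix.det_mul, Matrix.det_mul, hD] at hdet
  have h8 : q ^ (8 * d) = q ^ (4 * d) * q ^ (4 * d) := by rw [← pow_add]; ring_nf
  rw [h8]
  have hp : 0 < q ^ (4 * d) := by positivity
  calc κ ^ (2 * d) * (q ^ (4 * d) * q ^ (4 * d)) ≤
        ((q ^ (4 * d))⁻¹ * S.det * (q ^ (4 * d))⁻¹) * (q ^ (4 * d) * q ^ (4 * d)) := by gcongr
    _ = S.det := by field_simp

theorem inv_sqrt_det_le (h : ScaledBounds S κ K q) :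
    (Real.sqrt S.det)⁻¹ ≤ (κ ^ d)⁻¹ * (q ^ (4 * d))⁻¹ := by
  have hκ := h.κ_pos
  have hq := h.q_pos
  rw [← mul_inv]
  refine inv_anti₀ (by positivity) (Real.le_sqrt_of_sq_le ((le_of_eq ?_).trans h.det_lower))
  ring

/-- The quadratic form of the inverse, in rescaled variables. -/
def scaledForm (S : Matrix (Fin d ⊕ Fin d) (Fin d ⊕ Fin d) ℝ) (q : ℝ) :
    State d →L[ℝ] State d →L[ℝ] ℝ :=
  let sc : State d →L[ℝ] State d := (q • ContinuousLinearMap.fst ℝ (Vec d) (Vec d)).prod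
    (q ^ 3 • ContinuousLinearMap.snd ℝ (Vec d) (Vec d))
  (gaussForm S⁻¹).bilinearComp sc sc

theorem scaledForm_apply (S : Matrix (Fin d ⊕ Fin d) (Fin d ⊕ Fin d) ℝ) (q : ℝ) (z w : State d) :
    scaledForm S q z w = gaussForm S⁻¹ (q • z.1, q ^ 3 • z.2) (q • w.1, q ^ 3 • w.2) := rfl

theorem scaledForm_lower (h : ScaledBounds S κ K q) (z : State d) :
    K⁻¹ * (‖z.1‖ ^ 2 + ‖z.2‖ ^ 2) ≤ scaledForm S q z z := by
  have hq := h.q_pos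
  have := h.inv_lower (q • z.1, q ^ 3 • z.2)
  rw [← scaledForm_apply] at this
  refine le_trans (le_of_eq ?_) this
  simp only [norm_smul, Real.norm_eq_abs, mul_pow, sq_abs]
  field_simp

theorem scaledForm_upper (h : ScaledBounds S κ K q) (z : State d) :
    scaledForm S q z z ≤ 2 * κ⁻¹ * ‖z‖ ^ 2 := by
  have hq := h.q_pos
  have hκ := h.κ_pos
  have := h.inv_upper (q • z.1, q ^ 3 • z.2)
  rw [← scaledForm_apply] at this
  refine this.trans ?_
  simp only [norm_smul, Real.norm_eq_abs, mul_pow, sq_abs]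
  have e : q ^ 2 * ‖z.1‖ ^ 2 / q ^ 2 + (q ^ 3) ^ 2 * ‖z.2‖ ^ 2 / q ^ 6 = ‖z.1‖ ^ 2 + ‖z.2‖ ^ 2 := by
    field_simp
  rw [e]
  have h1 : ‖z.1‖ ^ 2 ≤ ‖z‖ ^ 2 := by gcongr; exact norm_fst_le z
  have h2 : ‖z.2‖ ^ 2 ≤ ‖z‖ ^ 2 := by gcongr; exact norm_snd_le z
  have : κ⁻¹ * (‖z.1‖ ^ 2 + ‖z.2‖ ^ 2) ≤ κ⁻¹ * (‖z‖ ^ 2 + ‖z‖ ^ 2) := by gcongr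
  linarith

/-- Six is the largest total order of differentiation, two in each of three variables. The
polynomial is paid for by half of the exponential rate, from 1/(2K) to 1/(4K), through v³/3! ≤ exp v
at v = (1+ρ)/(4K); 48 is 8·3!. -/
theorem one_add_pow_six_mul_exp_le (hK : 0 < K) {x ρ : ℝ} (hx : 0 ≤ x) (hxρ : x ^ 2 ≤ ρ) :
    (1 + x) ^ 6 * Real.exp (-(1 / 2) * (K⁻¹ * ρ)) ≤
      48 * (4 * K) ^ 3 * Real.exp ((4 * K)⁻¹) * Real.exp (-(4 * K)⁻¹ * ρ) := by
  have hρ : 0 ≤ ρ := (sq_nonneg x).trans hxρ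
  have h1 : (1 + x) ^ 2 ≤ 2 * (1 + ρ) := by nlinarith [sq_nonneg (1 - x)]
  have h2 : (1 + x) ^ 6 ≤ 8 * (1 + ρ) ^ 3 := by
    calc (1 + x) ^ 6 = ((1 + x) ^ 2) ^ 3 := by ring
      _ ≤ (2 * (1 + ρ)) ^ 3 := by gcongr
      _ = _ := by ring
  have h3 := Real.pow_div_factorial_le_exp (x := (1 + ρ) / (4 * K)) (by positivity) 3
  have h4 : (1 + ρ) ^ 3 ≤ 6 * (4 * K) ^ 3 * Real.exp ((1 + ρ) / (4 * K)) := by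
    rw [div_le_iff₀ (by positivity), div_pow, div_le_iff₀ (by positivity)] at h3
    norm_num [Nat.factorial] at h3 ⊢
    linarith
  calc (1 + x) ^ 6 * Real.exp (-(1 / 2) * (K⁻¹ * ρ)) ≤
        8 * (6 * (4 * K) ^ 3 * Real.exp ((1 + ρ) / (4 * K))) *
          Real.exp (-(1 / 2) * (K⁻¹ * ρ)) := by
        gcongr
        linarith
    _ = 48 * (4 * K) ^ 3 * (Real.exp ((1 + ρ) / (4 * K)) * Real.exp (-(1 / 2) * (K⁻¹ * ρ))) := by
        ring
    _ = _ := by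
        rw [mul_assoc (48 * (4 * K) ^ 3), ← Real.exp_add, ← Real.exp_add]
        congr 2
        field_simp
        ring

/-- The constant in the bounds on the derivatives of the Gaussian kernel. -/
def gaussConst (d : ℕ) (κ K : ℝ) : ℝ :=
  (κ ^ d)⁻¹ * (720 * (2 * κ⁻¹ + 1) ^ 6 * (48 * (4 * K) ^ 3 * Real.exp ((4 * K)⁻¹)))

theorem gaussConst_pos (hκ : 0 < κ) (hK : 0 < K) : 0 < gaussConst d κ K := by
  unfold gaussConst
  positivity

/-- Bounds on the derivatives of the Gaussian kernel, in rescaled variables. -/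
theorem norm_iteratedFDeriv_scaled_le (h : ScaledBounds S κ K q) {n : ℕ} (hn : n ≤ 6) (z : State d) :
    (Real.sqrt S.det)⁻¹ *
        ‖iteratedFDeriv ℝ n (fun z => Real.exp (-(1 / 2) * scaledForm S q z z)) z‖ ≤
      gaussConst d κ K * (q ^ (4 * d))⁻¹ *
        Real.exp (-(4 * K)⁻¹ * (‖z.1‖ ^ 2 + ‖z.2‖ ^ 2)) := by
  have hκ := h.κ_pos
  have hK := h.K_pos
  have hq := h.q_pos
  have h1 := norm_iteratedFDeriv_gaussian_le (B := scaledForm S q) (M := 2 * κ⁻¹) (by positivity)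
    (fun x y => h.inv_symm _ _)
    (fun x => le_trans (by positivity) (h.scaledForm_lower x)) h.scaledForm_upper n z
  have h2 : (n.factorial : ℝ) ≤ 720 := by
    have : n.factorial ≤ Nat.factorial 6 := Nat.factorial_le hn
    exact_mod_cast this
  have h3 : Real.exp (-(1 / 2) * scaledForm S q z z) ≤
      Real.exp (-(1 / 2) * (K⁻¹ * (‖z.1‖ ^ 2 + ‖z.2‖ ^ 2))) := by
    have := h.scaledForm_lower z
    exact Real.exp_le_exp.2 (by linarith)
  have h4 : ((2 * κ⁻¹ + 1) * (1 + ‖z‖)) ^ n ≤ (2 * κ⁻¹ + 1) ^ 6 * (1 + ‖z‖) ^ 6 := by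
    rw [← mul_pow]
    refine pow_le_pow_right₀ ?_ hn
    have : 0 < κ⁻¹ := by positivity
    nlinarith [norm_nonneg z]
  have h5 : ‖z‖ ^ 2 ≤ ‖z.1‖ ^ 2 + ‖z.2‖ ^ 2 := by
    rcases max_choice ‖z.1‖ ‖z.2‖ with h | h <;> rw [Prod.norm_def, h]
    · linarith [sq_nonneg ‖z.2‖]
    · linarith [sq_nonneg ‖z.1‖]
  have h6 := one_add_pow_six_mul_exp_le hK (norm_nonneg z) h5
  calc _ ≤ ((κ ^ d)⁻¹ * (q ^ (4 * d))⁻¹) *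
        (720 * Real.exp (-(1 / 2) * (K⁻¹ * (‖z.1‖ ^ 2 + ‖z.2‖ ^ 2))) *
          ((2 * κ⁻¹ + 1) ^ 6 * (1 + ‖z‖) ^ 6)) := by
        refine mul_le_mul h.inv_sqrt_det_le (h1.trans ?_) (norm_nonneg _) (by positivity)
        gcongr
    _ = ((κ ^ d)⁻¹ * (q ^ (4 * d))⁻¹) * (720 * (2 * κ⁻¹ + 1) ^ 6 *
          ((1 + ‖z‖) ^ 6 * Real.exp (-(1 / 2) * (K⁻¹ * (‖z.1‖ ^ 2 + ‖z.2‖ ^ 2))))) := by ring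
    _ ≤ ((κ ^ d)⁻¹ * (q ^ (4 * d))⁻¹) * (720 * (2 * κ⁻¹ + 1) ^ 6 *
          (48 * (4 * K) ^ 3 * Real.exp ((4 * K)⁻¹) *
            Real.exp (-(4 * K)⁻¹ * (‖z.1‖ ^ 2 + ‖z.2‖ ^ 2)))) := by gcongr
    _ = _ := by
        unfold gaussConst
        ring

end ScaledBounds

end Forms

/-! ### The Gaussian bounds -/

section Bounds

variable {d : ℕ} {b : Coefficients d} {θ : ℝ → State d} {T τ Λ C c₀ : ℝ}

/-- The ellipticity constant of the rescaled covariance. -/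
def lowerConst (Λ C c₀ : ℝ) : ℝ := Λ⁻¹ * (2 + (32 * C ^ 2 + 16) / c₀ ^ 2)⁻¹

/-- The upper bound for the rescaled covariance. -/
def upperConst (Λ C : ℝ) : ℝ := 2 * Λ * (1 + C ^ 2)

/-- The canonical basis of `ℝ^d × ℝ^d`. -/
def stdBasis (d : ℕ) (i : Fin d ⊕ Fin d) : State d := (coordsEquiv d).symm (Pi.single i 1)

theorem coords_stdBasis (i : Fin d ⊕ Fin d) : coords (stdBasis d i) = Pi.single i 1 :=
  coords_coordsEquiv_symm _

namespace FrozenReg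

variable (h : FrozenReg b θ T τ Λ C c₀)
include h

theorem lowerConst_pos : 0 < lowerConst Λ C c₀ := by
  have := h.Λ_pos
  have := h.c₀_pos
  unfold lowerConst
  positivity

theorem upperConst_pos : 0 < upperConst Λ C := by
  have := h.Λ_pos
  unfold upperConst
  positivity

theorem covMatrix_apply {t s : ℝ} (ht : t ∈ Icc 0 T) (hs : s ∈ Icc 0 T) (i j : Fin d ⊕ Fin d) :
    covMatrix b θ t s i j =
      ∫ r in t..s, inner ℝ (noise b θ s (stdBasis d i) r) (noise b θ s (stdBasis d j) r) := by
  rw [← h.covMatrix_form ht hs, coords_stdBasis, coords_stdBasis]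
  simp

theorem covMatrix_isHermitian {t s : ℝ} (ht : t ∈ Icc 0 T) (hs : s ∈ Icc 0 T) :
    (covMatrix b θ t s).IsHermitian := by
  ext i j
  rw [Matrix.conjTranspose_apply, star_trivial, h.covMatrix_apply ht hs, h.covMatrix_apply ht hs]
  simp_rw [real_inner_comm]

theorem scaledBounds {t s : ℝ} (h0 : 0 ≤ t) (hts : t < s) (hsT : s ≤ T) :
    ScaledBounds (covMatrix b θ t s) (lowerConst Λ C c₀) (upperConst Λ C) (√(s - t)) := by
  have hst : 0 < s - t := sub_pos.2 hts
  have h2 : √(s - t) ^ 2 = s - t := Real.sq_sqrt hst.le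
  have h6 : √(s - t) ^ 6 = (s - t) ^ 3 := by
    rw [show √(s - t) ^ 6 = (√(s - t) ^ 2) ^ 3 by ring, h2]
  refine ⟨h.lowerConst_pos, h.upperConst_pos, Real.sqrt_pos.2 hst,
    h.covMatrix_isHermitian ⟨h0, hts.le.trans hsT⟩ ⟨h0.trans hts.le, hsT⟩, fun ζ => ?_, fun ζ => ?_⟩
  · rw [h2, h6]
    exact h.le_covMatrix h0 hts.le hsT ζ
  · rw [h2, h6]
    exact h.covMatrix_le h0 hts.le hsT ζ

omit h in
theorem mean₁_eq (t s : ℝ) (x : State d) : mean₁ b θ t s x = x.1 + mean₁ b θ t s 0 := by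
  simp [mean₁]

theorem pw_mean₂ {t : ℝ} (ht : t ∈ Icc 0 T) (x : State d) :
    PW T τ fun r => b.F₂ r (θ r) + b.D₁F₂ r (θ r) (x.1 - (θ r).1)
      + b.D₁F₂ r (θ r) (∫ v in t..r, b.F₁ v (θ v)) := by
  have h1 : PW T τ fun r => ∫ v in t..r, b.F₁ v (θ v) :=
    PW.of_continuousOn h.T_pos.le (h.pw_F₁.continuousOn_integral_right t ht) h.τ_mem
  exact (h.pw_F₂.prodMk (h.pw_D.prodMk (h.pw_θ.prodMk h1))).comp
    (φ := fun z : Vec d × Mat d × State d × Vec d => z.1 + z.2.1 (x.1 - z.2.2.1.1) + z.2.1 z.2.2.2)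
    (by fun_prop)

theorem mean₂_eq {t s : ℝ} (ht : t ∈ Icc 0 T) (hs : s ∈ Icc 0 T) (x : State d) :
    mean₂ b θ t s x = x.2 + R b θ t s x.1 + mean₂ b θ t s 0 := by
  have h1 : R b θ t s x.1 = ∫ r in t..s, b.D₁F₂ r (θ r) x.1 :=
    ((ContinuousLinearMap.apply ℝ (Vec d) x.1).intervalIntegral_comp_comm
      (h.pw_D.intervalIntegrable ht hs)).symm
  have h2 : IntervalIntegrable (fun r => b.D₁F₂ r (θ r) x.1) volume t s :=
    (h.pw_D.comp (φ := fun A : Mat d => A x.1) (by fun_prop)).intervalIntegrable ht hs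
  rw [mean₂, mean₂, h1, add_assoc, Prod.snd_zero, zero_add,
    ← intervalIntegral.integral_add h2 ((h.pw_mean₂ ht 0).intervalIntegrable ht hs)]
  congr 1
  refine intervalIntegral.integral_congr fun r _ => ?_
  simp only [map_sub, Prod.fst_zero, map_zero]
  abel

end FrozenReg

/-- The deviation `y - m(x)`, for a mean `m(x) = (x₁ + c₁, x₂ + R x₁ + c₂)`. -/
def devOf (R : Mat d) (c x y : State d) : State d :=
  (y.1 - (x.1 + c.1), y.2 - (x.2 + R x.1 + c.2))

theorem FrozenReg.deviation_eq (h : FrozenReg b θ T τ Λ C c₀) {t s : ℝ} (ht : t ∈ Icc 0 T)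
    (hs : s ∈ Icc 0 T) (x y : State d) :
    deviation b θ t x s y =
      coords (devOf (R b θ t s) (mean₁ b θ t s 0, mean₂ b θ t s 0) x y) := by
  rw [deviation, FrozenReg.mean₁_eq, h.mean₂_eq ht hs]
  rfl

theorem FrozenReg.density_eq (h : FrozenReg b θ T τ Λ C c₀) {t s : ℝ} (ht : t ∈ Icc 0 T)
    (hs : s ∈ Icc 0 T) (x y : State d) :
    density b θ t x s y = ((2 * Real.pi) ^ d)⁻¹ * (Real.sqrt (covMatrix b θ t s).det)⁻¹ *
      Real.exp (-(1 / 2) * gaussForm (covMatrix b θ t s)⁻¹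
        (devOf (R b θ t s) (mean₁ b θ t s 0, mean₂ b θ t s 0) x y)
        (devOf (R b θ t s) (mean₁ b θ t s 0, mean₂ b θ t s 0) x y)) := by
  rw [density, h.deviation_eq ht hs, gaussForm_apply]

theorem FrozenReg.contDiff_density (h : FrozenReg b θ T τ Λ C c₀) {t s : ℝ} (ht : t ∈ Icc 0 T)
    (hs : s ∈ Icc 0 T) :
    ContDiff ℝ (⊤ : ℕ∞) (fun z : State d × State d => density b θ t z.1 s z.2) := by
  simp only [h.density_eq ht hs, devOf]
  fun_prop

theorem FrozenReg.mixedDerivNorm_le (h : FrozenReg b θ T τ Λ C c₀) {t s : ℝ} (h0 : 0 ≤ t)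
    (hts : t < s) (hsT : s ≤ T) (x y : State d) {k₁ k₂ l : ℕ} (hk₁ : k₁ ≤ 2) (hk₂ : k₂ ≤ 2)
    (hl : l ≤ 2) :
    mixedDerivNorm k₁ k₂ l (fun x' y' => density b θ t x' s y') x y ≤
      ((1 + C) ^ 2 * ScaledBounds.gaussConst d (lowerConst Λ C c₀) (upperConst Λ C) * (4 * upperConst Λ C)) *
        (s - t) ^ (-((3 * k₂ + k₁ + l : ℕ) : ℝ) / 2) *
        boundKernel b θ (4 * upperConst Λ C)⁻¹ t x s y := by
  have ht : t ∈ Icc 0 T := ⟨h0, hts.le.trans hsT⟩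
  have hs : s ∈ Icc 0 T := ⟨h0.trans hts.le, hsT⟩
  have hSB := h.scaledBounds h0 hts hsT
  have hst : 0 < s - t := sub_pos.2 hts
  have hκ := hSB.κ_pos
  have hK := hSB.K_pos
  have hC := h.C_pos
  set q := √(s - t) with hq
  have hq0 : 0 < q := hSB.q_pos
  have hq2 : q ^ 2 = s - t := Real.sq_sqrt hst.le
  set S := covMatrix b θ t s with hS
  set κ := lowerConst Λ C c₀
  set K := upperConst Λ C
  set m₁ := mean₁ b θ t s 0 with hm₁
  set m₂ := mean₂ b θ t s 0 with hm₂
  set Rts := R b θ t s with hRts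
  let g : State d → ℝ := fun z => Real.exp (-(1 / 2) * ScaledBounds.scaledForm S q z z)
  have hg : ContDiff ℝ (⊤ : ℕ∞) g := by fun_prop
  let A : ℝ := ((2 * Real.pi) ^ d)⁻¹ * (Real.sqrt S.det)⁻¹
  -- The rescaled deviation is affine in x₁, x₂, y₁ with linear parts ι₁, ι₂, ι₃, whose norms are
  -- the cost of one derivative: q⁻¹, q⁻³ and q⁻¹ up to constants. The term q⁻³R in ι₁ is no worse
  -- than q⁻¹ because ‖R‖ ≤ Cq². The variable y₂ is not differentiated and stays in the base point
  -- `z₀`.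
  let ι₁ : Vec d →L[ℝ] State d :=
    (-(q⁻¹ • ContinuousLinearMap.id ℝ (Vec d))).prod (-((q ^ 3)⁻¹ • Rts))
  let ι₂ : Vec d →L[ℝ] State d :=
    (0 : Vec d →L[ℝ] Vec d).prod (-((q ^ 3)⁻¹ • ContinuousLinearMap.id ℝ (Vec d)))
  let ι₃ : Vec d →L[ℝ] State d :=
    (q⁻¹ • ContinuousLinearMap.id ℝ (Vec d)).prod (0 : Vec d →L[ℝ] Vec d)
  let z₀ : State d := (-(q⁻¹ • m₁), (q ^ 3)⁻¹ • (y.2 - m₂))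
  have hz : ∀ x₁ x₂ y₁ : Vec d, z₀ + ι₁ x₁ + ι₂ x₂ + ι₃ y₁ =
      (q⁻¹ • (y₁ - (x₁ + m₁)), (q ^ 3)⁻¹ • (y.2 - (x₂ + Rts x₁ + m₂))) := by
    intro x₁ x₂ y₁
    refine Prod.ext ?_ ?_
    · simp [z₀, ι₁, ι₂, ι₃, smul_sub]
      abel
    · simp [z₀, ι₁, ι₂, ι₃, smul_sub]
      abel
  have hdens : ∀ x₁ x₂ y₁ : Vec d, density b θ t (x₁, x₂) s (y₁, y.2) =
      A * g (z₀ + ι₁ x₁ + ι₂ x₂ + ι₃ y₁) := by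
    intro x₁ x₂ y₁
    rw [h.density_eq ht hs, hz]
    simp only [A, g, ScaledBounds.scaledForm_apply, devOf, smul_smul,
      mul_inv_cancel₀ hq0.ne', mul_inv_cancel₀ (pow_pos hq0 3).ne', one_smul]
    rfl
  have hA : 0 ≤ A := by positivity
  have hg' : ContDiff ℝ (⊤ : ℕ∞) fun z => A * g z := contDiff_const.mul hg
  have hι₁ : ‖ι₁‖ ≤ (1 + C) * q⁻¹ := by
    refine ContinuousLinearMap.opNorm_le_bound _ (by positivity) fun v => ?_
    have hR : ‖Rts v‖ ≤ C * q ^ 2 * ‖v‖ := by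
      refine (Rts.le_opNorm v).trans (mul_le_mul_of_nonneg_right ?_ (norm_nonneg _))
      rw [hq2]
      exact h.norm_R_le h0 hts.le hsT
    rw [Prod.norm_def]
    refine max_le ?_ ?_
    · simp only [ι₁, ContinuousLinearMap.prod_apply, neg_apply, smul_apply,
        ContinuousLinearMap.id_apply, norm_neg, norm_smul, norm_inv, Real.norm_eq_abs,
        abs_of_pos hq0]
      refine mul_le_mul_of_nonneg_right ?_ (norm_nonneg _)
      nlinarith [inv_pos.2 hq0]
    · simp only [ι₁, ContinuousLinearMap.prod_apply, neg_apply, smul_apply,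
        norm_neg, norm_smul, norm_inv, norm_pow, Real.norm_eq_abs, abs_of_pos hq0]
      calc (q ^ 3)⁻¹ * ‖Rts v‖ ≤ (q ^ 3)⁻¹ * (C * q ^ 2 * ‖v‖) := by gcongr
        _ = C * q⁻¹ * ‖v‖ := by field_simp
        _ ≤ (1 + C) * q⁻¹ * ‖v‖ := by gcongr; linarith
  have hι₂ : ‖ι₂‖ ≤ (q ^ 3)⁻¹ := by
    refine ContinuousLinearMap.opNorm_le_bound _ (by positivity) fun v => ?_
    simp only [ι₂, ContinuousLinearMap.prod_apply, neg_apply, smul_apply, zero_apply, Prod.norm_def,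
        ContinuousLinearMap.id_apply, norm_neg, norm_smul, norm_inv, norm_pow, Real.norm_eq_abs,
        abs_of_pos hq0, norm_zero]
    exact max_le (by positivity) le_rfl
  have hι₃ : ‖ι₃‖ ≤ q⁻¹ := by
    refine ContinuousLinearMap.opNorm_le_bound _ (by positivity) fun v => ?_
    simp only [ι₃, ContinuousLinearMap.prod_apply, smul_apply, zero_apply, Prod.norm_def,
        ContinuousLinearMap.id_apply, norm_smul, norm_inv, Real.norm_eq_abs,
        abs_of_pos hq0, norm_zero]
    exact max_le le_rfl (by positivity)
  have key := norm_nested_iteratedFDeriv_le hg' ι₁ ι₂ ι₃ z₀ k₁ k₂ l x.1 x.2 y.1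
  simp only [← hdens] at key
  change mixedDerivNorm k₁ k₂ l (fun x' y' => density b θ t x' s y') x y ≤ _ at key
  refine key.trans ?_
  rw [hz]
  set z : State d := (q⁻¹ • (y.1 - (x.1 + m₁)), (q ^ 3)⁻¹ • (y.2 - (x.2 + Rts x.1 + m₂))) with hzdef
  have hmul : ‖iteratedFDeriv ℝ (k₁ + k₂ + l) (fun z => A * g z) z‖ =
      A * ‖iteratedFDeriv ℝ (k₁ + k₂ + l) g z‖ := by
    have := iteratedFDeriv_const_smul_apply (𝕜 := ℝ) (a := A) (f := g) (x := z) (i := k₁ + k₂ + l)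
      (hg.contDiffAt.of_le (by exact_mod_cast le_top))
    rw [show (fun z => A * g z) = A • g from rfl, this, norm_smul, Real.norm_of_nonneg hA]
  have hG := hSB.norm_iteratedFDeriv_scaled_le (n := k₁ + k₂ + l) (by omega) z
  have hA' : A * ‖iteratedFDeriv ℝ (k₁ + k₂ + l) g z‖ ≤ ScaledBounds.gaussConst d κ K * (q ^ (4 * d))⁻¹ *
        Real.exp (-(4 * K)⁻¹ * (‖z.1‖ ^ 2 + ‖z.2‖ ^ 2)) := by
    refine le_trans ?_ hG
    have hpi : ((2 * Real.pi) ^ d)⁻¹ ≤ 1 := by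
      refine inv_le_one_of_one_le₀ (one_le_pow₀ ?_)
      linarith [Real.pi_gt_three]
    have hnn : 0 ≤ (Real.sqrt S.det)⁻¹ * ‖iteratedFDeriv ℝ (k₁ + k₂ + l) g z‖ := by positivity
    calc _ = ((2 * Real.pi) ^ d)⁻¹ * ((Real.sqrt S.det)⁻¹ *
          ‖iteratedFDeriv ℝ (k₁ + k₂ + l) g z‖) := by simp only [A]; ring
      _ ≤ 1 * ((Real.sqrt S.det)⁻¹ * ‖iteratedFDeriv ℝ (k₁ + k₂ + l) g z‖) := by gcongr
      _ = _ := one_mul _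
  have hpow : ‖ι₁‖ ^ k₁ * ‖ι₂‖ ^ k₂ * ‖ι₃‖ ^ l ≤ (1 + C) ^ 2 * (q ^ (3 * k₂ + k₁ + l))⁻¹ := by
    calc ‖ι₁‖ ^ k₁ * ‖ι₂‖ ^ k₂ * ‖ι₃‖ ^ l ≤ ((1 + C) * q⁻¹) ^ k₁ * ((q ^ 3)⁻¹) ^ k₂ * (q⁻¹) ^ l := by
          gcongr
      _ = (1 + C) ^ k₁ * (q ^ (3 * k₂ + k₁ + l))⁻¹ := by
          rw [mul_pow, inv_pow, inv_pow, inv_pow, ← pow_mul, pow_add, pow_add, mul_inv, mul_inv]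
          ring
      _ ≤ (1 + C) ^ 2 * (q ^ (3 * k₂ + k₁ + l))⁻¹ := by
          have : (1 : ℝ) ≤ 1 + C := by linarith
          gcongr
  have hq4 : q ^ (4 * d) = (s - t) ^ (2 * d) := by
    rw [← hq2, ← pow_mul]
    congr 1
    ring
  have hrpow : (s - t) ^ (-((3 * k₂ + k₁ + l : ℕ) : ℝ) / 2) = (q ^ (3 * k₂ + k₁ + l))⁻¹ := by
    rw [neg_div, Real.rpow_neg hst.le, hq, Real.sqrt_eq_rpow, ← Real.rpow_natCast,
      ← Real.rpow_mul hst.le]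
    congr 2
    ring
  -- The kernel carries c = (4K)⁻¹ also as a prefactor, which the factor 4K in the constant cancels.
  have hkern : boundKernel b θ (4 * K)⁻¹ t x s y = (4 * K)⁻¹ * ((q ^ (4 * d))⁻¹ *
      Real.exp (-(4 * K)⁻¹ * (‖z.1‖ ^ 2 + ‖z.2‖ ^ 2))) := by
    have e1 : ‖z.1‖ ^ 2 = ‖y.1 - mean₁ b θ t s x‖ ^ 2 / (s - t) := by
      rw [hzdef, FrozenReg.mean₁_eq, norm_smul, mul_pow, Real.norm_eq_abs, sq_abs, inv_pow, hq2,
        ← hm₁]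
      ring
    have e2 : ‖z.2‖ ^ 2 = ‖y.2 - mean₂ b θ t s x‖ ^ 2 / (s - t) ^ 3 := by
      rw [hzdef, h.mean₂_eq ht hs, norm_smul, mul_pow, Real.norm_eq_abs, sq_abs, inv_pow, ← pow_mul,
        ← hm₂, show q ^ (3 * 2) = (q ^ 2) ^ 3 by ring, hq2]
      ring
    rw [boundKernel, e1, e2, hq4]
    ring
  rw [hmul, hrpow, hkern]
  have hgc := ScaledBounds.gaussConst_pos (d := d) hκ hK
  calc _ ≤ ((1 + C) ^ 2 * (q ^ (3 * k₂ + k₁ + l))⁻¹) * (ScaledBounds.gaussConst d κ K * (q ^ (4 * d))⁻¹ *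
        Real.exp (-(4 * K)⁻¹ * (‖z.1‖ ^ 2 + ‖z.2‖ ^ 2))) := by
        refine mul_le_mul hpow hA' (by positivity) (by positivity)
    _ = _ := by
        field_simp

theorem FrozenReg.density_le (h : FrozenReg b θ T τ Λ C c₀) {t s : ℝ} (h0 : 0 ≤ t)
    (hts : t < s) (hsT : s ≤ T) (x y : State d) :
    density b θ t x s y ≤
      ((1 + C) ^ 2 * ScaledBounds.gaussConst d (lowerConst Λ C c₀) (upperConst Λ C) * (4 * upperConst Λ C)) *
        boundKernel b θ (4 * upperConst Λ C)⁻¹ t x s y := by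
  have h1 := h.mixedDerivNorm_le h0 hts hsT x y (k₁ := 0) (k₂ := 0) (l := 0) (by simp) (by simp)
    (by simp)
  have h2 : mixedDerivNorm 0 0 0 (fun x' y' => density b θ t x' s y') x y =
      ‖density b θ t x s y‖ := by
    simp [mixedDerivNorm, norm_iteratedFDeriv_zero]
  rw [h2] at h1
  refine (Real.le_norm_self _).trans (h1.trans_eq ?_)
  simp

end Bounds

/-! ### Derivatives of Gaussian densities -/

section MatrixCalculus

variable {n : Type*} [Fintype n] [DecidableEq n]

attribute [local instance] Matrix.linftyOpNormedAddCommGroup Matrix.linftyOpNormedSpace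
  Matrix.linftyOpNormedRing Matrix.linftyOpNormedAlgebra

theorem hasDerivWithinAt_matrix {S : ℝ → Matrix n n ℝ} {S' : Matrix n n ℝ} {U : Set ℝ} {t : ℝ}
    (hS : ∀ i j, HasDerivWithinAt (fun r => S r i j) (S' i j) U t) : HasDerivWithinAt S S' U t := by
  have h1 : ∀ M : Matrix n n ℝ, ∑ i, ∑ j, M i j • Matrix.single i j (1 : ℝ) = M := by
    intro M
    conv_rhs => rw [Matrix.matrix_eq_sum_single M]
    simp [Matrix.smul_single]
  have h2 : HasDerivWithinAt (fun r => ∑ i, ∑ j, S r i j • Matrix.single i j (1 : ℝ))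
      (∑ i, ∑ j, S' i j • Matrix.single i j (1 : ℝ)) U t :=
    HasDerivWithinAt.fun_sum fun i _ => HasDerivWithinAt.fun_sum fun j _ => (hS i j).smul_const _
  simpa only [h1] using h2

omit [DecidableEq n] in
theorem hasDerivWithinAt_matrix_apply {S : ℝ → Matrix n n ℝ} {S' : Matrix n n ℝ} {U : Set ℝ} {t : ℝ}
    (hS : HasDerivWithinAt S S' U t) (i j : n) : HasDerivWithinAt (fun r => S r i j) (S' i j) U t := by
  let e : Matrix n n ℝ →L[ℝ] ℝ := LinearMap.toContinuousLinearMap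
    (((LinearMap.proj j : (n → ℝ) →ₗ[ℝ] ℝ)).comp (LinearMap.proj i : (n → n → ℝ) →ₗ[ℝ] (n → ℝ)))
  exact e.hasFDerivAt.comp_hasDerivWithinAt t hS

/-- Jacobi's formula. -/
theorem hasDerivWithinAt_det {S : ℝ → Matrix n n ℝ} {S' : Matrix n n ℝ} {U : Set ℝ} {t : ℝ}
    (hS : HasDerivWithinAt S S' U t) (hdet : (S t).det ≠ 0) :
    HasDerivWithinAt (fun r => (S r).det) ((S t).det * ((S t)⁻¹ * S').trace) U t := by
  have hd : DifferentiableAt ℝ (fun M : Matrix n n ℝ => M.det) (S t) := by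
    simp only [Matrix.det_apply]
    refine DifferentiableAt.fun_sum fun σ _ => ?_
    simp only [Units.smul_def, zsmul_eq_mul]
    refine DifferentiableAt.const_mul (𝔸 := ℝ) ?_ _
    let e : n → Matrix n n ℝ →L[ℝ] ℝ := fun i => LinearMap.toContinuousLinearMap
      (((LinearMap.proj i : (n → ℝ) →ₗ[ℝ] ℝ)).comp
        (LinearMap.proj (σ i) : (n → n → ℝ) →ₗ[ℝ] (n → ℝ)))
    have h1 : ContDiff ℝ 1 fun M : Matrix n n ℝ => ∏ i, e i M :=
      contDiff_prod fun i _ => (e i).contDiff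
    exact (h1.differentiable one_ne_zero).differentiableAt
  -- The determinant is differentiable, being a polynomial; its differential in the direction S' is
  -- read off on the line S t + r S' = S t (1 + r (S t)⁻¹S'), where the expansion of det(1 + rX)
  -- gives the trace.
  have h1 : HasDerivAt (fun r : ℝ => (S t + r • S').det)
      (fderiv ℝ (fun M : Matrix n n ℝ => M.det) (S t) S') 0 := by
    have h2 : HasDerivAt (fun r : ℝ => S t + r • S') S' 0 := by
      have := ((hasDerivAt_id (0 : ℝ)).smul_const S').const_add (S t)
      rw [one_smul] at this
      exact this
    have h3 : HasFDerivAt (fun M : Matrix n n ℝ => M.det)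
        (fderiv ℝ (fun M : Matrix n n ℝ => M.det) (S t)) (S t + (0 : ℝ) • S') := by
      simpa using hd.hasFDerivAt
    exact h3.comp_hasDerivAt (0 : ℝ) h2
  have h4 : HasDerivAt (fun r : ℝ => (S t + r • S').det) ((S t).det * ((S t)⁻¹ * S').trace) 0 := by
    have h5 : ∀ r : ℝ, (S t + r • S').det = (S t).det * (1 + r • ((S t)⁻¹ * S')).det := by
      intro r
      rw [← Matrix.det_mul, mul_add, mul_one, Matrix.mul_smul, ← mul_assoc,
        Matrix.mul_nonsing_inv _ (isUnit_iff_ne_zero.2 hdet), one_mul]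
    simp only [h5]
    refine HasDerivAt.const_mul _ ?_
    obtain ⟨Q, h8⟩ : ∃ Q : Polynomial ℝ, ∀ r : ℝ, (1 + r • ((S t)⁻¹ * S')).det =
        1 + ((S t)⁻¹ * S').trace * r + Q.eval r * r ^ 2 :=
      ⟨_, fun r => Matrix.det_one_add_smul r _⟩
    rw [funext h8]
    have h6 : HasDerivAt (fun r : ℝ => Polynomial.eval r Q * r ^ 2) 0 0 := by
      refine HasDerivAt.congr_deriv ((Q.hasDerivAt (0 : ℝ)).fun_mul ((hasDerivAt_id' (0 : ℝ)).fun_pow 2)) ?_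
      simp
    refine HasDerivAt.congr_deriv
      ((((hasDerivAt_id' (0 : ℝ)).const_mul ((S t)⁻¹ * S').trace).const_add 1).fun_add h6) ?_
    simp
  rw [h4.unique h1]
  exact hd.hasFDerivAt.comp_hasDerivWithinAt t hS

theorem hasDerivWithinAt_inv {S : ℝ → Matrix n n ℝ} {S' : Matrix n n ℝ} {U : Set ℝ} {t : ℝ}
    (hS : HasDerivWithinAt S S' U t) (hdet : (S t).det ≠ 0) :
    HasDerivWithinAt (fun r => (S r)⁻¹) (-((S t)⁻¹ * S' * (S t)⁻¹)) U t := by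
  have hu : IsUnit (S t) := (Matrix.isUnit_iff_isUnit_det _).2 (isUnit_iff_ne_zero.2 hdet)
  obtain ⟨u, hu⟩ := hu
  have h1 := hasFDerivAt_ringInverse (𝕜 := ℝ) u
  rw [hu] at h1
  have h2 := h1.comp_hasDerivWithinAt t hS
  have h3 : ((u⁻¹ : (Matrix n n ℝ)ˣ) : Matrix n n ℝ) = (S t)⁻¹ := by
    rw [← hu, Matrix.coe_units_inv]
  simp only [h3] at h2
  have h4 : (fun r => (S r)⁻¹) = Ring.inverse ∘ S := by
    funext r
    exact Matrix.nonsing_inv_eq_ringInverse _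
  rw [h4]
  refine HasDerivWithinAt.congr_deriv (f' := _) h2 ?_
  simp

omit [DecidableEq n] in
theorem hasDerivWithinAt_dotProduct {u v : ℝ → n → ℝ} {u' v' : n → ℝ} {U : Set ℝ} {t : ℝ}
    (hu : HasDerivWithinAt u u' U t) (hv : HasDerivWithinAt v v' U t) :
    HasDerivWithinAt (fun r => u r ⬝ᵥ v r) (u' ⬝ᵥ v t + u t ⬝ᵥ v') U t := by
  rw [hasDerivWithinAt_pi] at hu hv
  simp only [dotProduct, ← Finset.sum_add_distrib]
  exact HasDerivWithinAt.fun_sum fun i _ => (hu i).mul (hv i)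

omit [DecidableEq n] in
theorem hasDerivWithinAt_mulVec {P : ℝ → Matrix n n ℝ} {P' : Matrix n n ℝ} {v : ℝ → n → ℝ}
    {v' : n → ℝ} {U : Set ℝ} {t : ℝ}
    (hP : ∀ i j, HasDerivWithinAt (fun r => P r i j) (P' i j) U t) (hv : HasDerivWithinAt v v' U t) :
    HasDerivWithinAt (fun r => (P r).mulVec (v r)) (P'.mulVec (v t) + (P t).mulVec v') U t := by
  rw [hasDerivWithinAt_pi]
  intro i
  refine hasDerivWithinAt_dotProduct (u := fun r => P r i) ?_ hv
  rw [hasDerivWithinAt_pi]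
  exact fun j => hP i j

/-- The derivative of a Gaussian density with respect to a parameter. -/
theorem hasDerivWithinAt_gaussian {S : ℝ → Matrix n n ℝ} {S' : Matrix n n ℝ} {u : ℝ → n → ℝ}
    {u' : n → ℝ} {U : Set ℝ} {t : ℝ} (hS : ∀ i j, HasDerivWithinAt (fun r => S r i j) (S' i j) U t)
    (hu : HasDerivWithinAt u u' U t) (hpos : (S t).PosDef) :
    HasDerivWithinAt
      (fun r => (√(S r).det)⁻¹ * Real.exp (-(1 / 2) * (u r ⬝ᵥ (S r)⁻¹.mulVec (u r))))
      ((√(S t).det)⁻¹ * Real.exp (-(1 / 2) * (u t ⬝ᵥ (S t)⁻¹.mulVec (u t))) *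
        (-(1 / 2) * ((S t)⁻¹ * S').trace - (S t)⁻¹.mulVec (u t) ⬝ᵥ u' +
          1 / 2 * ((S t)⁻¹.mulVec (u t) ⬝ᵥ S'.mulVec ((S t)⁻¹.mulVec (u t))))) U t := by
  have hdet := hpos.det_pos
  have hS' := hasDerivWithinAt_matrix hS
  have h1 := ((hasDerivWithinAt_det hS' hdet.ne').sqrt hdet.ne').inv (Real.sqrt_pos.2 hdet).ne'
  have h2 := hasDerivWithinAt_dotProduct hu (hasDerivWithinAt_mulVec
    (hasDerivWithinAt_matrix_apply (hasDerivWithinAt_inv hS' hdet.ne')) hu)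
  have h3 := h1.mul (h2.const_mul (-(1 / 2) : ℝ)).exp
  have hT : ((S t)⁻¹).transpose = (S t)⁻¹ := by
    rw [Matrix.transpose_nonsing_inv]
    congr 1
    have := hpos.isHermitian
    rwa [Matrix.IsHermitian, Matrix.conjTranspose_eq_transpose_of_trivial] at this
  have h4 : ∀ v w : n → ℝ, v ⬝ᵥ (S t)⁻¹.mulVec w = (S t)⁻¹.mulVec v ⬝ᵥ w := by
    intro v w
    rw [Matrix.dotProduct_mulVec, ← Matrix.mulVec_transpose, hT]
  have h5 : √(S t).det ^ 2 = (S t).det := Real.sq_sqrt hdet.le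
  have h6 : √(S t).det ≠ 0 := (Real.sqrt_pos.2 hdet).ne'
  refine h3.congr_deriv ?_
  rw [Matrix.neg_mulVec, ← Matrix.mulVec_mulVec, ← Matrix.mulVec_mulVec]
  rw [dotProduct_add, dotProduct_neg, h4 _ (S'.mulVec _), h4 (u t) u', dotProduct_comm u', Pi.inv_apply]
  have h7 : (S t).det * ((S t)⁻¹ * S').trace / (2 * √(S t).det) / √(S t).det ^ 2 =
      (√(S t).det)⁻¹ * (1 / 2 * ((S t)⁻¹ * S').trace) := by
    rw [h5]
    field_simp
  rw [neg_div, h7]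
  ring

end MatrixCalculus

section SpaceDerivatives

variable {E F : Type*} [NormedAddCommGroup E] [NormedSpace ℝ E] [NormedAddCommGroup F]
  [NormedSpace ℝ F]

theorem hasFDerivAt_exp_form (B : F →L[ℝ] F →L[ℝ] ℝ) (hB : ∀ u v, B u v = B v u) (A : ℝ) (w : F)
    (M : E →L[ℝ] F) (z : E) :
    HasFDerivAt (fun z => A * Real.exp (-(1 / 2) * B (w - M z) (w - M z)))
      ((A * Real.exp (-(1 / 2) * B (w - M z) (w - M z))) • (B (w - M z)).comp M) z := by
  have h1 : HasFDerivAt (fun z => w - M z) (-M) z := M.hasFDerivAt.const_sub w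
  have h2 := B.hasFDerivAt_of_bilinear h1 h1
  have h3 := ((h2.const_mul (-(1 / 2) : ℝ)).exp).const_mul A
  refine h3.congr_fderiv ?_
  ext h
  simp only [smul_apply, add_apply, ContinuousLinearMap.precompR_apply,
    ContinuousLinearMap.precompL_apply, neg_apply, map_neg, smul_eq_mul,
    ContinuousLinearMap.comp_apply, ContinuousLinearMap.compL_apply, hB (M h) (w - M z)]
  ring

theorem iteratedFDeriv_two_exp_form (B : F →L[ℝ] F →L[ℝ] ℝ) (hB : ∀ u v, B u v = B v u) (A : ℝ)
    (w : F) (M : E →L[ℝ] F) (z h k : E) :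
    iteratedFDeriv ℝ 2 (fun z => A * Real.exp (-(1 / 2) * B (w - M z) (w - M z))) z ![h, k] =
      A * Real.exp (-(1 / 2) * B (w - M z) (w - M z)) *
        (B (w - M z) (M h) * B (w - M z) (M k) - B (M h) (M k)) := by
  rw [iteratedFDeriv_two_apply]
  have h1 : fderiv ℝ (fun z => A * Real.exp (-(1 / 2) * B (w - M z) (w - M z))) =
      fun z => (A * Real.exp (-(1 / 2) * B (w - M z) (w - M z))) • (B (w - M z)).comp M :=
    funext fun z => (hasFDerivAt_exp_form B hB A w M z).fderiv
  rw [h1]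
  have h2 : HasFDerivAt (fun z => B (w - M z)) (-(B.comp M)) z :=
    (B.hasFDerivAt.comp z (M.hasFDerivAt.const_sub w)).congr_fderiv (by ext; simp)
  have h3 : HasFDerivAt (fun z => (B (w - M z)).comp M)
      (((ContinuousLinearMap.compL ℝ E F ℝ).flip M).comp (-(B.comp M))) z :=
    ((ContinuousLinearMap.compL ℝ E F ℝ).flip M).hasFDerivAt.comp z h2
  have h4 := (hasFDerivAt_exp_form B hB A w M z).smul h3
  change fderiv ℝ ((fun z => A * Real.exp (-(1 / 2) * B (w - M z) (w - M z))) •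
    fun z => (B (w - M z)).comp M) z h k = _
  rw [h4.fderiv]
  simp only [add_apply, smul_apply, ContinuousLinearMap.smulRight_apply, neg_apply, map_neg,
    ContinuousLinearMap.comp_apply, smul_eq_mul, ContinuousLinearMap.flip_apply,
    ContinuousLinearMap.compL_apply]
  ring

end SpaceDerivatives

/-! ### The Kolmogorov equation of the frozen density -/

/-- The two choices of `U` let one computation serve for the right derivative at every time and for
the two-sided derivative away from τ. -/
theorem PW.hasDerivWithinAt_integral {E : Type*} [NormedAddCommGroup E] [NormedSpace ℝ E]
    [CompleteSpace E] {T τ : ℝ} {k : ℝ → E} (hk : PW T τ k) {U : Set ℝ} {t s : ℝ}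
    (h0 : 0 ≤ t) (hts : t < s) (hsT : s ≤ T) (hU : U = Ici t ∨ (U = univ ∧ 0 < t ∧ t ≠ τ)) :
    HasDerivWithinAt (fun t => ∫ r in t..s, k r) (-k t) U t := by
  rcases hU with rfl | ⟨rfl, h0', htτ⟩
  · exact hk.hasDerivWithinAt_integral_left h0 hts hsT
  · rw [hasDerivWithinAt_univ]
    exact hk.hasDerivAt_integral_left h0' hts hsT htτ

section Kolmogorov

variable {d : ℕ} {b : Coefficients d} {θ : ℝ → State d} {T τ Λ C c₀ : ℝ}

theorem hasDerivWithinAt_coords {v : ℝ → State d} {v' : State d} {U : Set ℝ} {t : ℝ}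
    (hv : HasDerivWithinAt v v' U t) :
    HasDerivWithinAt (fun r => coords (v r)) (coords v') U t := by
  rw [hasDerivWithinAt_pi]
  exact fun i => (coordL d i).hasFDerivAt.comp_hasDerivWithinAt t hv

namespace FrozenReg

variable (h : FrozenReg b θ T τ Λ C c₀)
include h

theorem pw_mean₂_zero : PW T τ fun r => b.F₂ r (θ r) + b.D₁F₂ r (θ r) (0 - (θ r).1)
      + b.D₁F₂ r (θ r) (∫ v in (0 : ℝ)..r, b.F₁ v (θ v)) :=
  h.pw_mean₂ ⟨le_rfl, h.T_pos.le⟩ 0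

/-- In `mean₂` the time t is an endpoint and also occurs inside the integrand. Writing ∫_t^r F₁ =
∫_0^r F₁ - ∫_0^t F₁ removes it from the integrand at the price of a product term, after which the
fundamental theorem of calculus applies. -/
theorem mean₂_zero_eq {t s : ℝ} (ht : t ∈ Icc 0 T) (hs : s ∈ Icc 0 T) :
    mean₂ b θ t s 0 = (∫ r in t..s, (b.F₂ r (θ r) + b.D₁F₂ r (θ r) (0 - (θ r).1)
      + b.D₁F₂ r (θ r) (∫ v in (0 : ℝ)..r, b.F₁ v (θ v)))) -
      R b θ t s (∫ v in (0 : ℝ)..t, b.F₁ v (θ v)) := by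
  have h0 : (0 : ℝ) ∈ Icc 0 T := ⟨le_rfl, h.T_pos.le⟩
  have h1 : R b θ t s (∫ v in (0 : ℝ)..t, b.F₁ v (θ v)) =
      ∫ r in t..s, b.D₁F₂ r (θ r) (∫ v in (0 : ℝ)..t, b.F₁ v (θ v)) :=
    ((ContinuousLinearMap.apply ℝ (Vec d) _).intervalIntegral_comp_comm
      (h.pw_D.intervalIntegrable ht hs)).symm
  have h2 : IntervalIntegrable (fun r => b.D₁F₂ r (θ r) (∫ v in (0 : ℝ)..t, b.F₁ v (θ v)))
      volume t s :=
    (h.pw_D.comp (φ := fun A : Mat d => A (∫ v in (0 : ℝ)..t, b.F₁ v (θ v)))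
      (by fun_prop)).intervalIntegrable ht hs
  rw [mean₂, h1, ← intervalIntegral.integral_sub (h.pw_mean₂_zero.intervalIntegrable ht hs) h2,
    Prod.snd_zero, zero_add]
  refine intervalIntegral.integral_congr fun r hr => ?_
  have hr' := uIcc_subset_Icc ht hs hr
  have h3 := intervalIntegral.integral_add_adjacent_intervals
    (h.pw_F₁.intervalIntegrable h0 ht) (h.pw_F₁.intervalIntegrable ht hr')
  simp only [← h3, Prod.fst_zero, map_add]
  abel

omit h in
theorem eventually_mem_Icc {U : Set ℝ} {t s : ℝ} (h0 : 0 ≤ t) (hts : t < s) (hsT : s ≤ T)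
    (hU : U = Ici t ∨ (U = univ ∧ 0 < t ∧ t ≠ τ)) : ∀ᶠ r in 𝓝[U] t, r ∈ Icc 0 T := by
  have htT := hts.trans_le hsT
  rcases hU with rfl | ⟨rfl, h0', -⟩
  · filter_upwards [self_mem_nhdsWithin, nhdsWithin_le_nhds (Iio_mem_nhds htT)] with r hr hr'
    exact ⟨h0.trans hr, le_of_lt hr'⟩
  · rw [nhdsWithin_univ]
    exact Icc_mem_nhds h0' htT

/-- The derivative is the frozen drift at (t, x) transported to time s by the linear flow (z₁, z₂) ↦
(z₁, z₂ + R_{t,s}z₁). The first-order part of the frozen operator produces the same vector. -/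
theorem hasDerivWithinAt_deviation {U : Set ℝ} {t s : ℝ} (h0 : 0 ≤ t) (hts : t < s) (hsT : s ≤ T)
    (hU : U = Ici t ∨ (U = univ ∧ 0 < t ∧ t ≠ τ)) (x y : State d) :
    HasDerivWithinAt (fun r => coords (devOf (R b θ r s) (mean₁ b θ r s 0, mean₂ b θ r s 0) x y))
      (coords (b.F₁ t (θ t), b.F₂ t (θ t) + b.D₁F₂ t (θ t) (x.1 - (θ t).1) +
        R b θ t s (b.F₁ t (θ t)))) U t := by
  have ht : t ∈ Icc 0 T := ⟨h0, hts.le.trans hsT⟩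
  have hs : s ∈ Icc 0 T := ⟨h0.trans hts.le, hsT⟩
  have h0T : (0 : ℝ) ∈ Icc 0 T := ⟨le_rfl, h.T_pos.le⟩
  have hev := eventually_mem_Icc h0 hts hsT hU
  have hm₁ : HasDerivWithinAt (fun r => mean₁ b θ r s 0) (-b.F₁ t (θ t)) U t := by
    simp only [mean₁, Prod.fst_zero, zero_add]
    exact h.pw_F₁.hasDerivWithinAt_integral h0 hts hsT hU
  have hR : HasDerivWithinAt (fun r => R b θ r s) (-b.D₁F₂ t (θ t)) U t :=
    h.pw_D.hasDerivWithinAt_integral h0 hts hsT hU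
  have hΦ : HasDerivWithinAt (fun r => ∫ v in (0 : ℝ)..r, b.F₁ v (θ v)) (b.F₁ t (θ t)) U t := by
    have h1 := (h.pw_F₁.hasDerivWithinAt_integral h0 hts hsT hU).const_sub
      (∫ v in (0 : ℝ)..s, b.F₁ v (θ v))
    rw [neg_neg] at h1
    have h2 : ∀ r ∈ Icc 0 T, ∫ v in (0 : ℝ)..r, b.F₁ v (θ v) =
        (∫ v in (0 : ℝ)..s, b.F₁ v (θ v)) - ∫ v in r..s, b.F₁ v (θ v) := fun r hr => by
      rw [← intervalIntegral.integral_add_adjacent_intervals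
        (h.pw_F₁.intervalIntegrable h0T hr) (h.pw_F₁.intervalIntegrable hr hs), add_sub_cancel_right]
    exact h1.congr_of_eventuallyEq (hev.mono h2) (h2 t ht)
  have hm₂ : HasDerivWithinAt (fun r => mean₂ b θ r s 0)
      (-(b.F₂ t (θ t) + b.D₁F₂ t (θ t) (0 - (θ t).1)) - R b θ t s (b.F₁ t (θ t))) U t := by
    have h1 := (h.pw_mean₂_zero.hasDerivWithinAt_integral h0 hts hsT hU).sub (hR.clm_apply hΦ)
    refine (h1.congr_of_eventuallyEq (hev.mono fun r hr => h.mean₂_zero_eq hr hs)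
      (h.mean₂_zero_eq ht hs)).congr_deriv ?_
    simp only [neg_apply]
    abel
  refine (hasDerivWithinAt_coords ((((hm₁.const_add x.1).const_sub y.1).prodMk
    ((((hR.clm_apply (hasDerivWithinAt_const t U x.1)).const_add x.2).add hm₂).const_sub
      y.2)))).congr_deriv ?_
  congr 1
  refine Prod.ext ?_ ?_
  · simp
  · simp only [map_sub, map_zero, neg_apply]
    abel

/-- For s fixed, the integrand `noise b θ s` does not involve the lower endpoint. -/
theorem hasDerivWithinAt_covMatrix {U : Set ℝ} {t s : ℝ} (h0 : 0 ≤ t) (hts : t < s) (hsT : s ≤ T)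
    (hU : U = Ici t ∨ (U = univ ∧ 0 < t ∧ t ≠ τ)) (i j : Fin d ⊕ Fin d) :
    HasDerivWithinAt (fun r => covMatrix b θ r s i j)
      (-inner ℝ (noise b θ s (stdBasis d i) t) (noise b θ s (stdBasis d j) t)) U t := by
  have ht : t ∈ Icc 0 T := ⟨h0, hts.le.trans hsT⟩
  have hs : s ∈ Icc 0 T := ⟨h0.trans hts.le, hsT⟩
  have h1 : PW T τ fun r => inner ℝ (noise b θ s (stdBasis d i) r) (noise b θ s (stdBasis d j) r) :=
    ((h.pw_noise hs _).prodMk (h.pw_noise hs _)).comp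
      (φ := fun z : Vec d × Vec d => inner ℝ z.1 z.2) (by fun_prop)
  exact (h1.hasDerivWithinAt_integral h0 hts hsT hU).congr_of_eventuallyEq
    ((eventually_mem_Icc h0 hts hsT hU).mono fun r hr => h.covMatrix_apply hr hs i j)
    (h.covMatrix_apply ht hs i j)

/-- In x₁ alone or x₂ alone the density is the exponential of a quadratic form of w - Mz, with M₁z =
(z, Rz) and M₂z = (0, z), so first and second derivatives are explicit. -/
theorem frozenOperator_density {t s : ℝ} (h0 : 0 ≤ t) (hts : t < s) (hsT : s ≤ T) (x y : State d) :
    frozenOperator b θ t (fun x' => density b θ t x' s y) x = density b θ t x s y *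
      (1 / 2 * ∑ i, ∑ j, entries (b.a t (θ t)) i j *
        (gaussForm (covMatrix b θ t s)⁻¹
            (devOf (R b θ t s) (mean₁ b θ t s 0, mean₂ b θ t s 0) x y)
            (EuclideanSpace.single i 1, R b θ t s (EuclideanSpace.single i 1)) *
          gaussForm (covMatrix b θ t s)⁻¹
            (devOf (R b θ t s) (mean₁ b θ t s 0, mean₂ b θ t s 0) x y)
            (EuclideanSpace.single j 1, R b θ t s (EuclideanSpace.single j 1)) -
          gaussForm (covMatrix b θ t s)⁻¹
            (EuclideanSpace.single i 1, R b θ t s (EuclideanSpace.single i 1))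
            (EuclideanSpace.single j 1, R b θ t s (EuclideanSpace.single j 1))) +
        gaussForm (covMatrix b θ t s)⁻¹
            (devOf (R b θ t s) (mean₁ b θ t s 0, mean₂ b θ t s 0) x y)
          (b.F₁ t (θ t), b.F₂ t (θ t) + b.D₁F₂ t (θ t) (x.1 - (θ t).1) +
            R b θ t s (b.F₁ t (θ t)))) := by
  have ht : t ∈ Icc 0 T := ⟨h0, hts.le.trans hsT⟩
  have hs : s ∈ Icc 0 T := ⟨h0.trans hts.le, hsT⟩
  have hS := h.scaledBounds h0 hts hsT
  set B := gaussForm (covMatrix b θ t s)⁻¹ with hB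
  set m₁ := mean₁ b θ t s 0
  set m₂ := mean₂ b θ t s 0
  set Q := R b θ t s with hQ
  have hsymm : ∀ u v, B u v = B v u := hS.inv_symm
  set A := ((2 * Real.pi) ^ d)⁻¹ * (√(covMatrix b θ t s).det)⁻¹
  let M₁ : Vec d →L[ℝ] State d := (ContinuousLinearMap.id ℝ (Vec d)).prod Q
  let M₂ : Vec d →L[ℝ] State d := ContinuousLinearMap.inr ℝ (Vec d) (Vec d)
  have e₁ : (fun z : Vec d => density b θ t (z, x.2) s y) = fun z =>
      A * Real.exp (-(1 / 2) * B ((y.1 - m₁, y.2 - x.2 - m₂) - M₁ z)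
        ((y.1 - m₁, y.2 - x.2 - m₂) - M₁ z)) := by
    funext z
    rw [h.density_eq ht hs]
    have : devOf Q (m₁, m₂) (z, x.2) y = (y.1 - m₁, y.2 - x.2 - m₂) - M₁ z :=
      Prod.ext (by simp [devOf, M₁]; abel) (by simp [devOf, M₁]; abel)
    rw [this]
  have e₂ : (fun z : Vec d => density b θ t (x.1, z) s y) = fun z =>
      A * Real.exp (-(1 / 2) * B ((y.1 - x.1 - m₁, y.2 - Q x.1 - m₂) - M₂ z)
        ((y.1 - x.1 - m₁, y.2 - Q x.1 - m₂) - M₂ z)) := by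
    funext z
    rw [h.density_eq ht hs]
    have : devOf Q (m₁, m₂) (x.1, z) y = (y.1 - x.1 - m₁, y.2 - Q x.1 - m₂) - M₂ z :=
      Prod.ext (by simp [devOf, M₂]; abel) (by simp [devOf, M₂]; abel)
    rw [this]
  set v := devOf Q (m₁, m₂) x y with hv
  have hv₁ : ((y.1 - m₁, y.2 - x.2 - m₂) : State d) - M₁ x.1 = v :=
    Prod.ext (by simp [v, devOf, M₁]; abel) (by simp [v, devOf, M₁]; abel)
  have hv₂ : ((y.1 - x.1 - m₁, y.2 - Q x.1 - m₂) : State d) - M₂ x.2 = v :=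
    Prod.ext (by simp [v, devOf, M₂]; abel) (by simp [v, devOf, M₂]; abel)
  have hD : density b θ t x s y = A * Real.exp (-(1 / 2) * B v v) := h.density_eq ht hs x y
  have hM : ((b.F₁ t (θ t), b.F₂ t (θ t) + b.D₁F₂ t (θ t) (x.1 - (θ t).1) +
      Q (b.F₁ t (θ t))) : State d) = M₁ (b.F₁ t (θ t)) +
        M₂ (b.F₂ t (θ t) + b.D₁F₂ t (θ t) (x.1 - (θ t).1)) :=
    Prod.ext (by simp [M₁, M₂]) (by simp [M₁, M₂]; abel)
  rw [frozenOperator, e₁, e₂, (hasFDerivAt_exp_form B hsymm A _ M₁ x.1).fderiv,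
    (hasFDerivAt_exp_form B hsymm A _ M₂ x.2).fderiv, hv₁, hv₂, ← hD, hM, (B v).map_add]
  simp only [iteratedFDeriv_two_exp_form B hsymm, hv₁, ← hD]
  have hsum : ∑ i, ∑ j, entries (b.a t (θ t)) i j * (density b θ t x s y *
      (B v (M₁ (EuclideanSpace.single i 1)) * B v (M₁ (EuclideanSpace.single j 1)) -
        B (M₁ (EuclideanSpace.single i 1)) (M₁ (EuclideanSpace.single j 1)))) =
      density b θ t x s y * ∑ i, ∑ j, entries (b.a t (θ t)) i j *
      (B v (M₁ (EuclideanSpace.single i 1)) * B v (M₁ (EuclideanSpace.single j 1)) -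
        B (M₁ (EuclideanSpace.single i 1)) (M₁ (EuclideanSpace.single j 1))) := by
    simp only [Finset.mul_sum]
    exact Finset.sum_congr rfl fun i _ => Finset.sum_congr rfl fun j _ => by ring
  rw [hsum]
  have hM₁ : ∀ i : Fin d, ((EuclideanSpace.single i 1, Q (EuclideanSpace.single i 1)) : State d) =
    M₁ (EuclideanSpace.single i 1) := fun i => rfl
  simp only [hM₁, smul_apply, ContinuousLinearMap.comp_apply, smul_eq_mul]
  ring

omit h in
/-- The covariance of the noise in terms of the diffusion matrix. -/
theorem sum_entries_mul_coords (s t : ℝ) (k l : Fin d ⊕ Fin d) :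
    ∑ i, ∑ j, entries (b.a t (θ t)) i j *
      (coords (EuclideanSpace.single i (1 : ℝ), R b θ t s (EuclideanSpace.single i 1)) k *
        coords (EuclideanSpace.single j (1 : ℝ), R b θ t s (EuclideanSpace.single j 1)) l) =
      inner ℝ (noise b θ s (stdBasis d k) t) (noise b θ s (stdBasis d l) t) := by
  have key : ∀ (k : Fin d ⊕ Fin d) (i : Fin d),
      coords (EuclideanSpace.single i (1 : ℝ), R b θ t s (EuclideanSpace.single i 1)) k =
        ((stdBasis d k).1 + (R b θ t s).adjoint (stdBasis d k).2) i := by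
    intro k i
    have h1 : ∀ w : Vec d, w i = inner ℝ w (EuclideanSpace.single i (1 : ℝ)) := fun w => by
      simp [EuclideanSpace.inner_single_right]
    rw [h1, inner_add_left, ContinuousLinearMap.adjoint_inner_left]
    have h2 := coords_dotProduct (stdBasis d k)
      (EuclideanSpace.single i (1 : ℝ), R b θ t s (EuclideanSpace.single i 1))
    rw [← h2, coords_stdBasis]
    simp
  simp only [key]
  rw [inner_noise, ← dotProduct_entries_mulVec]
  simp only [dotProduct, Matrix.mulVec, Finset.mul_sum]
  exact Finset.sum_congr rfl fun i _ => Finset.sum_congr rfl fun j _ => by ring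

/-- Let P = Σ⁻¹, v the deviation, w = Pv and ∂_tΣ = -N. Jacobi's formula gives the logarithmic
derivative ½tr(PN) - ½⟨Nw, w⟩ - ⟨w, ∂_t v⟩. Since N is a transported by z ↦ (z, Rz), the
second-order part of the operator gives ½⟨Nw, w⟩ - ½tr(PN) and the first-order part ⟨w, ∂_t v⟩:
exactly the opposite. -/
theorem hasDerivWithinAt_density {U : Set ℝ} {t s : ℝ} (h0 : 0 ≤ t) (hts : t < s) (hsT : s ≤ T)
    (hU : U = Ici t ∨ (U = univ ∧ 0 < t ∧ t ≠ τ)) (x y : State d) :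
    HasDerivWithinAt (fun r => density b θ r x s y)
      (-frozenOperator b θ t (fun x' => density b θ t x' s y) x) U t := by
  have ht : t ∈ Icc 0 T := ⟨h0, hts.le.trans hsT⟩
  have hs : s ∈ Icc 0 T := ⟨h0.trans hts.le, hsT⟩
  have hS := h.scaledBounds h0 hts hsT
  let N : Matrix (Fin d ⊕ Fin d) (Fin d ⊕ Fin d) ℝ := Matrix.of fun i j =>
    inner ℝ (noise b θ s (stdBasis d i) t) (noise b θ s (stdBasis d j) t)
  have h1 := (hasDerivWithinAt_gaussian (S := fun r => covMatrix b θ r s) (S' := -N)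
    (fun i j => h.hasDerivWithinAt_covMatrix h0 hts hsT hU i j)
    (h.hasDerivWithinAt_deviation h0 hts hsT hU x y) hS.posDef).const_mul ((2 * Real.pi) ^ d)⁻¹
  have h2 : ∀ r ∈ Icc 0 T, density b θ r x s y = ((2 * Real.pi) ^ d)⁻¹ *
      ((√(covMatrix b θ r s).det)⁻¹ * Real.exp (-(1 / 2) *
        (coords (devOf (R b θ r s) (mean₁ b θ r s 0, mean₂ b θ r s 0) x y) ⬝ᵥ
          (covMatrix b θ r s)⁻¹.mulVec
            (coords (devOf (R b θ r s) (mean₁ b θ r s 0, mean₂ b θ r s 0) x y))))) := by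
    intro r hr
    rw [h.density_eq hr hs, gaussForm_apply, mul_assoc]
  refine (h1.congr_of_eventuallyEq ((eventually_mem_Icc h0 hts hsT hU).mono h2)
    (h2 t ht)).congr_deriv ?_
  rw [← mul_assoc, ← h2 t ht, h.frozenOperator_density h0 hts hsT, ← mul_neg]
  congr 1
  set P := (covMatrix b θ t s)⁻¹ with hP
  set v := devOf (R b θ t s) (mean₁ b θ t s 0, mean₂ b θ t s 0) x y
  set w := P.mulVec (coords v) with hw
  have hPw : ∀ z : State d, gaussForm P v z = w ⬝ᵥ coords z := by
    intro z
    rw [hP, hS.inv_symm, gaussForm_apply, dotProduct_comm]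
  set e : Fin d → State d := fun i =>
    (EuclideanSpace.single i (1 : ℝ), R b θ t s (EuclideanSpace.single i 1)) with he
  have hN : ∀ k l, ∑ i, ∑ j, entries (b.a t (θ t)) i j * (coords (e i) k * coords (e j) l) = N k l :=
    fun k l => sum_entries_mul_coords s t k l
  have hquad : ∀ Z : Matrix (Fin d ⊕ Fin d) (Fin d ⊕ Fin d) ℝ,
      ∑ i, ∑ j, entries (b.a t (θ t)) i j * ∑ k, ∑ l, Z k l * (coords (e i) k * coords (e j) l) =
        ∑ k, ∑ l, Z k l * N k l := by
    intro Z
    simp only [← hN, Finset.mul_sum]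
    have h3 : ∀ f : Fin d → Fin d → Fin d ⊕ Fin d → Fin d ⊕ Fin d → ℝ,
        ∑ i, ∑ j, ∑ k, ∑ l, f i j k l = ∑ k, ∑ l, ∑ i, ∑ j, f i j k l := by
      intro f
      calc ∑ i, ∑ j, ∑ k, ∑ l, f i j k l = ∑ i, ∑ k, ∑ j, ∑ l, f i j k l :=
            Finset.sum_congr rfl fun i _ => Finset.sum_comm
        _ = ∑ i, ∑ k, ∑ l, ∑ j, f i j k l := Finset.sum_congr rfl fun i _ =>
            Finset.sum_congr rfl fun k _ => Finset.sum_comm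
        _ = ∑ k, ∑ i, ∑ l, ∑ j, f i j k l := Finset.sum_comm
        _ = _ := Finset.sum_congr rfl fun k _ => Finset.sum_comm
    rw [h3]
    refine Finset.sum_congr rfl fun k _ => Finset.sum_congr rfl fun l _ =>
      Finset.sum_congr rfl fun i _ => Finset.sum_congr rfl fun j _ => by ring
  have hq₁ : ∑ i, ∑ j, entries (b.a t (θ t)) i j *
      (gaussForm P v (e i) * gaussForm P v (e j) - gaussForm P (e i) (e j)) =
      w ⬝ᵥ N.mulVec w - (P * N).trace := by
    have h4 : ∀ i j, gaussForm P v (e i) * gaussForm P v (e j) - gaussForm P (e i) (e j) =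
        ∑ k, ∑ l, (w k * w l - P k l) * (coords (e i) k * coords (e j) l) := by
      intro i j
      rw [hPw, hPw, gaussForm_apply]
      simp only [dotProduct, Matrix.mulVec]
      rw [Finset.sum_mul_sum]
      simp only [Finset.mul_sum, sub_mul, Finset.sum_sub_distrib]
      congr 1 <;> exact Finset.sum_congr rfl fun k _ => Finset.sum_congr rfl fun l _ => by ring
    simp only [h4]
    have h5 := hquad (Matrix.of fun k l => w k * w l - P k l)
    simp only [Matrix.of_apply] at h5
    rw [h5]
    have hNs : ∀ k l, N k l = N l k := fun k l => by
      simp only [N, Matrix.of_apply]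
      exact real_inner_comm _ _
    simp only [dotProduct, Matrix.mulVec, Matrix.trace, Matrix.diag, Matrix.mul_apply, sub_mul,
      Finset.sum_sub_distrib, Finset.mul_sum]
    congr 1
    · exact Finset.sum_congr rfl fun k _ => Finset.sum_congr rfl fun l _ => by ring
    · exact Finset.sum_congr rfl fun k _ => Finset.sum_congr rfl fun l _ => by rw [hNs k l]
  have hq₂ : (P * -N).trace = -(P * N).trace := by rw [Matrix.mul_neg, Matrix.trace_neg]
  have hq₃ : w ⬝ᵥ (-N).mulVec w = -(w ⬝ᵥ N.mulVec w) := by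
    rw [Matrix.neg_mulVec, dotProduct_neg]
  rw [hq₁, hPw, hq₂, hq₃]
  ring

end FrozenReg

end Kolmogorov

/-! ### Densities of Gaussian laws -/

section GaussianLaw

open scoped MatrixOrder Matrix.Norms.L2Operator

variable {ι : Type*} [Fintype ι] [DecidableEq ι]

omit [DecidableEq ι] in
-- Both measures are finite with characteristic function exp(-‖t‖²/2), the density side by the
-- Fourier transform of a Gaussian.
theorem stdGaussian_eq_withDensity : stdGaussian (EuclideanSpace ℝ ι) =
    volume.withDensity fun z => ENNReal.ofReal
      ((√(2 * Real.pi) ^ Fintype.card ι)⁻¹ * Real.exp (-(1 / 2) * ‖z‖ ^ 2)) := by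
  set k : ℝ := (√(2 * Real.pi) ^ Fintype.card ι)⁻¹ with hk
  have hk0 : 0 < k := by positivity
  have hint : Integrable fun z : EuclideanSpace ℝ ι => k * Real.exp (-(1 / 2) * ‖z‖ ^ 2) := by
    refine Integrable.const_mul ?_ k
    have h1 := (GaussianFourier.integrable_cexp_neg_mul_sq_norm_add (b := (1 / 2 : ℂ)) (by norm_num)
      0 (0 : EuclideanSpace ℝ ι)).re
    refine h1.congr (Eventually.of_forall fun z => ?_)
    have h2 : (-(1 / 2 : ℂ) * (‖z‖ : ℂ) ^ 2 + 0 * ((inner ℝ (0 : EuclideanSpace ℝ ι) z : ℝ) : ℂ)) =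
        ((-(1 / 2) * ‖z‖ ^ 2 : ℝ) : ℂ) := by push_cast; ring
    simp only [h2]
    rw [← Complex.ofReal_exp]
    exact Complex.ofReal_re _
  have hfin : IsFiniteMeasure (volume.withDensity fun z : EuclideanSpace ℝ ι => ENNReal.ofReal
      (k * Real.exp (-(1 / 2) * ‖z‖ ^ 2))) := isFiniteMeasure_withDensity_ofReal hint.2
  refine Measure.ext_of_charFun (funext fun t => ?_)
  rw [charFun_stdGaussian, charFun_apply]
  have hmeas : Measurable fun z : EuclideanSpace ℝ ι =>
      Real.toNNReal (k * Real.exp (-(1 / 2) * ‖z‖ ^ 2)) := by fun_prop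
  have h3 := integral_withDensity_eq_integral_smul (μ := volume) hmeas
    (fun x : EuclideanSpace ℝ ι => Complex.exp ((inner ℝ x t : ℝ) * Complex.I))
  have h4 : ∀ x : EuclideanSpace ℝ ι, Real.toNNReal (k * Real.exp (-(1 / 2) * ‖x‖ ^ 2)) •
      Complex.exp ((inner ℝ x t : ℝ) * Complex.I) =
      (k : ℂ) * Complex.exp (-(1 / 2 : ℂ) * (‖x‖ : ℂ) ^ 2 + Complex.I * (inner ℝ t x : ℝ)) := by
    intro x
    rw [NNReal.smul_def, Real.coe_toNNReal _ (by positivity), Complex.real_smul, Complex.exp_add,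
      real_inner_comm, mul_comm Complex.I]
    push_cast
    ring
  simp only [h4] at h3
  rw [integral_const_mul, GaussianFourier.integral_cexp_neg_mul_sq_norm_add (by norm_num)] at h3
  refine Eq.trans ?_ h3.symm
  have h5 : (Complex.I ^ 2 * (‖t‖ : ℂ) ^ 2 / (4 * (1 / 2)) : ℂ) = -(‖t‖ : ℂ) ^ 2 / 2 := by
    rw [Complex.I_sq]
    ring
  have h6 : ((Real.pi : ℂ) / (1 / 2)) ^ ((Module.finrank ℝ (EuclideanSpace ℝ ι) : ℂ) / 2) =
      ((√(2 * Real.pi) ^ Fintype.card ι : ℝ) : ℂ) := by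
    rw [finrank_euclideanSpace, show ((Real.pi : ℂ) / (1 / 2)) = ((2 * Real.pi : ℝ) : ℂ) by
      push_cast; ring, show ((Fintype.card ι : ℂ) / 2) = ((Fintype.card ι / 2 : ℝ) : ℂ) by push_cast; ring,
      ← Complex.ofReal_cpow (by positivity), Real.sqrt_eq_rpow, ← Real.rpow_natCast,
      ← Real.rpow_mul (by positivity)]
    congr 2
    ring
  rw [h5, h6, ← mul_assoc, ← Complex.ofReal_mul, hk, inv_mul_cancel₀ (by positivity)]
  simp

/-- The law is the image of the standard one under z ↦ m + √S z. This change of variables has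
Jacobian det √S = √(det S), and the form of S⁻¹ at √S z is |z|². -/
theorem multivariateGaussian_eq_withDensity {S : Matrix ι ι ℝ} (hS : S.PosDef)
    (m : EuclideanSpace ℝ ι) : multivariateGaussian m S =
    volume.withDensity fun y => ENNReal.ofReal
      ((√(2 * Real.pi) ^ Fintype.card ι)⁻¹ * (√S.det)⁻¹ *
        Real.exp (-(1 / 2) * ((y - m).ofLp ⬝ᵥ S⁻¹.mulVec (y - m).ofLp))) := by
  set M := CFC.sqrt S with hM
  have hMM : M * M = S := CFC.sqrt_mul_sqrt_self _ hS.posSemidef.nonneg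
  have hMT : M.transpose = M := by
    have := (Matrix.nonneg_iff_posSemidef.1 (CFC.sqrt_nonneg S)).isHermitian
    rwa [Matrix.IsHermitian, Matrix.conjTranspose_eq_transpose_of_trivial] at this
  have hdet : M.det = √S.det := by
    rw [hM, hS.posSemidef.det_sqrt, RCLike.sqrt_of_nonneg hS.det_pos.le]
    simp
  have hdet0 : 0 < √S.det := Real.sqrt_pos.2 hS.det_pos
  have hdetM : M.det ≠ 0 := by rw [hdet]; exact hdet0.ne'
  have hinv : S⁻¹ = M⁻¹ * M⁻¹ := by rw [← hMM, Matrix.mul_inv_rev]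
  have hquad : ∀ z : ι → ℝ, M.mulVec z ⬝ᵥ S⁻¹.mulVec (M.mulVec z) = z ⬝ᵥ z := by
    intro z
    rw [hinv, Matrix.mulVec_mulVec, mul_assoc, Matrix.nonsing_inv_mul _ (isUnit_iff_ne_zero.2 hdetM),
      mul_one, Matrix.dotProduct_mulVec, ← Matrix.mulVec_transpose, Matrix.transpose_nonsing_inv, hMT,
      Matrix.mulVec_mulVec, Matrix.nonsing_inv_mul _ (isUnit_iff_ne_zero.2 hdetM), Matrix.one_mulVec]
  set L := Matrix.toEuclideanCLM (𝕜 := ℝ) M with hL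
  set k : ℝ := (√(2 * Real.pi) ^ Fintype.card ι)⁻¹ with hk
  have hk0 : 0 < k := by positivity
  let G : EuclideanSpace ℝ ι → ℝ := fun y =>
    k * Real.exp (-(1 / 2) * ((y - m).ofLp ⬝ᵥ S⁻¹.mulVec (y - m).ofLp))
  have hG : Measurable fun y => ENNReal.ofReal (G y) := by
    refine ENNReal.measurable_ofReal.comp (Continuous.measurable ?_)
    refine continuous_const.mul (Real.continuous_exp.comp (continuous_const.mul ?_))
    have h1 : Continuous fun y : EuclideanSpace ℝ ι => (y - m).ofLp := by fun_prop
    exact h1.dotProduct (continuous_const.matrix_mulVec h1)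
  have hφ : Measurable fun z => m + L z := by fun_prop
  have hmap : (volume : Measure (EuclideanSpace ℝ ι)).map (fun z => m + L z) =
      ENNReal.ofReal (√S.det)⁻¹ • volume := by
    have h1 : (fun z => m + L z) = (fun z => m + z) ∘ (L : EuclideanSpace ℝ ι →ₗ[ℝ] _) := rfl
    have h2 : LinearMap.det (L : EuclideanSpace ℝ ι →ₗ[ℝ] EuclideanSpace ℝ ι) = √S.det := by
      rw [← hdet]
      exact LinearMap.det_toLin (PiLp.basisFun 2 ℝ ι) M
    have h3 : Measurable (L : EuclideanSpace ℝ ι →ₗ[ℝ] EuclideanSpace ℝ ι) := L.measurable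
    rw [h1, ← Measure.map_map (by fun_prop) h3,
      Measure.map_linearMap_addHaar_eq_smul_addHaar _ (by rw [h2]; exact hdet0.ne'), h2,
      Measure.map_smul, map_add_left_eq_self, abs_of_pos (inv_pos.2 hdet0)]
  have hGz : ∀ z, k * Real.exp (-(1 / 2) * ‖z‖ ^ 2) = G (m + L z) := by
    intro z
    simp only [G, add_sub_cancel_left, hL, Matrix.ofLp_toEuclideanCLM, hquad]
    rw [EuclideanSpace.real_norm_sq_eq]
    simp [dotProduct, sq]
  ext B hB
  rw [multivariateGaussian, Measure.map_apply hφ hB, stdGaussian_eq_withDensity,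
    withDensity_apply _ (hφ hB), withDensity_apply _ hB]
  simp only [← hk, hGz]
  rw [← setLIntegral_map hB hG hφ, hmap, Measure.restrict_smul, lintegral_smul_measure, smul_eq_mul,
    ← lintegral_const_mul _ hG]
  refine lintegral_congr fun y => ?_
  rw [← ENNReal.ofReal_mul (by positivity)]
  congr 1
  simp only [G]
  ring

end GaussianLaw

section StateLaw

variable {d : ℕ}

/-- The points of `ℝ^d × ℝ^d` with given coordinates. -/
def ofCoords (d : ℕ) (z : EuclideanSpace ℝ (Fin d ⊕ Fin d)) : State d := (coordsEquiv d).symm z.ofLp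

@[simp] theorem coords_ofCoords (z : EuclideanSpace ℝ (Fin d ⊕ Fin d)) :
    coords (ofCoords d z) = z.ofLp := coords_coordsEquiv_symm _

theorem ofCoords_toLp_coords (z : State d) : ofCoords d (WithLp.toLp 2 (coords z)) = z :=
  (coordsEquiv d).symm_apply_apply z

theorem ofCoords_add (z w : EuclideanSpace ℝ (Fin d ⊕ Fin d)) :
    ofCoords d (z + w) = ofCoords d z + ofCoords d w :=
  map_add (coordsEquiv d).symm _ _

theorem measurePreserving_ofCoords : MeasurePreserving (ofCoords d) volume volume := by
  have h1 := (volume_measurePreserving_sumPiEquivProdPi (fun _ : Fin d ⊕ Fin d => ℝ)).comp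
    (EuclideanSpace.volume_preserving_symm_measurableEquiv_toLp (Fin d ⊕ Fin d))
  exact (((EuclideanSpace.volume_preserving_symm_measurableEquiv_toLp (Fin d)).symm).prod
    ((EuclideanSpace.volume_preserving_symm_measurableEquiv_toLp (Fin d)).symm)).comp h1

theorem continuous_ofCoords : Continuous (ofCoords d) := by
  unfold ofCoords
  exact (LinearMap.continuous_of_finiteDimensional ((coordsEquiv d).symm.toLinearMap)).comp
    (PiLp.continuous_ofLp 2 _)

theorem map_ofCoords_withDensity {f : State d → ℝ≥0∞} (hf : Measurable f) :
    (volume.withDensity fun z => f (ofCoords d z)).map (ofCoords d) = volume.withDensity f := by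
  ext B hB
  have hm := measurePreserving_ofCoords (d := d)
  rw [Measure.map_apply hm.measurable hB, withDensity_apply _ (hm.measurable hB),
    withDensity_apply _ hB, ← setLIntegral_map hB hf hm.measurable, hm.map_eq]

variable {b : Coefficients d} {θ : ℝ → State d} {T τ Λ C c₀ : ℝ}

theorem ofLp_sub_toLp_coords (z : EuclideanSpace ℝ (Fin d ⊕ Fin d)) (m : State d) :
    (z - WithLp.toLp 2 (coords m)).ofLp =
      coords ((ofCoords d z).1 - m.1, (ofCoords d z).2 - m.2) := by
  have h1 : coords (ofCoords d z - m) = coords (ofCoords d z) - coords m := coords_sub _ _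
  rw [coords_ofCoords] at h1
  exact h1.symm

theorem FrozenReg.density_ofCoords (b : Coefficients d) (θ : ℝ → State d) (t s : ℝ) (x : State d)
    (z : EuclideanSpace ℝ (Fin d ⊕ Fin d)) :
    density b θ t x s (ofCoords d z) = (√(2 * Real.pi) ^ Fintype.card (Fin d ⊕ Fin d))⁻¹ *
      (√(covMatrix b θ t s).det)⁻¹ * Real.exp (-(1 / 2) *
        ((z - WithLp.toLp 2 (coords (mean₁ b θ t s x, mean₂ b θ t s x))).ofLp ⬝ᵥ
          (covMatrix b θ t s)⁻¹.mulVec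
            (z - WithLp.toLp 2 (coords (mean₁ b θ t s x, mean₂ b θ t s x))).ofLp)) := by
  have h2 : √(2 * Real.pi) ^ Fintype.card (Fin d ⊕ Fin d) = (2 * Real.pi) ^ d := by
    rw [Fintype.card_sum, Fintype.card_fin, ← two_mul, pow_mul, Real.sq_sqrt (by positivity)]
  rw [density, deviation, h2, ofLp_sub_toLp_coords]

theorem FrozenReg.continuous_density (h : FrozenReg b θ T τ Λ C c₀) {t s : ℝ} (ht : t ∈ Icc 0 T)
    (hs : s ∈ Icc 0 T) (x : State d) : Continuous fun y => density b θ t x s y := by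
  have h1 := (h.contDiff_density ht hs).continuous
  exact Continuous.comp (g := fun z : State d × State d => density b θ t z.1 s z.2)
    (f := fun y => (x, y)) h1 (by fun_prop)

/-- The Gaussian law of the solution of the frozen system. -/
theorem FrozenReg.withDensity_density (h : FrozenReg b θ T τ Λ C c₀) {t s : ℝ} (h0 : 0 ≤ t)
    (hts : t < s) (hsT : s ≤ T) (x : State d) :
    volume.withDensity (fun y => ENNReal.ofReal (density b θ t x s y)) =
      (multivariateGaussian (WithLp.toLp 2 (coords (mean₁ b θ t s x, mean₂ b θ t s x)))
        (covMatrix b θ t s)).map (ofCoords d) := by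
  have hc := h.continuous_density (t := t) (s := s) ⟨h0, hts.le.trans hsT⟩ ⟨h0.trans hts.le, hsT⟩ x
  rw [multivariateGaussian_eq_withDensity (h.scaledBounds h0 hts hsT).posDef,
    ← map_ofCoords_withDensity (f := fun y => ENNReal.ofReal (density b θ t x s y))
      (ENNReal.measurable_ofReal.comp hc.measurable)]
  simp only [FrozenReg.density_ofCoords]

end StateLaw

/-! ### The fundamental solution -/

section Fundamental

open scoped MatrixOrder

variable {d : ℕ} {b : Coefficients d} {θ : ℝ → State d} {T τ Λ C c₀ : ℝ}

/-- The parameters of a Gaussian density: normalization, inverse covariance, `R`, and shift. -/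
abbrev GaussParam (d : ℕ) := ℝ × (Fin d ⊕ Fin d → Fin d ⊕ Fin d → ℝ) × Mat d × State d

/-- A Gaussian density as a function of its parameters and of the starting point. -/
def paramDensity (y : State d) (z : GaussParam d × State d) : ℝ :=
  z.1.1 * Real.exp (-(1 / 2) * ∑ i, ∑ j, z.1.2.1 i j *
    (coordL d i (devOf z.1.2.2.1 z.1.2.2.2 z.2 y) * coordL d j (devOf z.1.2.2.1 z.1.2.2.2 z.2 y)))

theorem contDiff_paramDensity (y : State d) : ContDiff ℝ (⊤ : ℕ∞) (paramDensity y) := by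
  have h1 : ContDiff ℝ (⊤ : ℕ∞) fun z : GaussParam d × State d =>
      devOf z.1.2.2.1 z.1.2.2.2 z.2 y := by
    unfold devOf
    fun_prop
  have h2 : ∀ i, ContDiff ℝ (⊤ : ℕ∞) fun z : GaussParam d × State d =>
      coordL d i (devOf z.1.2.2.1 z.1.2.2.2 z.2 y) := fun i => (coordL d i).contDiff.comp h1
  unfold paramDensity
  refine ContDiff.mul (by fun_prop) (Real.contDiff_exp.comp (contDiff_const.mul ?_))
  refine ContDiff.sum fun i _ => ContDiff.sum fun j _ => ContDiff.mul ?_ ((h2 i).mul (h2 j))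
  have h3 : ContDiff ℝ (⊤ : ℕ∞) fun z : GaussParam d × State d => z.1.2.1 := by fun_prop
  exact contDiff_pi.1 (contDiff_pi.1 h3 i) j

namespace FrozenReg

variable (h : FrozenReg b θ T τ Λ C c₀)
include h

theorem density_eq_paramDensity {t s : ℝ} (ht : t ∈ Icc 0 T) (hs : s ∈ Icc 0 T) (x y : State d) :
    density b θ t x s y = paramDensity y
      ((((2 * Real.pi) ^ d)⁻¹ * (√(covMatrix b θ t s).det)⁻¹, fun i j => (covMatrix b θ t s)⁻¹ i j,
        R b θ t s, (mean₁ b θ t s 0, mean₂ b θ t s 0)), x) := by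
  rw [h.density_eq ht hs, paramDensity, gaussForm_apply]
  refine congrArg (HMul.hMul (((2 * Real.pi) ^ d)⁻¹ * (√(covMatrix b θ t s).det)⁻¹))
    (congrArg Real.exp (congrArg (HMul.hMul (-(1 / 2) : ℝ)) ?_))
  simp only [dotProduct, Matrix.mulVec, Finset.mul_sum, coordL_apply]
  exact Finset.sum_congr rfl fun i _ => Finset.sum_congr rfl fun j _ => by ring

theorem continuousOn_covMatrix {s : ℝ} (hs : s ∈ Icc 0 T) (i j : Fin d ⊕ Fin d) :
    ContinuousOn (fun t => covMatrix b θ t s i j) (Icc 0 T) := by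
  have h1 : PW T τ fun r => inner ℝ (noise b θ s (stdBasis d i) r) (noise b θ s (stdBasis d j) r) :=
    ((h.pw_noise hs _).prodMk (h.pw_noise hs _)).comp
      (φ := fun z : Vec d × Vec d => inner ℝ z.1 z.2) (by fun_prop)
  exact (h1.continuousOn_integral_left s hs).congr fun t ht => h.covMatrix_apply ht hs i j

theorem continuousOn_mean₁ {s : ℝ} (hs : s ∈ Icc 0 T) :
    ContinuousOn (fun t => mean₁ b θ t s 0) (Icc 0 T) :=
  continuousOn_const.add (h.pw_F₁.continuousOn_integral_left s hs)

theorem continuousOn_mean₂ {s : ℝ} (hs : s ∈ Icc 0 T) :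
    ContinuousOn (fun t => mean₂ b θ t s 0) (Icc 0 T) := by
  have h0T : (0 : ℝ) ∈ Icc 0 T := ⟨le_rfl, h.T_pos.le⟩
  exact ((h.pw_mean₂_zero.continuousOn_integral_left s hs).sub
    ((h.continuousOn_R hs).clm_apply (h.pw_F₁.continuousOn_integral_right 0 h0T))).congr
      fun t ht => h.mean₂_zero_eq ht hs

/-- The density is a fixed smooth function of x and of finitely many parameters. These are built
from integrals, hence continuous in t across the jump at τ, and Σ is invertible for t < s. Space
derivatives are partial derivatives of the fixed function. -/
theorem continuousOn_iteratedFDeriv_density {s : ℝ} (hs : s ∈ Ioc 0 T) (y : State d) (k : ℕ) :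
    ContinuousOn (fun z : ℝ × State d => iteratedFDeriv ℝ k (fun x => density b θ z.1 x s y) z.2)
      (Ico 0 s ×ˢ univ) := by
  have hs' : s ∈ Icc 0 T := ⟨hs.1.le, hs.2⟩
  have hsub : Ico 0 s ⊆ Icc 0 T := fun t ht => ⟨ht.1, ht.2.le.trans hs.2⟩
  let p : ℝ → GaussParam d := fun t =>
    (((2 * Real.pi) ^ d)⁻¹ * (√(covMatrix b θ t s).det)⁻¹, fun i j => (covMatrix b θ t s)⁻¹ i j,
        R b θ t s, (mean₁ b θ t s 0, mean₂ b θ t s 0))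
  have hpos : ∀ t ∈ Ico 0 s, 0 < (covMatrix b θ t s).det := fun t ht =>
    (h.scaledBounds ht.1 ht.2 hs.2).posDef.det_pos
  have hS : ContinuousOn (fun t => covMatrix b θ t s) (Ico 0 s) :=
    continuousOn_pi.2 fun i => continuousOn_pi.2 fun j => (h.continuousOn_covMatrix hs' i j).mono hsub
  have hdet : ContinuousOn (fun t => (covMatrix b θ t s).det) (Ico 0 s) :=
    (continuous_id.matrix_det).comp_continuousOn hS
  have hinv : ContinuousOn (fun t => (covMatrix b θ t s)⁻¹) (Ico 0 s) := by
    simp only [Matrix.inv_def, Ring.inverse_eq_inv']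
    exact (hdet.inv₀ fun t ht => (hpos t ht).ne').smul
      ((continuous_id.matrix_adjugate).comp_continuousOn hS)
  have hp : ContinuousOn p (Ico 0 s) := by
    refine ContinuousOn.prodMk ?_ (ContinuousOn.prodMk ?_ (ContinuousOn.prodMk ?_
      (ContinuousOn.prodMk ?_ ?_)))
    · exact continuousOn_const.mul (hdet.sqrt.inv₀ fun t ht => (Real.sqrt_pos.2 (hpos t ht)).ne')
    · exact continuousOn_pi.2 fun i => continuousOn_pi.2 fun j =>
        continuousOn_pi.1 (continuousOn_pi.1 hinv i) j
    · exact (h.continuousOn_R hs').mono hsub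
    · exact (h.continuousOn_mean₁ hs').mono hsub
    · exact (h.continuousOn_mean₂ hs').mono hsub
  have h1 : ∀ t ∈ Ico 0 s, ∀ x, iteratedFDeriv ℝ k (fun x => density b θ t x s y) x =
      partialDeriv (paramDensity y) (ContinuousLinearMap.inr ℝ (GaussParam d) (State d)) k (p t, x) := by
    intro t ht x
    have h2 : (fun x => density b θ t x s y) = fun x =>
        paramDensity y ((p t, 0) + ContinuousLinearMap.inr ℝ (GaussParam d) (State d) x) := by
      funext x
      rw [h.density_eq_paramDensity (hsub ht) hs']
      simp [p]
    rw [h2, iteratedFDeriv_comp_affine (contDiff_paramDensity y), partialDeriv]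
    simp
  refine ContinuousOn.congr (f := fun z : ℝ × State d => partialDeriv (paramDensity y)
    (ContinuousLinearMap.inr ℝ (GaussParam d) (State d)) k (p z.1, z.2)) ?_
    fun z hz => h1 z.1 hz.1 z.2
  refine (contDiff_partialDeriv (contDiff_paramDensity y) _ k).continuous.comp_continuousOn ?_
  exact (hp.comp continuousOn_fst fun z hz => hz.1).prodMk continuousOn_snd

omit h in
theorem density_nonneg (t s : ℝ) (x y : State d) : 0 ≤ density b θ t x s y := by
  unfold density
  positivity

theorem lintegral_density {t s : ℝ} (h0 : 0 ≤ t) (hts : t < s) (hsT : s ≤ T) (x : State d) :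
    ∫⁻ y, ENNReal.ofReal (density b θ t x s y) = 1 := by
  have h1 := congrArg (fun ν => ν univ) (h.withDensity_density h0 hts hsT x)
  simp only [withDensity_apply _ MeasurableSet.univ, Measure.restrict_univ] at h1
  rw [h1, Measure.map_apply continuous_ofCoords.measurable MeasurableSet.univ, preimage_univ,
    measure_univ]

theorem integrable_density {t s : ℝ} (h0 : 0 ≤ t) (hts : t < s) (hsT : s ≤ T) (x : State d) :
    Integrable fun y => density b θ t x s y := by
  have hc := h.continuous_density (t := t) (s := s) ⟨h0, hts.le.trans hsT⟩ ⟨h0.trans hts.le, hsT⟩ x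
  refine ⟨hc.aestronglyMeasurable, ?_⟩
  rw [hasFiniteIntegral_iff_ofReal (Eventually.of_forall fun y => FrozenReg.density_nonneg t s x y),
    h.lintegral_density h0 hts hsT]
  exact ENNReal.one_lt_top

/-- Integration against the frozen density. -/
theorem integral_density_mul {t s : ℝ} (h0 : 0 ≤ t) (hts : t < s) (hsT : s ≤ T) (x : State d)
    (f : State d →ᵇ ℝ) :
    ∫ y, density b θ t x s y * f y = ∫ z, f ((mean₁ b θ t s x, mean₂ b θ t s x) +
      ofCoords d (Matrix.toEuclideanCLM (𝕜 := ℝ) (CFC.sqrt (covMatrix b θ t s)) z))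
        ∂(stdGaussian (EuclideanSpace ℝ (Fin d ⊕ Fin d))) := by
  have hc := h.continuous_density (t := t) (s := s) ⟨h0, hts.le.trans hsT⟩ ⟨h0.trans hts.le, hsT⟩ x
  have h1 := integral_withDensity_eq_integral_smul (μ := volume)
    (f := fun y => Real.toNNReal (density b θ t x s y)) hc.measurable.real_toNNReal (fun y => f y)
  have h2 : ∀ y, Real.toNNReal (density b θ t x s y) • f y = density b θ t x s y * f y := fun y => by
    rw [NNReal.smul_def, Real.coe_toNNReal _ (FrozenReg.density_nonneg t s x y), smul_eq_mul]
  simp only [h2] at h1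
  rw [← h1]
  have h3 := h.withDensity_density h0 hts hsT x
  have h4 : (volume.withDensity fun y => ((Real.toNNReal (density b θ t x s y) : ℝ≥0) : ℝ≥0∞)) =
      (multivariateGaussian (WithLp.toLp 2 (coords (mean₁ b θ t s x, mean₂ b θ t s x)))
        (covMatrix b θ t s)).map (ofCoords d) := h3
  rw [h4, integral_map continuous_ofCoords.aemeasurable f.continuous.aestronglyMeasurable,
    multivariateGaussian, integral_map (f := fun z => f (ofCoords d z)) (by fun_prop)
      (f.continuous.comp continuous_ofCoords).aestronglyMeasurable]
  refine integral_congr_ae (Eventually.of_forall fun z => ?_)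
  simp only [ofCoords_add, ofCoords_toLp_coords]

theorem tendsto_mean {s : ℝ} (hs : s ∈ Ioc 0 T) (x₀ : State d) :
    Tendsto (fun z : ℝ × State d => ((mean₁ b θ z.1 s z.2, mean₂ b θ z.1 s z.2) : State d))
      (𝓝[<] s ×ˢ 𝓝 x₀) (𝓝 x₀) := by
  have hs' : s ∈ Icc 0 T := ⟨hs.1.le, hs.2⟩
  have hle : 𝓝[<] s ≤ 𝓝[Icc 0 T] s := by
    rw [← nhdsWithin_Ioo_eq_nhdsLT hs.1]
    exact nhdsWithin_mono _ fun t ht => ⟨ht.1.le, ht.2.le.trans hs.2⟩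
  have hm₁ := (h.continuousOn_mean₁ hs' s hs').tendsto.mono_left hle
  have hm₂ := (h.continuousOn_mean₂ hs' s hs').tendsto.mono_left hle
  have hR := (h.continuousOn_R hs' s hs').tendsto.mono_left hle
  have hfst : Tendsto (fun z : ℝ × State d => z.1) (𝓝[<] s ×ˢ 𝓝 x₀) (𝓝[<] s) := tendsto_fst
  have hsnd : Tendsto (fun z : ℝ × State d => z.2) (𝓝[<] s ×ˢ 𝓝 x₀) (𝓝 x₀) := tendsto_snd
  have hx₁ : Tendsto (fun z : ℝ × State d => z.2.1) (𝓝[<] s ×ˢ 𝓝 x₀) (𝓝 x₀.1) :=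
    (continuous_fst.tendsto x₀).comp hsnd
  have hx₂ := (continuous_snd.tendsto x₀).comp hsnd
  have h1 : mean₁ b θ s s 0 = 0 := by simp [mean₁]
  have h2 : mean₂ b θ s s 0 = 0 := by simp [mean₂]
  have h3 : R b θ s s = 0 := by simp [R]
  rw [h1] at hm₁
  rw [h2] at hm₂
  rw [h3] at hR
  have hR' : Tendsto (fun z : ℝ × State d => R b θ z.1 s) (𝓝[<] s ×ˢ 𝓝 x₀) (𝓝 0) := hR.comp hfst
  have hRx : Tendsto (fun z : ℝ × State d => R b θ z.1 s z.2.1) (𝓝[<] s ×ˢ 𝓝 x₀) (𝓝 0) := by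
    have := ((isBoundedBilinearMap_apply (𝕜 := ℝ) (E := Vec d) (F := Vec d)).continuous.tendsto
      (0, x₀.1)).comp (hR'.prodMk_nhds hx₁)
    rw [zero_apply] at this
    exact this
  have hlim := (hx₁.add (hm₁.comp hfst)).prodMk_nhds
    ((hx₂.add hRx).add (hm₂.comp hfst))
  simp only [add_zero] at hlim
  refine (hlim : Tendsto _ _ (𝓝 x₀)).congr' ?_
  have hev : ∀ᶠ z in 𝓝[<] s ×ˢ 𝓝 x₀, z.1 ∈ Icc 0 T := by
    refine hfst.eventually ?_
    rw [← nhdsWithin_Ioo_eq_nhdsLT hs.1]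
    filter_upwards [self_mem_nhdsWithin] with t ht using ⟨ht.1.le, ht.2.le.trans hs.2⟩
  filter_upwards [hev] with z hz
  rw [FrozenReg.mean₁_eq z.1 s z.2, h.mean₂_eq hz hs']
  rfl

/-- |√Σ z|² = ⟨Σz, z⟩, so only the entries of Σ have to tend to 0 and continuity of the matrix
square root is not needed. -/
theorem tendsto_sqrt_covMatrix {s : ℝ} (hs : s ∈ Ioc 0 T) (z : EuclideanSpace ℝ (Fin d ⊕ Fin d)) :
    Tendsto (fun t => Matrix.toEuclideanCLM (𝕜 := ℝ) (CFC.sqrt (covMatrix b θ t s)) z)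
      (𝓝[<] s) (𝓝 0) := by
  have hs' : s ∈ Icc 0 T := ⟨hs.1.le, hs.2⟩
  rw [← nhdsWithin_Ioo_eq_nhdsLT hs.1]
  have hsub : Ioo 0 s ⊆ Icc 0 T := fun t ht => ⟨ht.1.le, ht.2.le.trans hs.2⟩
  have h1 : Tendsto (fun t => ∑ i, ∑ j, z i * (covMatrix b θ t s i j * z j)) (𝓝[Ioo 0 s] s)
      (𝓝 (∑ i, ∑ j, z i * (covMatrix b θ s s i j * z j))) :=
    tendsto_finsetSum _ fun i _ => tendsto_finsetSum _ fun j _ => (((h.continuousOn_covMatrix hs' i j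
      s hs').tendsto.mono_left (nhdsWithin_mono _ hsub)).mul_const _).const_mul _
  have h2 : ∀ i j, covMatrix b θ s s i j = 0 := fun i j => by
    rw [h.covMatrix_apply hs' hs', intervalIntegral.integral_same]
  simp only [h2, zero_mul, mul_zero, Finset.sum_const_zero] at h1
  rw [tendsto_zero_iff_norm_tendsto_zero]
  have h3 := h1.sqrt
  rw [Real.sqrt_zero] at h3
  refine h3.congr' ?_
  filter_upwards [self_mem_nhdsWithin] with t ht
  have hS := (h.scaledBounds ht.1.le ht.2 hs.2).posDef
  set M := CFC.sqrt (covMatrix b θ t s) with hM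
  have hMM : M * M = covMatrix b θ t s := CFC.sqrt_mul_sqrt_self _ hS.posSemidef.nonneg
  have hMT : M.transpose = M := by
    have := (Matrix.nonneg_iff_posSemidef.1 (CFC.sqrt_nonneg (covMatrix b θ t s))).isHermitian
    rwa [Matrix.IsHermitian, Matrix.conjTranspose_eq_transpose_of_trivial] at this
  rw [← Real.sqrt_sq (norm_nonneg (Matrix.toEuclideanCLM (𝕜 := ℝ) M z))]
  congr 1
  rw [EuclideanSpace.real_norm_sq_eq, Matrix.ofLp_toEuclideanCLM]
  have h4 : ∑ i, M.mulVec z.ofLp i ^ 2 = M.mulVec z.ofLp ⬝ᵥ M.mulVec z.ofLp := by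
    simp [dotProduct, sq]
  have h5 : ∑ i, ∑ j, z i * (covMatrix b θ t s i j * z j) =
      z.ofLp ⬝ᵥ (covMatrix b θ t s).mulVec z.ofLp := by
    simp only [dotProduct, Matrix.mulVec, Finset.mul_sum]
  rw [h4, h5, ← hMM, ← Matrix.mulVec_mulVec, Matrix.dotProduct_mulVec, ← Matrix.mulVec_transpose, hMT]

/-- After the change of variables the law is a fixed standard Gaussian and only the point m + √Σ w
moves, towards x₀; the integrand is bounded by ‖f‖, so dominated convergence applies. -/
theorem tendsto_integral_density {s : ℝ} (hs : s ∈ Ioc 0 T) (f : State d →ᵇ ℝ) (x₀ : State d) :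
    Tendsto (fun z : ℝ × State d => ∫ y, density b θ z.1 z.2 s y * f y) (𝓝[<] s ×ˢ 𝓝 x₀)
      (𝓝 (f x₀)) := by
  have h1 : Tendsto (fun z : ℝ × State d => ∫ w, f ((mean₁ b θ z.1 s z.2, mean₂ b θ z.1 s z.2) +
      ofCoords d (Matrix.toEuclideanCLM (𝕜 := ℝ) (CFC.sqrt (covMatrix b θ z.1 s)) w))
        ∂(stdGaussian (EuclideanSpace ℝ (Fin d ⊕ Fin d)))) (𝓝[<] s ×ˢ 𝓝 x₀)
      (𝓝 (∫ _, f x₀ ∂(stdGaussian (EuclideanSpace ℝ (Fin d ⊕ Fin d))))) := by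
    refine tendsto_integral_filter_of_dominated_convergence (fun _ => ‖f‖)
      (Eventually.of_forall fun z => ?_) (Eventually.of_forall fun z => Eventually.of_forall fun w =>
        f.norm_coe_le_norm _) (integrable_const _) (Eventually.of_forall fun w => ?_)
    · refine (f.continuous.comp (continuous_const.add (continuous_ofCoords.comp ?_))).aestronglyMeasurable
      exact ContinuousLinearMap.continuous _
    · refine (f.continuous.tendsto x₀).comp ?_
      have h2 := (h.tendsto_mean hs x₀).add ((continuous_ofCoords.tendsto 0).comp
        ((h.tendsto_sqrt_covMatrix hs w).comp (tendsto_fst (f := 𝓝[<] s) (g := 𝓝 x₀))))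
      have h3 : ofCoords d 0 = 0 := map_zero (coordsEquiv d).symm
      rw [h3, add_zero] at h2
      exact h2
  rw [integral_const, probReal_univ, one_smul] at h1
  refine h1.congr' ?_
  have hev : ∀ᶠ z in 𝓝[<] s ×ˢ 𝓝 x₀, z.1 ∈ Ioo 0 s := by
    refine (tendsto_fst (f := 𝓝[<] s) (g := 𝓝 x₀)).eventually ?_
    rw [← nhdsWithin_Ioo_eq_nhdsLT hs.1]
    exact self_mem_nhdsWithin
  filter_upwards [hev] with z hz
  exact (h.integral_density_mul hz.1.le hz.2 hs.2 z.2 f).symm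

theorem isFundamentalSolution : IsFundamentalSolution T τ (frozenOperator b θ) (density b θ) where
  smooth s hs y t ht := by
    have h1 := h.contDiff_density (t := t) (s := s) ⟨ht.1, ht.2.le.trans hs.2⟩ ⟨hs.1.le, hs.2⟩
    exact ContDiff.comp (g := fun z : State d × State d => density b θ t z.1 s z.2)
      (f := fun x => (x, y)) h1 (by fun_prop)
  continuous s hs y k _ := h.continuousOn_iteratedFDeriv_density hs y k
  pde_right s hs y t ht x := h.hasDerivWithinAt_density ht.1 ht.2 hs.2 (Or.inl rfl) x y
  pde s hs y t ht htτ x := by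
    rw [← hasDerivWithinAt_univ]
    exact h.hasDerivWithinAt_density ht.1.le ht.2 hs.2 (Or.inr ⟨rfl, ht.1, htτ⟩) x y
  integrable s hs t ht x := h.integrable_density ht.1 ht.2 hs.2 x
  terminal s hs f x₀ := h.tendsto_integral_density hs f x₀

end FrozenReg

end Fundamental

/-! ### The Wiener isometry -/

/-- Square integrable functions of time with values in `ℝ^d`. -/
abbrev L2 (d : ℕ) := Lp (Vec d) 2 (volume.restrict (Ioi (0 : ℝ)))

/-- The function `r ↦ 1_{(0, u]}(r) e_i`. -/
def stepL2 (d : ℕ) (p : Fin d × ℝ≥0) : L2 d :=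
  indicatorConstLp 2 (measurableSet_Ioc (a := (0 : ℝ)) (b := p.2))
    (ne_of_lt ((Measure.restrict_apply_le _ _).trans_lt measure_Ioc_lt_top))
    (EuclideanSpace.single p.1 1)

/-- This is the covariance of the coordinates of `W` indexed by p and q, which is what makes the
Wiener map isometric. -/
theorem inner_stepL2 {d : ℕ} (p q : Fin d × ℝ≥0) :
    inner ℝ (stepL2 d p) (stepL2 d q) = if p.1 = q.1 then ((min p.2 q.2 : ℝ≥0) : ℝ) else 0 := by
  have hfin : ∀ u : ℝ, (volume.restrict (Ioi (0 : ℝ))) (Ioc 0 u) ≠ ⊤ := fun u =>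
    ne_of_lt ((Measure.restrict_apply_le _ _).trans_lt measure_Ioc_lt_top)
  rw [stepL2, stepL2, L2.inner_indicatorConstLp_indicatorConstLp _ _ (hfin _) (hfin _)]
  have h : (volume.restrict (Ioi (0 : ℝ))).real (Ioc 0 (p.2 : ℝ) ∩ Ioc 0 (q.2 : ℝ))
      = ((min p.2 q.2 : ℝ≥0) : ℝ) := by
    rw [Ioc_inter_Ioc, max_self, measureReal_restrict_apply measurableSet_Ioc,
      inter_eq_left.2 fun r hr => hr.1, Real.volume_real_Ioc_of_le (by positivity)]
    simp
  rw [h]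
  by_cases hpq : p.1 = q.1
  · simp [hpq]
  · simp [hpq, EuclideanSpace.inner_single_left]

theorem ae_eq_zero_of_setIntegral_Ioc {E : Type*} [NormedAddCommGroup E] [NormedSpace ℝ E]
    [CompleteSpace E] {f : ℝ → E} (hf : MemLp f 2 (volume.restrict (Ioi (0 : ℝ))))
    (h : ∀ u : ℝ, 0 ≤ u → ∫ r in Ioc 0 u, f r ∂(volume.restrict (Ioi (0 : ℝ))) = 0) :
    f =ᵐ[volume.restrict (Ioi (0 : ℝ))] 0 := by
  have hg : MemLp ((Ioi (0 : ℝ)).indicator f) 2 volume :=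
    (memLp_indicator_iff_restrict measurableSet_Ioi).2 hf
  have hloc : LocallyIntegrable ((Ioi (0 : ℝ)).indicator f) volume :=
    hg.locallyIntegrable (by norm_num)
  have hzero : (fun x => ∫ r in (0 : ℝ)..x, (Ioi (0 : ℝ)).indicator f r) = fun _ => 0 := by
    funext x
    rcases le_total 0 x with hx | hx
    · rw [intervalIntegral.integral_of_le hx, ← h x hx, Measure.restrict_restrict measurableSet_Ioc,
        inter_eq_left.2 fun r hr => hr.1]
      exact setIntegral_congr_fun measurableSet_Ioc fun r hr => indicator_of_mem (by exact hr.1) _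
    · rw [intervalIntegral.integral_of_ge hx, setIntegral_congr_fun (g := fun _ => 0)
        measurableSet_Ioc fun r hr => indicator_of_notMem (by simpa using hr.2) _]
      simp
  rw [EventuallyEq, ae_restrict_iff' measurableSet_Ioi]
  filter_upwards [LocallyIntegrable.ae_hasDerivAt_integral hloc] with x hx hx0
  have h1 := hx 0
  rw [hzero] at h1
  have h2 := (hasDerivAt_const x (0 : E)).unique h1
  rw [indicator_of_mem hx0] at h2
  simp [← h2]

/-- A function orthogonal to all of these has, coordinate by coordinate, zero integral over every
(0, u], so it vanishes almost everywhere by Lebesgue differentiation. -/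
theorem denseRange_stepL2 (d : ℕ) : DenseRange (Finsupp.linearCombination ℝ (stepL2 d)) := by
  suffices h : (LinearMap.range (Finsupp.linearCombination ℝ (stepL2 d))).topologicalClosure = ⊤ by
    exact Submodule.dense_iff_topologicalClosure_eq_top.2 h
  rw [Submodule.topologicalClosure_eq_top_iff, Submodule.eq_bot_iff]
  intro h hh
  rw [Submodule.mem_orthogonal] at hh
  have key : ⇑h =ᵐ[volume.restrict (Ioi (0 : ℝ))] 0 := by
    refine ae_eq_zero_of_setIntegral_Ioc (Lp.memLp h) fun u hu => ?_
    refine ext_inner_left ℝ fun c => ?_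
    have hb := (EuclideanSpace.basisFun (Fin d) ℝ).sum_repr c
    rw [inner_zero_right, ← hb, sum_inner]
    refine Finset.sum_eq_zero fun i _ => ?_
    have h1 := hh (stepL2 d (i, ⟨u, hu⟩)) ⟨Finsupp.single (i, ⟨u, hu⟩) 1, by simp⟩
    rw [stepL2, L2.inner_indicatorConstLp_eq_inner_setIntegral] at h1
    rw [real_inner_smul_left]
    simp only [EuclideanSpace.basisFun_apply]
    exact mul_eq_zero_of_right _ h1
  exact (Lp.eq_zero_iff_ae_eq_zero).2 key

/-- Equality of Gram matrices gives equality of norms of linear combinations. -/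
theorem norm_linearCombination_eq {ι E F : Type*} [NormedAddCommGroup E] [InnerProductSpace ℝ E]
    [NormedAddCommGroup F] [InnerProductSpace ℝ F] {e : ι → E} {f : ι → F}
    (h : ∀ i j, inner ℝ (f i) (f j) = inner ℝ (e i) (e j)) (c : ι →₀ ℝ) :
    ‖Finsupp.linearCombination ℝ f c‖ = ‖Finsupp.linearCombination ℝ e c‖ := by
  rw [← sq_eq_sq₀ (norm_nonneg _) (norm_nonneg _), ← real_inner_self_eq_norm_sq,
    ← real_inner_self_eq_norm_sq, Finsupp.linearCombination_apply, Finsupp.linearCombination_apply]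
  simp only [Finsupp.inner_sum, Finsupp.sum_inner, real_inner_smul_left, real_inner_smul_right, h]

variable {d : ℕ} {Ω : Type*} {mΩ : MeasurableSpace Ω} {P : Measure Ω} {W : ℝ≥0 → Ω → Vec d}

/-- `J` is the Wiener integral `h ↦ ∫₀^∞ ⟪h, dW⟫` of deterministic functions. -/
structure IsWienerMap (P : Measure Ω) (W : ℝ≥0 → Ω → Vec d) (J : L2 d →ₗᵢ[ℝ] Lp ℝ 2 P) :
    Prop where
  apply_step : ∀ p : Fin d × ℝ≥0, J (stepL2 d p) =ᵐ[P] fun ω => W p.2 ω p.1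
  law : ∀ h, P.map (J h) = gaussianReal 0 (‖h‖₊ ^ 2)

/-- Independence of the coordinates upgrades Gaussianity of each, on the finite set `K` of times
involved, to joint Gaussianity; the values in `I` are a linear image. -/
theorem IsBrownian.isGaussianProcess_coord [IsProbabilityMeasure P] (hW : IsBrownian W P) :
    IsGaussianProcess (fun (p : Fin d × ℝ≥0) ω => W p.2 ω p.1) P := by
  refine ⟨fun I => ?_⟩
  classical
  set K : Finset ℝ≥0 := I.image Prod.snd with hK
  have hg : ∀ i : Fin d, HasGaussianLaw (fun ω (u : K) => W u ω i) P :=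
    fun i => IsGaussianProcess.hasGaussianLaw (IsPreBrownianReal.isGaussianProcess (hW.coord i).toIsPreBrownianReal) K
  have hind : iIndepFun (fun (i : Fin d) ω (u : K) => W u ω i) P :=
    hW.indep.comp (g := fun (i : Fin d) (w : ℝ≥0 → ℝ) (u : K) => w u) fun i => by fun_prop
  have h := hind.hasGaussianLaw hg
  let L : (Fin d → K → ℝ) →L[ℝ] (I → ℝ) := ContinuousLinearMap.pi fun p =>
    (ContinuousLinearMap.proj (R := ℝ) (φ := fun _ : K => ℝ)
      ⟨p.1.2, Finset.mem_image_of_mem _ p.2⟩).comp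
      (ContinuousLinearMap.proj (R := ℝ) (φ := fun _ : Fin d => K → ℝ) p.1.1)
  exact h.map L

theorem IsBrownian.memLp_coord [IsProbabilityMeasure P] (hW : IsBrownian W P)
    (p : Fin d × ℝ≥0) : MemLp (fun ω => W p.2 ω p.1) 2 P :=
  (hW.isGaussianProcess_coord.hasGaussianLaw_eval p).memLp_two

theorem IsBrownian.integral_mul_coord [IsProbabilityMeasure P] (hW : IsBrownian W P)
    (p q : Fin d × ℝ≥0) : ∫ ω, W p.2 ω p.1 * W q.2 ω q.1 ∂P
      = if p.1 = q.1 then ((min p.2 q.2 : ℝ≥0) : ℝ) else 0 := by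
  have h0 : ∀ p : Fin d × ℝ≥0, ∫ ω, W p.2 ω p.1 ∂P = 0 := fun p => (hW.coord p.1).integral_eval p.2
  have h := covariance_eq_sub (hW.memLp_coord p) (hW.memLp_coord q)
  simp only [h0, mul_zero, sub_zero] at h
  refine h.symm.trans ?_
  split_ifs with hpq
  · obtain ⟨i, u⟩ := p
    obtain ⟨j, v⟩ := q
    obtain rfl : i = j := hpq
    exact (hW.coord i).covariance_eval u v
  · refine IndepFun.covariance_eq_zero ?_ (hW.memLp_coord p) (hW.memLp_coord q)
    exact (hW.indep.indepFun hpq).comp (φ := fun w : ℝ≥0 → ℝ => w p.2)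
      (ψ := fun w : ℝ≥0 → ℝ => w q.2) (by fun_prop) (by fun_prop)

theorem integral_abs_le_norm [IsProbabilityMeasure P] (f : Lp ℝ 2 P) : ∫ ω, |f ω| ∂P ≤ ‖f‖ := by
  have h1 : eLpNorm f 1 P ≤ eLpNorm f 2 P :=
    eLpNorm_le_eLpNorm_of_exponent_le (by norm_num) (Lp.aestronglyMeasurable f)
  have h2 := ENNReal.toReal_mono (Lp.eLpNorm_ne_top f) h1
  rw [← Lp.norm_def, eLpNorm_one_eq_lintegral_enorm,
    ← integral_norm_eq_lintegral_enorm (Lp.aestronglyMeasurable f)] at h2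
  exact h2

/-- |e^{iα} - e^{iβ}| ≤ |α - β| gives a Lipschitz bound in the L¹ norm, itself below the L² norm. It
carries Gaussian laws from a dense subspace to its closure. -/
theorem continuous_charFun_map [IsProbabilityMeasure P] (t : ℝ) :
    Continuous fun f : Lp ℝ 2 P => charFun (P.map f) t := by
  have hform : ∀ f : Lp ℝ 2 P,
      charFun (P.map f) t = ∫ ω, Complex.exp (t * f ω * Complex.I) ∂P := by
    intro f
    rw [charFun_apply_real, integral_map (Lp.aestronglyMeasurable f).aemeasurable
      (by fun_prop)]
  have hint : ∀ f : Lp ℝ 2 P, Integrable (fun ω => Complex.exp (t * f ω * Complex.I)) P := by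
    intro f
    refine Integrable.of_bound ?_ 1 (ae_of_all _ fun ω => ?_)
    · exact (by fun_prop : Continuous fun x : ℝ =>
        Complex.exp (t * x * Complex.I)).comp_aestronglyMeasurable (Lp.aestronglyMeasurable f)
    · rw [← Complex.ofReal_mul, Complex.norm_exp_ofReal_mul_I]
  have hlip : ∀ f g : Lp ℝ 2 P,
      dist (charFun (P.map f) t) (charFun (P.map g) t) ≤ |t| * dist f g := by
    intro f g
    rw [dist_eq_norm, dist_eq_norm, hform, hform, ← integral_sub (hint f) (hint g)]
    have hb : ∀ᵐ ω ∂P, ‖Complex.exp (t * f ω * Complex.I) - Complex.exp (t * g ω * Complex.I)‖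
        ≤ |t| * |(f - g : Lp ℝ 2 P) ω| := by
      filter_upwards [Lp.coeFn_sub f g] with ω hω
      have e : Complex.exp (t * f ω * Complex.I) - Complex.exp (t * g ω * Complex.I)
          = Complex.exp ((t * g ω : ℝ) * Complex.I) *
            (Complex.exp (Complex.I * (t * (f ω - g ω) : ℝ)) - 1) := by
        rw [mul_sub, ← Complex.exp_add]
        push_cast
        ring_nf
      rw [e, norm_mul, Complex.norm_exp_ofReal_mul_I, one_mul, hω, Pi.sub_apply, ← abs_mul]
      exact Real.norm_exp_I_mul_ofReal_sub_one_le
    have hi : Integrable (fun ω => |t| * |(f - g : Lp ℝ 2 P) ω|) P :=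
      (((Lp.memLp (f - g)).integrable (by norm_num)).abs).const_mul _
    refine (norm_integral_le_of_norm_le hi hb).trans ?_
    rw [integral_const_mul]
    exact mul_le_mul_of_nonneg_left (integral_abs_le_norm _) (abs_nonneg t)
  exact (LipschitzWith.of_dist_le_mul (K := ⟨|t|, abs_nonneg t⟩) hlip).continuous

/-- Equal Gram matrices make the assignment of coordinates of `W` to step functions isometric on
linear combinations, and it extends by density. The law is checked on combinations, where joint
Gaussianity applies, and passes to the limit through characteristic functions. -/
theorem IsBrownian.exists_isWienerMap [IsProbabilityMeasure P] (hW : IsBrownian W P) :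
    ∃ J : L2 d →ₗᵢ[ℝ] Lp ℝ 2 P, IsWienerMap P W J := by
  set f₀ : Fin d × ℝ≥0 → Lp ℝ 2 P := fun p => (hW.memLp_coord p).toLp _ with hf₀
  have hgram : ∀ p q, inner ℝ (f₀ p) (f₀ q) = inner ℝ (stepL2 d p) (stepL2 d q) := by
    intro p q
    rw [inner_stepL2, ← hW.integral_mul_coord p q, L2.inner_def]
    refine integral_congr_ae ?_
    filter_upwards [(hW.memLp_coord p).coeFn_toLp, (hW.memLp_coord q).coeFn_toLp] with ω h1 h2
    simp only [hf₀, h1, h2]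
    simp [mul_comm]
  set e := Finsupp.linearCombination ℝ (stepL2 d)
  set f := Finsupp.linearCombination ℝ f₀
  have hnorm : ∀ c, ‖f c‖ = ‖e c‖ := norm_linearCombination_eq hgram
  have hdense : DenseRange e := denseRange_stepL2 d
  set J₀ := f.extendOfNorm e
  have hJ₀ : ∀ c, J₀ (e c) = f c := LinearMap.extendOfNorm_eq hdense ⟨1, fun c => by simp [hnorm]⟩
  have hiso : ∀ h, ‖J₀ h‖ = ‖h‖ := by
    intro h
    refine hdense.induction_on (p := fun h => ‖J₀ h‖ = ‖h‖) h
      (isClosed_eq (by fun_prop) (by fun_prop)) fun c => ?_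
    rw [hJ₀, hnorm]
  refine ⟨⟨J₀.toLinearMap, hiso⟩, fun p => ?_, fun h => ?_⟩
  · have h1 : stepL2 d p = e (Finsupp.single p 1) := by simp [e]
    change J₀ _ =ᵐ[P] _
    rw [h1, hJ₀]
    simp only [f, Finsupp.linearCombination_single, one_smul]
    exact (hW.memLp_coord p).coeFn_toLp
  · change P.map (J₀ h) = _
    have : IsProbabilityMeasure (P.map (J₀ h)) :=
      Measure.isProbabilityMeasure_map (Lp.aestronglyMeasurable _).aemeasurable
    refine Measure.ext_of_charFun (funext fun t => ?_)
    refine hdense.induction_on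
      (p := fun h => charFun (P.map (J₀ h)) t = charFun (gaussianReal 0 (‖h‖₊ ^ 2)) t) h
      (isClosed_eq ((continuous_charFun_map t).comp J₀.continuous) ?_) fun c => ?_
    · simp only [charFun_gaussianReal]
      have : Continuous fun h : L2 d => (((‖h‖₊ ^ 2 : ℝ≥0) : ℝ) : ℂ) := by
        simp only [NNReal.coe_pow, coe_nnnorm]
        fun_prop
      fun_prop
    · rw [hJ₀]
      have hae : (fun ω => ∑ p ∈ c.support, c p * W p.2 ω p.1) =ᵐ[P] f c := by
        rw [show f c = ∑ p ∈ c.support, c p • f₀ p from rfl]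
        have h1 : ∀ᵐ ω ∂P, ∀ p ∈ c.support, (c p • f₀ p : Lp ℝ 2 P) ω = c p * W p.2 ω p.1 := by
          rw [Filter.eventually_all_finset]
          intro p _
          filter_upwards [Lp.coeFn_smul (c p) (f₀ p), (hW.memLp_coord p).coeFn_toLp] with ω h2 h3
          rw [h2, Pi.smul_apply, smul_eq_mul, h3]
        filter_upwards [h1, Lp.coeFn_finsetSum c.support fun p => c p • f₀ p] with ω h2 h3
        rw [h3, Finset.sum_apply]
        exact (Finset.sum_congr rfl h2).symm
      have hgl : HasGaussianLaw (f c) P := by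
        have h1 := (hW.isGaussianProcess_coord.smul c).hasGaussianLaw_fun_sum (I := c.support)
        exact HasGaussianLaw.congr h1 hae
      have hmean : ∫ ω, f c ω ∂P = 0 := by
        rw [← integral_congr_ae hae, integral_finsetSum _ fun p _ =>
          ((hW.memLp_coord p).integrable (by norm_num)).const_mul _]
        refine Finset.sum_eq_zero fun p _ => ?_
        rw [integral_const_mul, (hW.coord p.1).integral_eval p.2, mul_zero]
      have hvar : Var[f c; P].toNNReal = ‖e c‖₊ ^ 2 := by
        rw [variance_of_integral_eq_zero (Lp.aestronglyMeasurable _).aemeasurable hmean]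
        have h1 : ∫ ω, f c ω ^ 2 ∂P = ‖f c‖ ^ 2 := by
          rw [← real_inner_self_eq_norm_sq, L2.inner_def]
          simp [sq]
        rw [h1, hnorm]
        apply NNReal.eq
        simp
      rw [hgl.map_eq_gaussianReal, hmean, hvar]

/-! ### Integrands restricted to time intervals -/

theorem PW.memLp {E : Type*} [NormedAddCommGroup E] {T τ : ℝ} {k : ℝ → E} (hk : PW T τ k)
    {α β : ℝ} (hα : 0 ≤ α) (hβ : β ≤ T) (p : ℝ≥0∞) : MemLp k p (volume.restrict (Ioc α β)) := by
  obtain ⟨M, -, hM⟩ := hk.exists_bound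
  have hsub : Ioc α β ⊆ Icc 0 T := fun r hr => ⟨hα.trans hr.1.le, hr.2.trans hβ⟩
  refine MemLp.of_bound (hk.aestronglyMeasurable.mono_measure (Measure.restrict_mono hsub le_rfl)) M
    ?_
  filter_upwards [ae_restrict_mem measurableSet_Ioc] with r hr using hM r (hsub hr)

open Classical in
/-- The function `1_{(α, β]} k` as an element of `L²`. -/
def segL2 {d : ℕ} (α β : ℝ) (k : ℝ → Vec d) : L2 d :=
  if h : MemLp ((Ioc α β).indicator k) 2 (volume.restrict (Ioi (0 : ℝ))) then h.toLp else 0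

section Segments

variable {d : ℕ} {α β γ : ℝ} {k l : ℝ → Vec d}

theorem segL2_coeFn (hk : MemLp k 2 (volume.restrict (Ioc α β))) :
    segL2 α β k =ᵐ[volume.restrict (Ioi (0 : ℝ))] (Ioc α β).indicator k := by
  have h : MemLp ((Ioc α β).indicator k) 2 (volume.restrict (Ioi (0 : ℝ))) := by
    rw [memLp_indicator_iff_restrict measurableSet_Ioc]
    exact hk.mono_measure (Measure.restrict_mono_measure Measure.restrict_le_self _)
  rw [segL2, dif_pos h]
  exact h.coeFn_toLp

theorem segL2_add (hk : MemLp k 2 (volume.restrict (Ioc α β)))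
    (hl : MemLp l 2 (volume.restrict (Ioc α β))) :
    segL2 α β (fun r => k r + l r) = segL2 α β k + segL2 α β l := by
  refine Lp.ext ?_
  filter_upwards [segL2_coeFn (hk.add hl), segL2_coeFn hk, segL2_coeFn hl,
    Lp.coeFn_add (segL2 α β k) (segL2 α β l)] with r h1 h2 h3 h4
  rw [h4, Pi.add_apply, h2, h3]
  refine h1.trans ?_
  by_cases hr : r ∈ Ioc α β <;> simp [hr]

theorem segL2_smul (c : ℝ) (hk : MemLp k 2 (volume.restrict (Ioc α β))) :
    segL2 α β (fun r => c • k r) = c • segL2 α β k := by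
  refine Lp.ext ?_
  filter_upwards [segL2_coeFn (hk.const_smul c), segL2_coeFn hk,
    Lp.coeFn_smul c (segL2 α β k)] with r h1 h2 h4
  rw [h4, Pi.smul_apply, h2]
  refine h1.trans ?_
  by_cases hr : r ∈ Ioc α β <;> simp [hr]

theorem segL2_self (k : ℝ → Vec d) : segL2 α α k = 0 := by
  refine Lp.ext ?_
  filter_upwards [segL2_coeFn (k := k) (α := α) (β := α) (by simp),
    Lp.coeFn_zero (Vec d) 2 (volume.restrict (Ioi (0 : ℝ)))] with r h1 h2
  rw [h1, h2]
  simp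

theorem segL2_split (hαγ : α ≤ γ) (hγβ : γ ≤ β) (hk : MemLp k 2 (volume.restrict (Ioc α β))) :
    segL2 α β k = segL2 α γ k + segL2 γ β k := by
  have h1 := hk.mono_measure (Measure.restrict_mono (Ioc_subset_Ioc_right hγβ) le_rfl)
  have h2 := hk.mono_measure (Measure.restrict_mono (Ioc_subset_Ioc_left hαγ) le_rfl)
  refine Lp.ext ?_
  filter_upwards [segL2_coeFn hk, segL2_coeFn h1, segL2_coeFn h2,
    Lp.coeFn_add (segL2 α γ k) (segL2 γ β k)] with r e e1 e2 e3
  rw [e3, Pi.add_apply, e, e1, e2]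
  by_cases h : r ≤ γ
  · have : r ∉ Ioc γ β := fun h' => absurd h'.1 h.not_gt
    rw [indicator_of_notMem this, add_zero]
    by_cases h' : α < r
    · rw [indicator_of_mem (show r ∈ Ioc α β from ⟨h', h.trans hγβ⟩),
        indicator_of_mem (show r ∈ Ioc α γ from ⟨h', h⟩)]
    · rw [indicator_of_notMem (fun h'' : r ∈ Ioc α β => h' h''.1),
        indicator_of_notMem (fun h'' : r ∈ Ioc α γ => h' h''.1)]
  · have h := not_le.1 h
    have : r ∉ Ioc α γ := fun h' => absurd h'.2 h.not_ge
    rw [indicator_of_notMem this, zero_add]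
    by_cases h' : r ≤ β
    · rw [indicator_of_mem (show r ∈ Ioc α β from ⟨hαγ.trans_lt h, h'⟩),
        indicator_of_mem (show r ∈ Ioc γ β from ⟨h, h'⟩)]
    · rw [indicator_of_notMem (fun h'' : r ∈ Ioc α β => h' h''.2),
        indicator_of_notMem (fun h'' : r ∈ Ioc γ β => h' h''.2)]

theorem inner_segL2_left (hα : 0 ≤ α) (hk : MemLp k 2 (volume.restrict (Ioc α β))) (f : L2 d) :
    inner ℝ (segL2 α β k) f = ∫ r in Ioc α β, inner ℝ (k r) (f r) := by
  have hsub : Ioc α β ⊆ Ioi 0 := fun r hr => hα.trans_lt hr.1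
  have h1 : ∫ r in Ioc α β, inner ℝ (k r) (f r)
      = ∫ r in Ioc α β, inner ℝ (k r) (f r) ∂(volume.restrict (Ioi (0 : ℝ))) := by
    rw [Measure.restrict_restrict measurableSet_Ioc, inter_eq_left.2 hsub]
  rw [L2.inner_def, h1, ← integral_indicator measurableSet_Ioc]
  refine integral_congr_ae ?_
  filter_upwards [segL2_coeFn hk] with r hr
  rw [hr]
  by_cases h : r ∈ Ioc α β <;> simp [h]

theorem inner_segL2 (hα : 0 ≤ α) (hαβ : α ≤ β) (hk : MemLp k 2 (volume.restrict (Ioc α β)))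
    (hl : MemLp l 2 (volume.restrict (Ioc α β))) :
    inner ℝ (segL2 α β k) (segL2 α β l) = ∫ r in α..β, inner ℝ (k r) (l r) := by
  rw [inner_segL2_left hα hk, intervalIntegral.integral_of_le hαβ]
  have hsub : Ioc α β ⊆ Ioi 0 := fun r hr => hα.trans_lt hr.1
  have h1 := ae_restrict_of_ae_restrict_of_subset hsub (segL2_coeFn hl)
  refine integral_congr_ae ?_
  filter_upwards [h1, ae_restrict_mem measurableSet_Ioc] with r hr hr'
  rw [hr, indicator_of_mem hr']

theorem inner_segL2_disjoint {α' β' : ℝ} (hα : 0 ≤ α) (hdisj : Disjoint (Ioc α β) (Ioc α' β'))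
    (hk : MemLp k 2 (volume.restrict (Ioc α β))) (hl : MemLp l 2 (volume.restrict (Ioc α' β'))) :
    inner ℝ (segL2 α β k) (segL2 α' β' l) = 0 := by
  rw [inner_segL2_left hα hk]
  have hsub : Ioc α β ⊆ Ioi 0 := fun r hr => hα.trans_lt hr.1
  have h1 := ae_restrict_of_ae_restrict_of_subset hsub (segL2_coeFn hl)
  refine integral_eq_zero_of_ae ?_
  filter_upwards [h1, ae_restrict_mem measurableSet_Ioc] with r hr hr'
  rw [hr, indicator_of_notMem (disjoint_left.1 hdisj hr')]
  simp

theorem stepL2_eq_segL2 (p : Fin d × ℝ≥0) :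
    stepL2 d p = segL2 0 p.2 (fun _ => EuclideanSpace.single p.1 1) := by
  refine Lp.ext ?_
  filter_upwards [segL2_coeFn (k := fun _ => EuclideanSpace.single p.1 (1 : ℝ)) (α := 0)
    (β := p.2) (memLp_const _), indicatorConstLp_coeFn (p := 2)
    (μ := volume.restrict (Ioi (0 : ℝ))) (hs := measurableSet_Ioc (a := (0 : ℝ)) (b := p.2))
    (hμs := ne_of_lt ((Measure.restrict_apply_le _ _).trans_lt measure_Ioc_lt_top))
    (c := EuclideanSpace.single p.1 (1 : ℝ))] with r h1 h2
  rw [h1]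
  exact h2

end Segments

/-! ### Step functions -/

section Steps

variable {d : ℕ} {n : ℕ} {π : ℕ → ℝ} {A : ℕ → Mat d}

theorem stepFun_eq (hπ : Monotone π) {i : ℕ} (hi : i < n) {r : ℝ}
    (hr : r ∈ Ioc (π i) (π (i + 1))) : stepFun n π A r = A i := by
  rw [stepFun, Finset.sum_eq_single i]
  · exact indicator_of_mem hr _
  · intro j _ hj
    refine indicator_of_notMem (fun hr' => ?_) _
    rcases lt_or_gt_of_ne hj with h | h
    · exact absurd (hr'.2.trans (hπ h)) hr.1.not_ge
    · exact absurd (hr.2.trans (hπ h)) hr'.1.not_ge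
  · exact fun h => absurd (Finset.mem_range.2 hi) h

theorem exists_mem_Ioc_of_monotone {r : ℝ} : ∀ {n : ℕ}, r ∈ Ioc (π 0) (π n) →
    ∃ i < n, r ∈ Ioc (π i) (π (i + 1))
  | 0, hr => absurd (hr.1.trans_le hr.2) (lt_irrefl _)
  | n + 1, hr => by
    by_cases h : r ≤ π n
    · obtain ⟨i, hi, h'⟩ := exists_mem_Ioc_of_monotone (n := n) ⟨hr.1, h⟩
      exact ⟨i, hi.trans n.lt_succ_self, h'⟩
    · exact ⟨n, n.lt_succ_self, not_le.1 h, hr.2⟩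

theorem measurable_stepFun : StronglyMeasurable (stepFun n π A) :=
  Finset.stronglyMeasurable_fun_sum _ fun _ _ =>
    stronglyMeasurable_const.indicator measurableSet_Ioc

theorem memLp_stepFun (α β : ℝ) : MemLp (stepFun n π A) 2 (volume.restrict (Ioc α β)) := by
  refine MemLp.of_bound measurable_stepFun.aestronglyMeasurable
    (∑ i ∈ Finset.range n, ‖A i‖) (ae_of_all _ fun r => ?_)
  exact (norm_sum_le _ _).trans (Finset.sum_le_sum fun i _ => norm_indicator_le_norm_self _ _)

/-- The uniform partition of `[α, β]`. -/
def uniformPartition (α β : ℝ) (n i : ℕ) : ℝ := α + (β - α) * (i / (n + 1))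

theorem monotone_uniformPartition {α β : ℝ} (h : α ≤ β) (n : ℕ) :
    Monotone (uniformPartition α β n) := by
  intro i j hij
  have h' := sub_nonneg.2 h
  have : (i : ℝ) ≤ j := by exact_mod_cast hij
  unfold uniformPartition
  gcongr

theorem uniformPartition_zero (α β : ℝ) (n : ℕ) : uniformPartition α β n 0 = α := by
  simp [uniformPartition]

theorem uniformPartition_last (α β : ℝ) (n : ℕ) : uniformPartition α β n (n + 1) = β := by
  have : ((n + 1 : ℕ) : ℝ) / (n + 1) = 1 := by
    push_cast
    exact div_self (by positivity)
  rw [uniformPartition, this]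
  ring

theorem uniformPartition_succ (α β : ℝ) (n i : ℕ) :
    uniformPartition α β n (i + 1) = uniformPartition α β n i + (β - α) / (n + 1) := by
  simp only [uniformPartition]
  push_cast
  ring

/-- Sampling is at right endpoints: the sampling point approaches r from the right, where g is
continuous even at r = τ. So convergence holds at every r in (α, β), and bounded convergence
concludes. -/
theorem PW.tendsto_stepFun {T τ α β : ℝ} {g : ℝ → Mat d} (hg : PW T τ g) (hα : 0 ≤ α)
    (hαβ : α ≤ β) (hβ : β ≤ T) :
    Tendsto (fun n => eLpNorm (fun r => stepFun (n + 1) (uniformPartition α β n)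
      (fun i => g (uniformPartition α β n (i + 1))) r - g r) 2 (volume.restrict (Ioc α β)))
      atTop (𝓝 0) := by
  set F : ℕ → ℝ → Mat d := fun n => stepFun (n + 1) (uniformPartition α β n)
    (fun i => g (uniformPartition α β n (i + 1))) with hF
  have hval : ∀ n, ∀ r ∈ Ioc α β, ∃ ρ, F n r = g ρ ∧ r ≤ ρ ∧ ρ ≤ r + (β - α) / (n + 1) ∧ ρ ≤ β := by
    intro n r hr
    have hr' : r ∈ Ioc (uniformPartition α β n 0) (uniformPartition α β n (n + 1)) := by
      rwa [uniformPartition_zero, uniformPartition_last]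
    obtain ⟨i, hi, hri⟩ := exists_mem_Ioc_of_monotone hr'
    refine ⟨_, stepFun_eq (monotone_uniformPartition hαβ n) hi hri, hri.2, ?_, ?_⟩
    · rw [uniformPartition_succ]
      linarith [hri.1]
    · exact (monotone_uniformPartition hαβ n hi).trans_eq (uniformPartition_last α β n)
  obtain ⟨M, hM0, hM⟩ := hg.exists_bound
  have hsub : Ioc α β ⊆ Icc 0 T := fun r hr => ⟨hα.trans hr.1.le, hr.2.trans hβ⟩
  have hbound : ∀ n, ∀ r ∈ Ioc α β, ‖F n r - g r‖ ≤ 2 * M := by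
    intro n r hr
    obtain ⟨ρ, h1, h2, -, h3⟩ := hval n r hr
    rw [h1]
    refine (norm_sub_le _ _).trans ?_
    linarith [hM ρ ⟨(hsub hr).1.trans h2, h3.trans hβ⟩, hM r (hsub hr)]
  have hlim : ∀ r ∈ Ioo α β, Tendsto (fun n => F n r) atTop (𝓝 (g r)) := by
    intro r hr
    choose ρ h1 h2 h3 _ using fun n => hval n r ⟨hr.1, hr.2.le⟩
    have hρ : Tendsto ρ atTop (𝓝 r) := by
      refine tendsto_of_tendsto_of_tendsto_of_le_of_le tendsto_const_nhds ?_ h2 h3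
      have : Tendsto (fun n : ℕ => (β - α) / ((n : ℝ) + 1)) atTop (𝓝 0) :=
        (tendsto_const_div_atTop_nhds_zero_nat (β - α)).comp (tendsto_add_atTop_nat 1) |>.congr
          fun n => by simp
      simpa using this.const_add r
    have := (hg.continuousWithinAt (hα.trans hr.1.le) (hr.2.trans_le hβ)).tendsto.comp
      (tendsto_nhdsWithin_iff.2 ⟨hρ, Eventually.of_forall h2⟩)
    exact this.congr fun n => (h1 n).symm
  have hmeas : ∀ n, AEStronglyMeasurable (fun r => F n r - g r) (volume.restrict (Ioc α β)) :=
    fun n => measurable_stepFun.aestronglyMeasurable.sub (hg.memLp hα hβ 2).1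
  have hdom : Tendsto (fun n => ∫⁻ r in Ioc α β, ‖F n r - g r‖ₑ ^ (2 : ℝ)) atTop (𝓝 0) := by
    have h0 : (0 : ℝ≥0∞) = ∫⁻ r in Ioc α β, 0 := by simp
    rw [h0]
    refine tendsto_lintegral_of_dominated_convergence' (fun _ => ENNReal.ofReal (2 * M) ^ (2 : ℝ))
      (fun n => (hmeas n).enorm.pow_const _) (fun n => ?_) ?_ ?_
    · filter_upwards [ae_restrict_mem measurableSet_Ioc] with r hr
      refine ENNReal.rpow_le_rpow ?_ (by norm_num)
      rw [← ofReal_norm]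
      exact ENNReal.ofReal_le_ofReal (hbound n r hr)
    · rw [lintegral_const, Measure.restrict_apply_univ]
      exact ENNReal.mul_ne_top (ENNReal.rpow_ne_top_of_nonneg (by norm_num) ENNReal.ofReal_ne_top)
        measure_Ioc_lt_top.ne
    · have hne : ∀ᵐ r ∂(volume.restrict (Ioc α β)), r ≠ β :=
        ae_restrict_of_ae (Measure.ae_ne volume β)
      filter_upwards [ae_restrict_mem measurableSet_Ioc, hne] with r hr hr'
      have h1 := (hlim r ⟨hr.1, lt_of_le_of_ne hr.2 hr'⟩).sub_const (g r)
      rw [sub_self] at h1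
      have h2 := ((ENNReal.continuous_rpow_const (y := (2 : ℝ))).comp continuous_enorm).tendsto
        (0 : Mat d)
      have h3 := h2.comp h1
      have h4 : ‖(0 : Mat d)‖ₑ ^ (2 : ℝ) = 0 := by
        rw [← ofReal_norm]
        simp
      exact h3.trans_eq (congrArg 𝓝 h4)
  have hfin := ((ENNReal.continuous_rpow_const (y := (1 / 2 : ℝ))).tendsto 0).comp hdom
  refine (hfin.congr fun n => ?_).trans_eq ?_
  · rw [eLpNorm_eq_lintegral_rpow_enorm_toReal (by norm_num) (by norm_num)]
    simp [hF]
  · simp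

end Steps

/-! ### Wiener integrals as values of the isometry -/

theorem segL2_congr {d : ℕ} {α β : ℝ} {k l : ℝ → Vec d} (h : EqOn k l (Ioc α β)) :
    segL2 α β k = segL2 α β l := by
  have h' : (Ioc α β).indicator k = (Ioc α β).indicator l := indicator_congr h
  rw [segL2, segL2]
  rw [h']

theorem segL2_single {d : ℕ} {a b : ℝ} (ha : 0 ≤ a) (hab : a ≤ b) (j : Fin d) :
    segL2 a b (fun _ => EuclideanSpace.single j 1)
      = stepL2 d (j, b.toNNReal) - stepL2 d (j, a.toNNReal) := by
  rw [stepL2_eq_segL2, stepL2_eq_segL2, Real.coe_toNNReal _ ha, Real.coe_toNNReal _ (ha.trans hab),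
    segL2_split ha hab (memLp_const _), add_sub_cancel_left]

theorem segL2_const {d : ℕ} {a b : ℝ} (v : Vec d) :
    segL2 a b (fun _ => v) = ∑ j, v j • segL2 a b (fun _ => EuclideanSpace.single j (1 : ℝ)) := by
  let L : Vec d →ₗ[ℝ] L2 d :=
    { toFun := fun v => segL2 a b (fun _ => v)
      map_add' := fun v w => segL2_add (memLp_const v) (memLp_const w)
      map_smul' := fun c v => segL2_smul c (memLp_const v) }
  have h := congrArg L ((EuclideanSpace.basisFun (Fin d) ℝ).sum_repr v)
  rw [map_sum] at h
  refine h.symm.trans (Finset.sum_congr rfl fun j _ => ?_)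
  rw [map_smul]
  simp [L]

variable {d : ℕ} {Ω : Type*} {mΩ : MeasurableSpace Ω} {P : Measure Ω} {W : ℝ≥0 → Ω → Vec d}
  {J : L2 d →ₗᵢ[ℝ] Lp ℝ 2 P}

theorem IsBrownian.measurable_stepIntegral (hW : IsBrownian W P) (n : ℕ) (π : ℕ → ℝ) (A : ℕ → Mat d) :
    Measurable (stepIntegral W n π A) :=
  Finset.measurable_fun_sum _ fun _ _ =>
    (A _).continuous.measurable.comp ((hW.measurable _).sub (hW.measurable _))

namespace IsWienerMap

variable (hJ : IsWienerMap P W J)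
include hJ

theorem apply_const {a b : ℝ} (ha : 0 ≤ a) (hab : a ≤ b) (v : Vec d) :
    J (segL2 a b fun _ => v) =ᵐ[P]
      fun ω => inner ℝ v (W b.toNNReal ω - W a.toNNReal ω) := by
  have h0 : J (segL2 a b fun _ => v)
      = ∑ j, v j • (J (stepL2 d (j, b.toNNReal)) - J (stepL2 d (j, a.toNNReal))) := by
    rw [segL2_const, map_sum]
    refine Finset.sum_congr rfl fun j _ => ?_
    rw [map_smul, segL2_single ha hab, map_sub]
  have h1 : ∀ᵐ ω ∂P, ∀ j : Fin d,
      (v j • (J (stepL2 d (j, b.toNNReal)) - J (stepL2 d (j, a.toNNReal))) : Lp ℝ 2 P) ω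
        = v j * (W b.toNNReal ω j - W a.toNNReal ω j) := by
    rw [ae_all_iff]
    intro j
    filter_upwards [hJ.apply_step (j, b.toNNReal), hJ.apply_step (j, a.toNNReal),
      Lp.coeFn_smul (v j) (J (stepL2 d (j, b.toNNReal)) - J (stepL2 d (j, a.toNNReal))),
      Lp.coeFn_sub (J (stepL2 d (j, b.toNNReal))) (J (stepL2 d (j, a.toNNReal)))]
      with ω h2 h3 h4 h5
    rw [h4, Pi.smul_apply, h5, Pi.sub_apply, h2, h3, smul_eq_mul]
  rw [h0]
  filter_upwards [h1, Lp.coeFn_finsetSum Finset.univ fun j =>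
    v j • (J (stepL2 d (j, b.toNNReal)) - J (stepL2 d (j, a.toNNReal)))] with ω h2 h3
  rw [h3, Finset.sum_apply, Finset.sum_congr rfl fun j _ => h2 j, PiLp.inner_apply]
  simp [mul_comm]

/-- ⟨ζ, A dW⟩ = ⟨A*ζ, dW⟩ on each interval of the partition; the vector integral is thus reduced to
scalar ones. -/
theorem inner_stepIntegral {π : ℕ → ℝ} (hπ : Monotone π) (h0 : 0 ≤ π 0) (A : ℕ → Mat d)
    (ζ : Vec d) (n : ℕ) : (fun ω => inner ℝ ζ (stepIntegral W n π A ω)) =ᵐ[P]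
      J (segL2 (π 0) (π n) fun r => (stepFun n π A r).adjoint ζ) := by
  induction n with
  | zero =>
    rw [segL2_self, map_zero]
    filter_upwards [Lp.coeFn_zero ℝ 2 P] with ω hω
    rw [hω]
    simp [stepIntegral]
  | succ n ih =>
    have hn : 0 ≤ π n := h0.trans (hπ n.zero_le)
    have hmem : MemLp (fun r => (stepFun (n + 1) π A r).adjoint ζ) 2
        (volume.restrict (Ioc (π 0) (π (n + 1)))) := by
      have h1 := memLp_stepFun (n := n + 1) (π := π) (A := A) (π 0) (π (n + 1))
      refine h1.of_le_mul (c := ‖ζ‖) ?_ (ae_of_all _ fun r => ?_)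
      · exact (by fun_prop : Continuous fun B : Mat d => B.adjoint ζ).comp_aestronglyMeasurable h1.1
      · refine (ContinuousLinearMap.le_opNorm _ _).trans ?_
        rw [LinearIsometryEquiv.norm_map, mul_comm]
    rw [segL2_split (hπ n.zero_le) (hπ n.le_succ) hmem]
    have e1 : segL2 (π 0) (π n) (fun r => (stepFun (n + 1) π A r).adjoint ζ)
        = segL2 (π 0) (π n) (fun r => (stepFun n π A r).adjoint ζ) := by
      refine segL2_congr fun r hr => ?_
      obtain ⟨i, hi, hr'⟩ := exists_mem_Ioc_of_monotone hr
      simp only [stepFun_eq hπ hi hr', stepFun_eq hπ (hi.trans n.lt_succ_self) hr']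
    have e2 : segL2 (π n) (π (n + 1)) (fun r => (stepFun (n + 1) π A r).adjoint ζ)
        = segL2 (π n) (π (n + 1)) (fun _ => (A n).adjoint ζ) := by
      refine segL2_congr fun r hr => ?_
      simp only [stepFun_eq hπ n.lt_succ_self hr]
    rw [e1, e2, map_add]
    filter_upwards [ih, hJ.apply_const hn (hπ n.le_succ) ((A n).adjoint ζ), Lp.coeFn_add
      (J (segL2 (π 0) (π n) fun r => (stepFun n π A r).adjoint ζ))
      (J (segL2 (π n) (π (n + 1)) fun _ => (A n).adjoint ζ))] with ω h1 h2 h3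
    rw [h3, Pi.add_apply, ← h1, h2, ContinuousLinearMap.adjoint_inner_left, ← inner_add_right]
    simp only [stepIntegral, Finset.sum_range_succ]

/-- Since `J` is an isometry, the error over Ω equals an error over time. -/
theorem eLpNorm_inner_stepIntegral_sub_le {π : ℕ → ℝ} (hπ : Monotone π) (h0 : 0 ≤ π 0)
    (A : ℕ → Mat d) (n : ℕ) {g : ℝ → Mat d}
    (hg : MemLp g 2 (volume.restrict (Ioc (π 0) (π n)))) (ζ : Vec d) :
    eLpNorm (fun ω => inner ℝ ζ (stepIntegral W n π A ω)
        - J (segL2 (π 0) (π n) fun r => (g r).adjoint ζ) ω) 2 P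
      ≤ ENNReal.ofReal ‖ζ‖ *
        eLpNorm (fun r => stepFun n π A r - g r) 2 (volume.restrict (Ioc (π 0) (π n))) := by
  have hmem : ∀ {k : ℝ → Mat d}, MemLp k 2 (volume.restrict (Ioc (π 0) (π n))) →
      MemLp (fun r => (k r).adjoint ζ) 2 (volume.restrict (Ioc (π 0) (π n))) := by
    intro k hk
    refine hk.of_le_mul (c := ‖ζ‖) ?_ (ae_of_all _ fun r => ?_)
    · exact (by fun_prop : Continuous fun B : Mat d => B.adjoint ζ).comp_aestronglyMeasurable hk.1
    · refine (ContinuousLinearMap.le_opNorm _ _).trans ?_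
      rw [LinearIsometryEquiv.norm_map, mul_comm]
  have h1 := hmem hg
  have h2 := hmem (memLp_stepFun (n := n) (π := π) (A := A) (π 0) (π n))
  set f := segL2 (π 0) (π n) fun r => (stepFun n π A r).adjoint ζ with hf
  set f' := segL2 (π 0) (π n) fun r => (g r).adjoint ζ with hf'
  have e1 : eLpNorm (fun ω => inner ℝ ζ (stepIntegral W n π A ω) - J f' ω) 2 P = ‖f - f'‖ₑ := by
    rw [← LinearIsometry.enorm_map J, Lp.enorm_def, map_sub]
    refine eLpNorm_congr_ae ?_
    filter_upwards [hJ.inner_stepIntegral hπ h0 A ζ n, Lp.coeFn_sub (J f) (J f')] with ω h3 h4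
    rw [h4, Pi.sub_apply, h3]
  rw [e1, Lp.enorm_def]
  have e2 : eLpNorm (f - f' : L2 d) 2 (volume.restrict (Ioi (0 : ℝ)))
      = eLpNorm ((Ioc (π 0) (π n)).indicator fun r => (stepFun n π A r - g r).adjoint ζ) 2
        (volume.restrict (Ioi (0 : ℝ))) := by
    refine eLpNorm_congr_ae ?_
    filter_upwards [Lp.coeFn_sub f f', segL2_coeFn h1, segL2_coeFn h2] with r h3 h4 h5
    rw [h3, Pi.sub_apply, h4, h5]
    by_cases hr : r ∈ Ioc (π 0) (π n) <;> simp [hr]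
  rw [e2, eLpNorm_indicator_eq_eLpNorm_restrict measurableSet_Ioc]
  refine (eLpNorm_mono_measure _ (Measure.restrict_mono_measure Measure.restrict_le_self _)).trans ?_
  refine eLpNorm_le_mul_eLpNorm_of_ae_le_mul (ae_of_all _ fun r => ?_) 2
  refine (ContinuousLinearMap.le_opNorm _ _).trans ?_
  rw [LinearIsometryEquiv.norm_map, mul_comm]

/-- Whatever step functions are used, their integrals converge to the same value of `J`. Hence the
Wiener integral is unique up to null sets. -/
theorem inner_ae_eq_of_isWienerIntegral (hW : IsBrownian W P) {α β : ℝ} (hα : 0 ≤ α)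
    {g : ℝ → Mat d} (hg : MemLp g 2 (volume.restrict (Ioc α β))) {I : Ω → Vec d}
    (hI : IsWienerIntegral P W g α β I) (ζ : Vec d) :
    (fun ω => inner ℝ ζ (I ω)) =ᵐ[P] J (segL2 α β fun r => (g r).adjoint ζ) := by
  obtain ⟨hmeas, n, π, A, hπ, h1, h2⟩ := hI
  have hb : ∀ k, eLpNorm (fun ω => inner ℝ ζ (I ω) - J (segL2 α β fun r => (g r).adjoint ζ) ω) 2 P
      ≤ ENNReal.ofReal ‖ζ‖ * eLpNorm (fun ω => stepIntegral W (n k) (π k) (A k) ω - I ω) 2 P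
        + ENNReal.ofReal ‖ζ‖ * eLpNorm (fun r => stepFun (n k) (π k) (A k) r - g r) 2
          (volume.restrict (Ioc α β)) := by
    intro k
    obtain ⟨hm, h0, hn⟩ := hπ k
    have h3 := hJ.eLpNorm_inner_stepIntegral_sub_le hm (h0 ▸ hα) (A k) (n k)
      (by rw [h0, hn]; exact hg) ζ
    rw [h0, hn] at h3
    have hms := hW.measurable_stepIntegral (n k) (π k) (A k)
    have e : (fun ω => inner ℝ ζ (I ω) - J (segL2 α β fun r => (g r).adjoint ζ) ω)
        = (fun ω => inner ℝ ζ (I ω - stepIntegral W (n k) (π k) (A k) ω)) +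
          fun ω => inner ℝ ζ (stepIntegral W (n k) (π k) (A k) ω)
            - J (segL2 α β fun r => (g r).adjoint ζ) ω := by
      funext ω
      simp [inner_sub_right]
    rw [e]
    refine (eLpNorm_add_le ?_ ?_ (by norm_num)).trans (add_le_add ?_ h3)
    · exact (by fun_prop : Continuous fun v : Vec d => inner ℝ ζ v).comp_aestronglyMeasurable
        (hmeas.sub hms.aestronglyMeasurable)
    · exact ((by fun_prop : Continuous fun v : Vec d => inner ℝ ζ v).comp_aestronglyMeasurable
        hms.aestronglyMeasurable).sub (Lp.aestronglyMeasurable _)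
    · refine eLpNorm_le_mul_eLpNorm_of_ae_le_mul (ae_of_all _ fun ω => ?_) 2
      rw [norm_sub_rev]
      exact norm_inner_le_norm _ _
  have hlim : Tendsto (fun k => ENNReal.ofReal ‖ζ‖ *
        eLpNorm (fun ω => stepIntegral W (n k) (π k) (A k) ω - I ω) 2 P
        + ENNReal.ofReal ‖ζ‖ * eLpNorm (fun r => stepFun (n k) (π k) (A k) r - g r) 2
          (volume.restrict (Ioc α β))) atTop (𝓝 0) := by
    have h4 := (ENNReal.Tendsto.const_mul (a := ENNReal.ofReal ‖ζ‖) h2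
      (Or.inr ENNReal.ofReal_ne_top)).add
      (ENNReal.Tendsto.const_mul (a := ENNReal.ofReal ‖ζ‖) h1 (Or.inr ENNReal.ofReal_ne_top))
    simpa using h4
  have hzero := le_antisymm (ge_of_tendsto' hlim hb) zero_le
  rw [eLpNorm_eq_zero_iff ?_ (by norm_num)] at hzero
  · filter_upwards [hzero] with ω hω
    exact sub_eq_zero.1 hω
  · exact ((by fun_prop : Continuous fun v : Vec d => inner ℝ ζ v).comp_aestronglyMeasurable
      hmeas).sub (Lp.aestronglyMeasurable _)

/-- Uniform partitions give the approximating sequence; the norm of the error is at most the sum of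
its coordinates, each of which obeys the isometry bound. -/
theorem isWienerIntegral_of_inner_ae_eq (hW : IsBrownian W P) {T τ α β : ℝ} (hα : 0 ≤ α)
    (hαβ : α ≤ β) (hβ : β ≤ T) {g : ℝ → Mat d} (hg : PW T τ g) {I : Ω → Vec d}
    (hmeas : AEStronglyMeasurable I P)
    (hI : ∀ j, (fun ω => I ω j) =ᵐ[P]
      J (segL2 α β fun r => (g r).adjoint (EuclideanSpace.single j 1))) :
    IsWienerIntegral P W g α β I := by
  refine ⟨hmeas, fun n => n + 1, uniformPartition α β,
    fun n i => g (uniformPartition α β n (i + 1)), fun n => ⟨monotone_uniformPartition hαβ n,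
      uniformPartition_zero α β n, uniformPartition_last α β n⟩, hg.tendsto_stepFun hα hαβ hβ, ?_⟩
  set F : ℕ → ℝ → Mat d := fun n => stepFun (n + 1) (uniformPartition α β n)
    (fun i => g (uniformPartition α β n (i + 1))) with hF
  set S : ℕ → Ω → Vec d := fun n => stepIntegral W (n + 1) (uniformPartition α β n)
    (fun i => g (uniformPartition α β n (i + 1))) with hS
  have hb : ∀ n, eLpNorm (fun ω => S n ω - I ω) 2 P
      ≤ ∑ _j : Fin d, eLpNorm (fun r => F n r - g r) 2 (volume.restrict (Ioc α β)) := by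
    intro n
    have hms : AEStronglyMeasurable (fun ω => S n ω - I ω) P :=
      (hW.measurable_stepIntegral _ _ _).aestronglyMeasurable.sub hmeas
    have h1 : eLpNorm (fun ω => S n ω - I ω) 2 P
        ≤ eLpNorm (∑ j : Fin d, fun ω => ‖(S n ω - I ω) j‖) 2 P := by
      refine eLpNorm_mono fun ω => ?_
      rw [Finset.sum_apply]
      refine le_trans ?_ (Real.le_norm_self _)
      conv_lhs => rw [← (EuclideanSpace.basisFun (Fin d) ℝ).sum_repr (S n ω - I ω)]
      refine (norm_sum_le _ _).trans (Finset.sum_le_sum fun j _ => ?_)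
      rw [norm_smul]
      simp
    have hmj : ∀ j : Fin d, AEStronglyMeasurable (fun ω => (S n ω - I ω) j) P := fun j =>
      (by fun_prop : Continuous fun v : Vec d => v j).comp_aestronglyMeasurable hms
    refine h1.trans ((eLpNorm_sum_le (fun j _ => (hmj j).norm) (by norm_num)).trans ?_)
    refine Finset.sum_le_sum fun j _ => ?_
    rw [eLpNorm_norm]
    have h2 := hJ.eLpNorm_inner_stepIntegral_sub_le (monotone_uniformPartition hαβ n)
      ((uniformPartition_zero α β n).symm ▸ hα) (fun i => g (uniformPartition α β n (i + 1)))
      (n + 1) (g := g) (by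
        rw [uniformPartition_zero, uniformPartition_last]
        exact hg.memLp hα hβ 2) (EuclideanSpace.single j 1)
    rw [uniformPartition_zero, uniformPartition_last] at h2
    simp only [PiLp.norm_single, norm_one, ENNReal.ofReal_one, one_mul] at h2
    refine le_trans (le_of_eq (eLpNorm_congr_ae ?_)) h2
    filter_upwards [hI j] with ω hω
    rw [← hω]
    simp [hS, EuclideanSpace.inner_single_left]
  refine tendsto_of_tendsto_of_tendsto_of_le_of_le tendsto_const_nhds ?_ (fun _ => zero_le) hb
  have h3 := tendsto_finsetSum (Finset.univ : Finset (Fin d)) fun _ _ =>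
    hg.tendsto_stepFun hα hαβ hβ
  simpa using h3

end IsWienerMap

/-! ### Moments, Gaussianity and independence of Wiener integrals -/

/-- The fourth moment of the standard Gaussian law. -/
def gaussFourth : ℝ≥0∞ := ∫⁻ x, ‖x‖ₑ ^ (4 : ℕ) ∂(gaussianReal 0 1)

theorem gaussFourth_ne_top : gaussFourth ≠ ⊤ := by
  have h := (memLp_id_gaussianReal (μ := 0) (v := 1) 4).2
  rw [eLpNorm_lt_top_iff_lintegral_rpow_enorm_lt_top (by norm_num) (by norm_num)] at h
  have e : ∀ x : ℝ, ‖id x‖ₑ ^ (((4 : ℝ≥0) : ℝ≥0∞).toReal) = ‖x‖ₑ ^ (4 : ℕ) := by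
    intro x
    rw [ENNReal.coe_toReal, show ((4 : ℝ≥0) : ℝ) = ((4 : ℕ) : ℝ) by norm_num, ENNReal.rpow_natCast]
    rfl
  simp_rw [e] at h
  exact h.ne

theorem lintegral_pow_four_gaussianReal (c : ℝ≥0) :
    ∫⁻ x, ‖x‖ₑ ^ (4 : ℕ) ∂(gaussianReal 0 (c ^ 2)) = gaussFourth * (c : ℝ≥0∞) ^ (4 : ℕ) := by
  have h := gaussianReal_map_const_mul (μ := 0) (v := 1) (c : ℝ)
  have e : NNReal.mk ((c : ℝ) ^ 2) (sq_nonneg _) * 1 = c ^ 2 := by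
    rw [mul_one]
    rfl
  rw [mul_zero, e] at h
  rw [← h, lintegral_map (by fun_prop) (by fun_prop), gaussFourth,
    ← lintegral_mul_const _ (by fun_prop)]
  refine lintegral_congr fun x => ?_
  rw [enorm_mul, mul_pow, mul_comm]
  simp

variable {d : ℕ} {Ω : Type*} {mΩ : MeasurableSpace Ω} {P : Measure Ω} {W : ℝ≥0 → Ω → Vec d}
  {J : L2 d →ₗᵢ[ℝ] Lp ℝ 2 P}

theorem covariance_congr_ae {X X' Y Y' : Ω → ℝ} (hX : X =ᵐ[P] X') (hY : Y =ᵐ[P] Y') :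
    covariance X Y P = covariance X' Y' P := by
  rw [covariance, covariance, integral_congr_ae hX, integral_congr_ae hY]
  refine integral_congr_ae ?_
  filter_upwards [hX, hY] with ω h1 h2
  rw [h1, h2]

theorem history_le (hW : IsBrownian W P) (r : ℝ) : history W r ≤ mΩ :=
  iSup₂_le fun u _ => (hW.measurable u).comap_le

namespace IsWienerMap

variable (hJ : IsWienerMap P W J)
include hJ

theorem integral_apply (h : L2 d) : ∫ ω, J h ω ∂P = 0 := by
  have h1 := integral_map (μ := P) (Lp.aestronglyMeasurable (J h)).aemeasurable (f := fun x => x)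
    (by fun_prop)
  rw [hJ.law, integral_id_gaussianReal] at h1
  exact h1.symm

theorem covariance_apply [IsProbabilityMeasure P] (h k : L2 d) :
    covariance (J h) (J k) P = inner ℝ h k := by
  rw [covariance_eq_sub (Lp.memLp _) (Lp.memLp _), hJ.integral_apply, zero_mul, sub_zero,
    ← J.inner_map_map, L2.inner_def]
  simp [mul_comm]

theorem lintegral_pow_four (h : L2 d) :
    ∫⁻ ω, ‖J h ω‖ₑ ^ (4 : ℕ) ∂P = gaussFourth * ‖h‖ₑ ^ (4 : ℕ) := by
  have h1 := lintegral_map' (μ := P) (g := J h) (f := fun x : ℝ => ‖x‖ₑ ^ (4 : ℕ))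
    (by fun_prop) (Lp.aestronglyMeasurable (J h)).aemeasurable
  rw [← h1, hJ.law, lintegral_pow_four_gaussianReal]
  rfl

/-- A linear combination of values of `J` is again a value of `J`, hence a real Gaussian variable.
-/
theorem isGaussianProcess [IsProbabilityMeasure P] :
    IsGaussianProcess (fun (h : L2 d) ω => J h ω) P := by
  classical
  refine ⟨fun I => ⟨isGaussian_of_map_eq_gaussianReal fun L => ?_⟩⟩
  have hm : AEMeasurable (fun ω => I.restrict fun h : L2 d => J h ω) P :=
    aemeasurable_pi_lambda _ fun h => (Lp.aestronglyMeasurable (J h)).aemeasurable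
  refine ⟨0, ‖∑ h : I, L (Pi.single h 1) • (h : L2 d)‖₊ ^ 2, ?_⟩
  rw [AEMeasurable.map_map_of_aemeasurable L.continuous.measurable.aemeasurable hm, ← hJ.law]
  refine Measure.map_congr ?_
  rw [map_sum]
  have h1 : ∀ᵐ ω ∂P, ∀ h : I, J (L (Pi.single h 1) • (h : L2 d)) ω
      = L (Pi.single h 1) * J (h : L2 d) ω := by
    rw [ae_all_iff]
    intro h
    rw [map_smul]
    filter_upwards [Lp.coeFn_smul (L (Pi.single h 1)) (J (h : L2 d))] with ω hω
    rw [hω, Pi.smul_apply, smul_eq_mul]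
  filter_upwards [h1, Lp.coeFn_finsetSum Finset.univ fun h : I =>
    J (L (Pi.single h 1) • (h : L2 d))] with ω h2 h3
  rw [h3, Finset.sum_apply, Finset.sum_congr rfl fun h _ => h2 h, Function.comp_apply]
  conv_lhs => rw [← Finset.univ_sum_single (I.restrict fun h : L2 d => J h ω), map_sum]
  refine Finset.sum_congr rfl fun h _ => ?_
  have h4 : (Pi.single h (I.restrict (fun h : L2 d => J h ω) h) : I → ℝ)
      = J (h : L2 d) ω • Pi.single h (1 : ℝ) := by
    rw [← Pi.single_smul, smul_eq_mul, mul_one]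
    rfl
  rw [h4, map_smul, smul_eq_mul, mul_comm]

/-- Integrals of functions which vanish up to time `r` are independent of the history up to `r`. -/
theorem indep_history [IsProbabilityMeasure P] {ι : Type*} (H : ι → L2 d)
    (r : ℝ) (hH : ∀ p : Fin d × ℝ≥0, (p.2 : ℝ) ≤ r → ∀ i, inner ℝ (stepL2 d p) (H i) = 0) :
    Indep (MeasurableSpace.comap (fun ω i => J (H i) ω) inferInstance) (history W r) P := by
  let X : {p : Fin d × ℝ≥0 // (p.2 : ℝ) ≤ r} → Ω → ℝ := fun p ω => W p.1.2 ω p.1.1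
  let Y : ι → Ω → ℝ := fun i => J (H i)
  have hg : IsGaussianProcess (Sum.elim X Y) P := by
    have h1 := hJ.isGaussianProcess.comp_right
      (Sum.elim (fun p : {p : Fin d × ℝ≥0 // (p.2 : ℝ) ≤ r} => stepL2 d p.1) H)
    refine h1.congr fun p => ?_
    rcases p with p | i
    · exact hJ.apply_step p.1
    · exact EventuallyEq.rfl
  have hX : ∀ p, AEMeasurable (X p) P := fun p => (hg.aemeasurable (Sum.inl p))
  have hY : ∀ i, AEMeasurable (Y i) P := fun i => (hg.aemeasurable (Sum.inr i))
  -- In a jointly Gaussian family, zero cross covariance is independence.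
  have hind : IndepFun (fun ω p => X p ω) (fun ω i => Y i ω) P := by
    refine hg.indepFun_of_covariance_eq_zero hX hY fun p i => ?_
    rw [← hH p.1 p.2 i, ← hJ.covariance_apply]
    exact covariance_congr_ae (hJ.apply_step p.1).symm EventuallyEq.rfl
  have hle : history W r ≤ MeasurableSpace.comap (fun ω p => X p ω) inferInstance := by
    refine iSup₂_le fun u hu => ?_
    rw [← measurable_iff_comap_le]
    have h1 : Measurable[MeasurableSpace.comap (fun ω p => X p ω) inferInstance]
        fun ω (i : Fin d) => W u ω i := by
      refine @measurable_pi_lambda _ _ _ (_) _ _ fun i => ?_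
      exact (measurable_pi_apply (⟨(i, u), hu⟩ : {p : Fin d × ℝ≥0 // (p.2 : ℝ) ≤ r})).comp
        (comap_measurable fun ω p => X p ω)
    exact (WithLp.measurable_toLp 2 (Fin d → ℝ)).comp h1
  exact (indep_of_indep_of_le_left hind hle).symm

/-- The scalar product with t is `J` of Σ tᵢHᵢ, with variance ⟨St, t⟩; this determines the
characteristic function. -/
theorem map_toLp [IsProbabilityMeasure P] {ι : Type*} [Fintype ι] [DecidableEq ι] (H : ι → L2 d)
    {S : Matrix ι ι ℝ} (hS : S.PosSemidef) (hSH : ∀ i j, S i j = inner ℝ (H i) (H j)) :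
    P.map (fun ω => WithLp.toLp 2 fun i => J (H i) ω) = multivariateGaussian 0 S := by
  have hm : AEMeasurable (fun ω => WithLp.toLp 2 fun i => J (H i) ω) P :=
    (WithLp.measurable_toLp 2 (ι → ℝ)).comp_aemeasurable
      (aemeasurable_pi_lambda _ fun i => (Lp.aestronglyMeasurable (J (H i))).aemeasurable)
  have : IsProbabilityMeasure (P.map (fun ω => WithLp.toLp 2 fun i => J (H i) ω)) :=
    Measure.isProbabilityMeasure_map hm
  refine Measure.ext_of_charFun (funext fun t => ?_)
  rw [charFun_multivariateGaussian hS]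
  have e : ∀ᵐ ω ∂P, inner ℝ (WithLp.toLp 2 fun i => J (H i) ω) t = J (∑ i, t i • H i) ω := by
    have h1 : ∀ᵐ ω ∂P, ∀ i, J (t i • H i) ω = t i * J (H i) ω := by
      rw [ae_all_iff]
      intro i
      rw [map_smul]
      filter_upwards [Lp.coeFn_smul (t i) (J (H i))] with ω hω
      rw [hω, Pi.smul_apply, smul_eq_mul]
    rw [map_sum]
    filter_upwards [h1, Lp.coeFn_finsetSum Finset.univ fun i => J (t i • H i)] with ω h2 h3
    rw [h3, Finset.sum_apply, Finset.sum_congr rfl fun i _ => h2 i, PiLp.inner_apply]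
    simp
  rw [charFun_apply, integral_map hm (by fun_prop)]
  have h1 := charFun_apply_real (μ := P.map (J (∑ i, t i • H i))) 1
  rw [integral_map (Lp.aestronglyMeasurable _).aemeasurable (by fun_prop), hJ.law,
    charFun_gaussianReal] at h1
  have h2 : ∫ ω, Complex.exp ((inner ℝ (WithLp.toLp 2 fun i => J (H i) ω) t : ℝ) * Complex.I) ∂P
      = ∫ ω, Complex.exp (((1 : ℝ) : ℂ) * (J (∑ i, t i • H i) ω) * Complex.I) ∂P := by
    refine integral_congr_ae ?_
    filter_upwards [e] with ω hω
    rw [hω]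
    simp
  rw [h2, ← h1]
  have h3 : ‖∑ i, t i • H i‖ ^ 2 = t.ofLp ⬝ᵥ S.mulVec t.ofLp := by
    rw [← real_inner_self_eq_norm_sq, sum_inner]
    simp only [inner_sum, real_inner_smul_left, real_inner_smul_right, dotProduct, Matrix.mulVec,
      hSH, Finset.mul_sum]
    refine Finset.sum_congr rfl fun i _ => Finset.sum_congr rfl fun j _ => by ring
  congr 1
  simp [← h3]

end IsWienerMap

/-! ### Kolmogorov's continuity criterion by dyadic interpolation -/

/-- The tent function of height `1/2` on `[0, 1]`. -/
def tent (v : ℝ) : ℝ := max 0 (min v (1 - v))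

theorem tent_nonneg (v : ℝ) : 0 ≤ tent v := le_max_left _ _

theorem tent_le_one (v : ℝ) : tent v ≤ 1 := by
  refine max_le zero_le_one ?_
  rcases le_total v 1 with h | h
  · exact (min_le_left _ _).trans h
  · exact (min_le_right _ _).trans (by linarith)

theorem tent_of_nonpos {v : ℝ} (h : v ≤ 0) : tent v = 0 :=
  max_eq_left ((min_le_left _ _).trans h)

theorem tent_of_one_le {v : ℝ} (h : 1 ≤ v) : tent v = 0 :=
  max_eq_left ((min_le_right _ _).trans (by linarith))

theorem tent_left {v : ℝ} (h0 : 0 ≤ v) (h1 : v ≤ 1 / 2) : tent v = v := by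
  rw [tent, min_eq_left (by linarith), max_eq_right h0]

theorem tent_right {v : ℝ} (h0 : 1 / 2 ≤ v) (h1 : v ≤ 1) : tent v = 1 - v := by
  rw [tent, min_eq_right (by linarith), max_eq_right (by linarith)]

theorem continuous_tent : Continuous tent := by
  unfold tent
  fun_prop

/-- The second difference of `f` on the dyadic interval of rank `j` and level `n`. -/
def dyadicCoeff (f : ℝ → ℝ) (n j : ℕ) : ℝ :=
  (f ((2 * j + 1) / 2 ^ (n + 1)) - f (j / 2 ^ n)) +
    (f ((2 * j + 1) / 2 ^ (n + 1)) - f ((j + 1) / 2 ^ n))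

/-- The correction between the piecewise linear interpolations of `f` at the levels `n` and
`n + 1`. -/
def dyadicTerm (f : ℝ → ℝ) (n : ℕ) (u : ℝ) : ℝ :=
  ∑ j ∈ Finset.range (2 ^ n), dyadicCoeff f n j * tent (2 ^ n * u - j)

theorem continuous_dyadicTerm (f : ℝ → ℝ) (n : ℕ) : Continuous (dyadicTerm f n) :=
  continuous_finsetSum _ fun _ _ => continuous_const.mul (continuous_tent.comp (by fun_prop))

theorem tent_sub_eq_zero {v : ℝ} (h0 : 0 ≤ v) (h1 : v ≤ 1) {i j : ℕ} (hij : i ≠ j) :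
    tent ((j : ℝ) + v - i) = 0 := by
  rcases lt_or_gt_of_ne hij with h | h
  · have : (i : ℝ) + 1 ≤ j := by exact_mod_cast h
    exact tent_of_one_le (by linarith)
  · have : (j : ℝ) + 1 ≤ i := by exact_mod_cast h
    exact tent_of_nonpos (by linarith)

theorem dyadicTerm_eq (f : ℝ → ℝ) {n j : ℕ} (hj : j < 2 ^ n) {v : ℝ} (h0 : 0 ≤ v) (h1 : v ≤ 1) :
    dyadicTerm f n ((j + v) / 2 ^ n) = dyadicCoeff f n j * tent v := by
  have e : (2 : ℝ) ^ n * ((j + v) / 2 ^ n) = j + v := by field_simp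
  rw [dyadicTerm, e, Finset.sum_eq_single j]
  · rw [add_sub_cancel_left]
  · intro i _ hij
    rw [tent_sub_eq_zero h0 h1 hij, mul_zero]
  · exact fun h => absurd (Finset.mem_range.2 hj) h

/-- At most one tent is nonzero at u, so the term is at most one coefficient c. Either c ≤ α =
(9/10)^n, or c ≤ α⁻³c⁴, with α⁻³ = (1000/729)^n; the fourth power is then bounded by the sum over
the level. This trades a supremum for moments that can be integrated. -/
theorem abs_dyadicTerm_le (f : ℝ → ℝ) (n : ℕ) (u : ℝ) :
    |dyadicTerm f n u| ≤ (9 / 10) ^ n +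
      (1000 / 729) ^ n * ∑ j ∈ Finset.range (2 ^ n), |dyadicCoeff f n j| ^ 4 := by
  have hS : 0 ≤ ∑ j ∈ Finset.range (2 ^ n), |dyadicCoeff f n j| ^ 4 :=
    Finset.sum_nonneg fun _ _ => by positivity
  have hb : ∀ c : ℝ, 0 ≤ c → c ≤ (9 / 10) ^ n + (1000 / 729) ^ n * c ^ 4 := by
    intro c hc
    rcases le_total c ((9 / 10) ^ n) with h | h
    · exact h.trans (le_add_of_nonneg_right (by positivity))
    · have h1 : c = (1000 / 729) ^ n * (((9 / 10) ^ n) ^ 3 * c) := by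
        rw [← mul_assoc, ← pow_mul, mul_comm n 3, pow_mul, ← mul_pow]
        norm_num
      have h2 : ((9 / 10) ^ n) ^ 3 * c ≤ c ^ 3 * c := by gcongr
      calc c = (1000 / 729) ^ n * (((9 / 10) ^ n) ^ 3 * c) := h1
        _ ≤ (1000 / 729) ^ n * (c ^ 3 * c) := by gcongr
        _ = (1000 / 729) ^ n * c ^ 4 := by ring
        _ ≤ _ := le_add_of_nonneg_left (by positivity)
  by_cases hu : ∃ j ∈ Finset.range (2 ^ n), tent (2 ^ n * u - j) ≠ 0
  · obtain ⟨j, hj, hne⟩ := hu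
    have h0 : 0 < 2 ^ n * u - j := not_le.1 fun h => hne (tent_of_nonpos h)
    have h1 : 2 ^ n * u - j < 1 := not_le.1 fun h => hne (tent_of_one_le h)
    have e : u = (j + (2 ^ n * u - j)) / 2 ^ n := by field_simp; ring
    rw [e, dyadicTerm_eq f (Finset.mem_range.1 hj) h0.le h1.le, abs_mul, abs_of_nonneg (tent_nonneg _)]
    refine (mul_le_of_le_one_right (abs_nonneg _) (tent_le_one _)).trans ((hb _ (abs_nonneg _)).trans ?_)
    gcongr
    exact Finset.single_le_sum (f := fun j => |dyadicCoeff f n j| ^ 4)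
      (fun _ _ => by positivity) hj
  · push Not at hu
    rw [dyadicTerm, Finset.sum_eq_zero fun j hj => by rw [hu j hj, mul_zero], abs_zero]
    positivity

/-- From level n to n + 1 the old nodes are kept and the midpoint moves by half the second
difference, the tent having height 1/2. The even and odd intervals of level n + 1 are the two
halves. -/
theorem interpolation_eq (f : ℝ → ℝ) (n : ℕ) : ∀ j : ℕ, j < 2 ^ n → ∀ w : ℝ, 0 ≤ w → w ≤ 1 →
    f 0 + (f 1 - f 0) * ((j + w) / 2 ^ n) + ∑ k ∈ Finset.range n, dyadicTerm f k ((j + w) / 2 ^ n)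
      = (1 - w) * f (j / 2 ^ n) + w * f ((j + 1) / 2 ^ n) := by
  induction n with
  | zero =>
    intro j hj w h0 h1
    obtain rfl : j = 0 := by simpa using hj
    simp
    ring
  | succ n ih =>
    intro i hi w h0 h1
    rw [Finset.sum_range_succ, ← add_assoc]
    rcases Nat.even_or_odd' i with ⟨j, rfl | rfl⟩
    · have hj : j < 2 ^ n := by rw [pow_succ] at hi; omega
      have e1 : (((2 * j : ℕ) : ℝ) + w) / 2 ^ (n + 1) = (j + w / 2) / 2 ^ n := by
        push_cast
        rw [pow_succ]
        field_simp
      have e2 : ((2 * j : ℕ) : ℝ) / 2 ^ (n + 1) = j / 2 ^ n := by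
        push_cast
        rw [pow_succ]
        field_simp
      have e3 : (((2 * j : ℕ) : ℝ) + 1) / 2 ^ (n + 1) = (2 * j + 1) / 2 ^ (n + 1) := by
        push_cast
        rfl
      rw [e1, ih j hj (w / 2) (by linarith) (by linarith),
        dyadicTerm_eq f hj (by linarith) (by linarith), tent_left (by linarith) (by linarith), e2, e3,
        dyadicCoeff]
      ring
    · have hj : j < 2 ^ n := by rw [pow_succ] at hi; omega
      have e1 : (((2 * j + 1 : ℕ) : ℝ) + w) / 2 ^ (n + 1) = (j + (1 + w) / 2) / 2 ^ n := by
        push_cast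
        rw [pow_succ]
        field_simp
        ring
      have e2 : ((2 * j + 1 : ℕ) : ℝ) / 2 ^ (n + 1) = (2 * j + 1) / 2 ^ (n + 1) := by
        push_cast
        rfl
      have e3 : (((2 * j + 1 : ℕ) : ℝ) + 1) / 2 ^ (n + 1) = (j + 1) / 2 ^ n := by
        push_cast
        rw [pow_succ]
        field_simp
        ring
      rw [e1, ih j hj ((1 + w) / 2) (by linarith) (by linarith),
        dyadicTerm_eq f hj (by linarith) (by linarith), tent_right (by linarith) (by linarith), e2, e3,
        dyadicCoeff]
      ring

/-- Dyadic points of level n become integers after multiplication by 2^k, where all tents vanish. So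
at a dyadic point the series is a finite sum. -/
theorem dyadicTerm_dyadic (f : ℝ → ℝ) {n k : ℕ} (hnk : n ≤ k) (j : ℕ) :
    dyadicTerm f k (j / 2 ^ n) = 0 := by
  refine Finset.sum_eq_zero fun i _ => ?_
  have e : (2 : ℝ) ^ k * (j / 2 ^ n) - i = ((j * 2 ^ (k - n) : ℕ) : ℝ) + 0 - i := by
    obtain ⟨m, rfl⟩ := Nat.exists_eq_add_of_le hnk
    rw [Nat.add_sub_cancel_left, pow_add]
    push_cast
    field_simp
    ring
  rw [e]
  by_cases h : i = j * 2 ^ (k - n)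
  · rw [h, add_zero, sub_self, tent_of_nonpos le_rfl, mul_zero]
  · rw [tent_sub_eq_zero le_rfl zero_le_one h, mul_zero]

/-- The limit of the dyadic interpolations of `f`. -/
def dyadicLimit (f : ℝ → ℝ) (u : ℝ) : ℝ := f 0 + (f 1 - f 0) * u + ∑' n, dyadicTerm f n u

theorem dyadicLimit_dyadic (f : ℝ → ℝ) {n j : ℕ} (hj : j < 2 ^ n) :
    dyadicLimit f (j / 2 ^ n) = f (j / 2 ^ n) := by
  have h := interpolation_eq f n j hj 0 le_rfl zero_le_one
  simp only [add_zero, sub_zero, one_mul, zero_mul] at h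
  rw [dyadicLimit, tsum_eq_sum (s := Finset.range n) fun k hk =>
    dyadicTerm_dyadic f (not_lt.1 fun h => hk (Finset.mem_range.2 h)) j, h]

theorem continuous_dyadicLimit {f : ℝ → ℝ} (hf : Summable fun n : ℕ => (1000 / 729 : ℝ) ^ n *
    ∑ j ∈ Finset.range (2 ^ n), |dyadicCoeff f n j| ^ 4) : Continuous (dyadicLimit f) := by
  refine (by fun_prop : Continuous fun u => f 0 + (f 1 - f 0) * u).add ?_
  refine continuous_tsum (continuous_dyadicTerm f)
    ((summable_geometric_of_lt_one (r := (9 / 10 : ℝ)) (by norm_num) (by norm_num)).add hf)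
    fun n u => abs_dyadicTerm_le f n u

variable {Ω : Type*} {mΩ : MeasurableSpace Ω} {P : Measure Ω}

theorem ae_tsum_ne_top {f : ℕ → Ω → ℝ≥0∞} (hf : ∀ n, AEMeasurable (f n) P)
    (h : ∑' n, ∫⁻ ω, f n ω ∂P ≠ ⊤) : ∀ᵐ ω ∂P, ∑' n, f n ω ≠ ⊤ := by
  rw [← lintegral_tsum hf] at h
  filter_upwards [ae_lt_top' (AEMeasurable.tsum hf) h] with ω hω using hω.ne

theorem enorm_add_pow_four_le (x y : ℝ) :
    ‖x + y‖ₑ ^ (4 : ℕ) ≤ 8 * (‖x‖ₑ ^ (4 : ℕ) + ‖y‖ₑ ^ (4 : ℕ)) := by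
  have h : |x + y| ^ 4 ≤ 8 * (|x| ^ 4 + |y| ^ 4) := by
    have h1 : ∀ z : ℝ, |z| ^ 4 = z ^ 4 := fun z => by
      rw [show 4 = 2 * 2 from rfl, pow_mul, pow_mul, sq_abs]
    rw [h1, h1, h1]
    nlinarith [sq_nonneg (x ^ 2 - y ^ 2), sq_nonneg (x - y), sq_nonneg (x + y),
      mul_nonneg (sq_nonneg (x - y)) (sq_nonneg (x + y)),
      mul_nonneg (sq_nonneg (x - y)) (add_nonneg (sq_nonneg x) (sq_nonneg y)),
      sq_nonneg ((x - y) ^ 2)]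
  have h2 : ∀ z : ℝ, ‖z‖ₑ ^ (4 : ℕ) = ENNReal.ofReal (|z| ^ 4) := fun z => by
    rw [ENNReal.ofReal_pow (abs_nonneg z), ← Real.norm_eq_abs, ofReal_norm]
  rw [h2, h2, h2, ← ENNReal.ofReal_add (by positivity) (by positivity),
    show (8 : ℝ≥0∞) = ENNReal.ofReal 8 by norm_num, ← ENNReal.ofReal_mul (by norm_num)]
  exact ENNReal.ofReal_le_ofReal h

/-- Kolmogorov's continuity criterion, with fourth moments, on `[0, 1]`. -/
theorem exists_continuous_modification {M : ℝ → Ω → ℝ} {K : ℝ≥0∞} (hK : K ≠ ⊤)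
    (hM : ∀ u ∈ Icc (0 : ℝ) 1, AEStronglyMeasurable (M u) P)
    (h : ∀ u ∈ Icc (0 : ℝ) 1, ∀ v ∈ Icc (0 : ℝ) 1,
      ∫⁻ ω, ‖M u ω - M v ω‖ₑ ^ (4 : ℕ) ∂P ≤ K * ENNReal.ofReal (|u - v| ^ 2)) :
    ∃ N : ℝ → Ω → ℝ, (∀ ω, Continuous fun u => N u ω) ∧ ∀ u ∈ Icc (0 : ℝ) 1, N u =ᵐ[P] M u := by
  classical
  set f : Ω → ℝ → ℝ := fun ω u => M u ω with hf
  set good : Ω → Prop := fun ω => Summable fun n : ℕ => (1000 / 729 : ℝ) ^ n *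
    ∑ j ∈ Finset.range (2 ^ n), |dyadicCoeff (f ω) n j| ^ 4 with hgood
  have hmemd : ∀ n j : ℕ, j ≤ 2 ^ n → (j : ℝ) / 2 ^ n ∈ Icc (0 : ℝ) 1 := by
    intro n j hj
    refine ⟨by positivity, (div_le_one (by positivity)).2 (by exact_mod_cast hj)⟩
  have hmem : ∀ n, ∀ j ∈ Finset.range (2 ^ n), (j : ℝ) / 2 ^ n ∈ Icc (0 : ℝ) 1 ∧
      ((j : ℝ) + 1) / 2 ^ n ∈ Icc (0 : ℝ) 1 ∧ (2 * (j : ℝ) + 1) / 2 ^ (n + 1) ∈ Icc (0 : ℝ) 1 := by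
    intro n j hj
    have hj := Finset.mem_range.1 hj
    refine ⟨hmemd n j hj.le, ?_, ?_⟩
    · exact_mod_cast hmemd n (j + 1) hj
    · have := hmemd (n + 1) (2 * j + 1) (by rw [pow_succ]; omega)
      exact_mod_cast this
  have hcm : ∀ n, ∀ j ∈ Finset.range (2 ^ n),
      AEStronglyMeasurable (fun ω => dyadicCoeff (f ω) n j) P := by
    intro n j hj
    obtain ⟨h1, h2, h3⟩ := hmem n j hj
    exact ((hM _ h3).sub (hM _ h1)).add ((hM _ h3).sub (hM _ h2))
  -- The coefficient is a sum of two increments of length 2^{-(n+1)}, each contributing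
  -- K·4^{-(n+1)}; the inequality |x+y|⁴ ≤ 8(|x|⁴+|y|⁴) gives 8·2 = 16.
  have hc4 : ∀ n, ∀ j ∈ Finset.range (2 ^ n),
      ∫⁻ ω, ‖dyadicCoeff (f ω) n j‖ₑ ^ (4 : ℕ) ∂P
        ≤ 16 * K * ENNReal.ofReal ((1 / 4) ^ (n + 1)) := by
    intro n j hj
    obtain ⟨h1, h2, h3⟩ := hmem n j hj
    have e : ((1 : ℝ) / 4) ^ (n + 1) = (1 / 2 ^ (n + 1)) ^ 2 := by
      rw [div_pow, one_pow, div_pow, one_pow, ← pow_mul, mul_comm, pow_mul]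
      norm_num
    have e1 : |(2 * (j : ℝ) + 1) / 2 ^ (n + 1) - j / 2 ^ n| = 1 / 2 ^ (n + 1) := by
      rw [show (2 * (j : ℝ) + 1) / 2 ^ (n + 1) - j / 2 ^ n = 1 / 2 ^ (n + 1) by
        rw [pow_succ]; field_simp; ring]
      exact abs_of_nonneg (by positivity)
    have e2 : |(2 * (j : ℝ) + 1) / 2 ^ (n + 1) - (j + 1) / 2 ^ n| = 1 / 2 ^ (n + 1) := by
      rw [show (2 * (j : ℝ) + 1) / 2 ^ (n + 1) - (j + 1) / 2 ^ n = -(1 / 2 ^ (n + 1)) by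
        rw [pow_succ]; field_simp; ring, abs_neg]
      exact abs_of_nonneg (by positivity)
    have b1 := h _ h3 _ h1
    have b2 := h _ h3 _ h2
    rw [e1, ← e] at b1
    rw [e2, ← e] at b2
    calc ∫⁻ ω, ‖dyadicCoeff (f ω) n j‖ₑ ^ (4 : ℕ) ∂P
        ≤ ∫⁻ ω, 8 * (‖M ((2 * j + 1) / 2 ^ (n + 1)) ω - M (j / 2 ^ n) ω‖ₑ ^ (4 : ℕ)
          + ‖M ((2 * j + 1) / 2 ^ (n + 1)) ω - M ((j + 1) / 2 ^ n) ω‖ₑ ^ (4 : ℕ)) ∂P :=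
          lintegral_mono fun ω => enorm_add_pow_four_le _ _
      _ = 8 * (∫⁻ ω, ‖M ((2 * j + 1) / 2 ^ (n + 1)) ω - M (j / 2 ^ n) ω‖ₑ ^ (4 : ℕ) ∂P
          + ∫⁻ ω, ‖M ((2 * j + 1) / 2 ^ (n + 1)) ω - M ((j + 1) / 2 ^ n) ω‖ₑ ^ (4 : ℕ) ∂P) := by
          rw [lintegral_const_mul' _ _ (by norm_num),
            lintegral_add_left' (f := fun ω =>
              ‖M ((2 * j + 1) / 2 ^ (n + 1)) ω - M (j / 2 ^ n) ω‖ₑ ^ (4 : ℕ))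
              (((hM _ h3).sub (hM _ h1)).enorm.pow_const _)]
      _ ≤ 8 * (K * ENNReal.ofReal ((1 / 4) ^ (n + 1)) + K * ENNReal.ofReal ((1 / 4) ^ (n + 1))) := by
          gcongr
      _ = 16 * K * ENNReal.ofReal ((1 / 4) ^ (n + 1)) := by ring
  have hae : ∀ᵐ ω ∂P, good ω := by
    have hm : ∀ n, AEMeasurable (fun ω => ENNReal.ofReal ((1000 / 729) ^ n) *
        ∑ j ∈ Finset.range (2 ^ n), ‖dyadicCoeff (f ω) n j‖ₑ ^ (4 : ℕ)) P := fun n =>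
      (Finset.aemeasurable_fun_sum _ fun j hj => (hcm n j hj).enorm.pow_const _).const_mul _
    have hfin : ∑' n, ∫⁻ ω, ENNReal.ofReal ((1000 / 729) ^ n) *
        ∑ j ∈ Finset.range (2 ^ n), ‖dyadicCoeff (f ω) n j‖ₑ ^ (4 : ℕ) ∂P ≠ ⊤ := by
      -- The weight (1000/729)^n, the 2^n intervals and the moment 4^{-n} multiply to (500/729)^n,
      -- which is summable.
      have hb : ∀ n, ∫⁻ ω, ENNReal.ofReal ((1000 / 729) ^ n) *
          ∑ j ∈ Finset.range (2 ^ n), ‖dyadicCoeff (f ω) n j‖ₑ ^ (4 : ℕ) ∂P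
            ≤ 4 * K * ENNReal.ofReal (500 / 729) ^ n := by
        intro n
        rw [lintegral_const_mul' _ _ ENNReal.ofReal_ne_top,
          lintegral_finsetSum' _ fun j hj => (hcm n j hj).enorm.pow_const _]
        calc _ ≤ ENNReal.ofReal ((1000 / 729) ^ n) *
              ∑ _j ∈ Finset.range (2 ^ n), 16 * K * ENNReal.ofReal ((1 / 4) ^ (n + 1)) := by
              gcongr with j hj
              exact hc4 n j hj
          _ = 4 * K * ENNReal.ofReal (500 / 729) ^ n := by
              rw [Finset.sum_const, Finset.card_range, nsmul_eq_mul,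
                show (16 : ℝ≥0∞) = 4 * ENNReal.ofReal 4 by
                  rw [show ENNReal.ofReal 4 = 4 by norm_num]; norm_num,
                show ((2 ^ n : ℕ) : ℝ≥0∞) = ENNReal.ofReal (2 ^ n) by
                  rw [ENNReal.ofReal_pow (by norm_num)]; norm_num]
              have e : (500 / 729 : ℝ) ^ n = (1000 / 729) ^ n * (2 ^ n * (4 * (1 / 4) ^ (n + 1))) := by
                rw [pow_succ, show 4 * ((1 / 4 : ℝ) ^ n * (1 / 4)) = (1 / 4) ^ n by ring, ← mul_pow,
                  ← mul_pow]
                norm_num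
              rw [← ENNReal.ofReal_pow (by norm_num), e, ENNReal.ofReal_mul (by positivity),
                ENNReal.ofReal_mul (by positivity), ENNReal.ofReal_mul (by norm_num)]
              ring
      refine ne_top_of_le_ne_top ?_ (ENNReal.tsum_le_tsum hb)
      rw [ENNReal.tsum_mul_left, ENNReal.tsum_geometric]
      refine ENNReal.mul_ne_top (ENNReal.mul_ne_top (by norm_num) hK) (ENNReal.inv_ne_top.2 ?_)
      rw [← ENNReal.ofReal_one, ← ENNReal.ofReal_sub _ (by norm_num)]
      simp only [ne_eq, ENNReal.ofReal_eq_zero]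
      norm_num
    filter_upwards [ae_tsum_ne_top hm hfin] with ω hω
    have h1 := ENNReal.summable_toReal hω
    refine h1.congr fun n => ?_
    rw [ENNReal.toReal_mul, ENNReal.toReal_ofReal (by positivity), ENNReal.toReal_sum fun j _ => by simp]
    simp
  refine ⟨fun u ω => if good ω then dyadicLimit (f ω) u else 0, fun ω => ?_, fun u hu => ?_⟩
  · by_cases hω : good ω
    · simpa only [hω, if_true] using continuous_dyadicLimit hω
    · simpa only [hω, if_false] using continuous_const
  -- At u = 1 the floor would be 2^n, which is not the index of an interval; there all tents vanish
  -- and the limit is f 1 directly.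
  rcases eq_or_lt_of_le hu.2 with rfl | hu1
  · filter_upwards [hae] with ω hω
    rw [if_pos hω, dyadicLimit, tsum_congr (g := fun _ => 0) fun n => ?_]
    · simp [hf]
    · have := dyadicTerm_dyadic (f ω) (n := 0) (k := n) n.zero_le 1
      simpa using this
  set v : ℕ → ℝ := fun n => (⌊2 ^ n * u⌋₊ : ℝ) / 2 ^ n with hv
  have hlt : ∀ n, ⌊2 ^ n * u⌋₊ < 2 ^ n := fun n => by
    rw [Nat.floor_lt (by have := hu.1; positivity)]
    push_cast
    exact mul_lt_of_lt_one_right (by positivity) hu1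
  have hvmem : ∀ n, v n ∈ Icc (0 : ℝ) 1 := fun n => hmemd n _ (hlt n).le
  have hdist : ∀ n, |v n - u| ≤ (1 / 2) ^ n := by
    intro n
    have h1 := Nat.floor_le (a := 2 ^ n * u) (by have := hu.1; positivity)
    have h2 := Nat.lt_floor_add_one (2 ^ n * u)
    have e : v n - u = -((2 ^ n * u - ⌊2 ^ n * u⌋₊) / 2 ^ n) := by
      simp only [hv]
      field_simp
      ring
    rw [e, abs_neg, abs_of_nonneg (div_nonneg (by linarith) (by positivity)), div_pow, one_pow]
    gcongr
    linarith
  have hvlim : Tendsto v atTop (𝓝 u) := by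
    rw [tendsto_iff_norm_sub_tendsto_zero]
    exact squeeze_zero (fun _ => norm_nonneg _) hdist
      (tendsto_pow_atTop_nhds_zero_of_lt_one (by norm_num) (by norm_num))
  -- The fourth moments of M(v n) - M u are summable, so M(v n) → M u almost surely. The continuous
  -- process agrees with M at the dyadic points v n, hence almost surely at u.
  have hfin : ∑' n, ∫⁻ ω, ‖M (v n) ω - M u ω‖ₑ ^ (4 : ℕ) ∂P ≠ ⊤ := by
    have hb : ∀ n, ∫⁻ ω, ‖M (v n) ω - M u ω‖ₑ ^ (4 : ℕ) ∂P ≤ K * ENNReal.ofReal (1 / 4) ^ n := by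
      intro n
      refine (h _ (hvmem n) _ hu).trans ?_
      rw [← ENNReal.ofReal_pow (by norm_num)]
      gcongr
      calc |v n - u| ^ 2 ≤ ((1 / 2) ^ n) ^ 2 := by gcongr; exact hdist n
        _ = (1 / 4) ^ n := by rw [← pow_mul, mul_comm, pow_mul]; norm_num
    refine ne_top_of_le_ne_top ?_ (ENNReal.tsum_le_tsum hb)
    rw [ENNReal.tsum_mul_left, ENNReal.tsum_geometric]
    refine ENNReal.mul_ne_top hK (ENNReal.inv_ne_top.2 ?_)
    rw [← ENNReal.ofReal_one, ← ENNReal.ofReal_sub _ (by norm_num)]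
    simp only [ne_eq, ENNReal.ofReal_eq_zero]
    norm_num
  filter_upwards [hae, ae_tsum_ne_top
    (fun n => ((hM _ (hvmem n)).sub (hM u hu)).enorm.pow_const 4) hfin] with ω hω hω'
  rw [if_pos hω]
  have h1 : Tendsto (fun n => dyadicLimit (f ω) (v n)) atTop (𝓝 (dyadicLimit (f ω) u)) :=
    ((continuous_dyadicLimit hω).tendsto u).comp hvlim
  have h2 : Tendsto (fun n => M (v n) ω) atTop (𝓝 (M u ω)) := by
    have h3 := ENNReal.tendsto_atTop_zero_of_tsum_ne_top hω'
    have h4 : Tendsto (fun n => ‖M (v n) ω - M u ω‖ₑ) atTop (𝓝 0) := by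
      have h5 := ((ENNReal.continuous_rpow_const (y := (1 / 4 : ℝ))).tendsto 0).comp h3
      rw [ENNReal.zero_rpow_of_pos (by norm_num)] at h5
      refine h5.congr fun n => ?_
      simp only [Function.comp_apply, Pi.sub_apply]
      rw [← ENNReal.rpow_natCast, ← ENNReal.rpow_mul]
      norm_num
    rw [tendsto_iff_norm_sub_tendsto_zero]
    have h6 := (ENNReal.tendsto_toReal ENNReal.zero_ne_top).comp h4
    simpa [Function.comp_def] using h6
  refine tendsto_nhds_unique h1 (h2.congr fun n => ?_)
  exact (dyadicLimit_dyadic (f ω) (hlt n)).symm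

/-! ### Continuous and adapted versions of Wiener integrals -/

theorem norm_segL2_le {d : ℕ} {a b B : ℝ} (ha : 0 ≤ a) (hab : a ≤ b) (hB : 0 ≤ B) {k : ℝ → Vec d}
    (hk : MemLp k 2 (volume.restrict (Ioc a b))) (hkB : ∀ r ∈ Ioc a b, ‖k r‖ ≤ B) :
    ‖segL2 a b k‖ ≤ B * √(b - a) := by
  refine abs_le_of_sq_le_sq' ?_ (by positivity) |>.2
  rw [← real_inner_self_eq_norm_sq, inner_segL2 ha hab hk hk, mul_pow, Real.sq_sqrt (by linarith)]
  refine (Real.le_norm_self _).trans ?_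
  have := intervalIntegral.norm_integral_le_of_norm_le_const (a := a) (b := b) (C := B ^ 2)
    (f := fun r => inner ℝ (k r) (k r)) fun r hr => by
      rw [uIoc_of_le hab] at hr
      rw [real_inner_self_eq_norm_sq, norm_pow, norm_norm]
      exact pow_le_pow_left₀ (norm_nonneg _) (hkB r hr) 2
  rwa [abs_of_nonneg (sub_nonneg.2 hab)] at this

variable {d : ℕ} {Ω : Type*} {mΩ : MeasurableSpace Ω} {P : Measure Ω} {W : ℝ≥0 → Ω → Vec d}
  {J : L2 d →ₗᵢ[ℝ] Lp ℝ 2 P}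

namespace IsWienerMap

variable (hJ : IsWienerMap P W J)
include hJ

/-- Increments are Gaussian with standard deviation at most B√|b-a|, so their fourth moments are
O(|b-a|²), which is Kolmogorov's condition after rescaling [t, T] to [0, 1]. -/
theorem exists_continuous_version {T τ t : ℝ} (ht : t ∈ Icc 0 T) {k : ℝ → Vec d}
    (hk : PW T τ k) : ∃ N : ℝ → Ω → ℝ, (∀ ω, Continuous fun s => N s ω) ∧
      ∀ s ∈ Icc t T, N s =ᵐ[P] J (segL2 t s k) := by
  obtain ⟨B, hB, hkB⟩ := hk.exists_bound
  have hdiff : ∀ a ∈ Icc t T, ∀ b ∈ Icc t T, a ≤ b →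
      ‖segL2 t b k - segL2 t a k‖ ≤ B * √|b - a| := by
    intro a ha b hb hab
    rw [segL2_split ha.1 hab (hk.memLp ht.1 hb.2 2), add_sub_cancel_left,
      abs_of_nonneg (sub_nonneg.2 hab)]
    exact norm_segL2_le (ht.1.trans ha.1) hab hB (hk.memLp (ht.1.trans ha.1) hb.2 2) fun r hr =>
      hkB r ⟨(ht.1.trans ha.1).trans hr.1.le, hr.2.trans hb.2⟩
  have hdiff' : ∀ a ∈ Icc t T, ∀ b ∈ Icc t T,
      ‖segL2 t b k - segL2 t a k‖ ≤ B * √|b - a| := by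
    intro a ha b hb
    rcases le_total a b with h | h
    · exact hdiff a ha b hb h
    · rw [norm_sub_rev, abs_sub_comm]
      exact hdiff b hb a ha h
  set φ : ℝ → ℝ := fun u => t + (T - t) * u with hφ
  have hφm : ∀ u ∈ Icc (0 : ℝ) 1, φ u ∈ Icc t T := by
    intro u hu
    have h1 : 0 ≤ T - t := sub_nonneg.2 ht.2
    refine ⟨le_add_of_nonneg_right (mul_nonneg h1 hu.1), ?_⟩
    have := mul_le_mul_of_nonneg_left hu.2 h1
    simp only [hφ]
    linarith
  obtain ⟨N, hN, hNM⟩ := exists_continuous_modification (P := P)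
    (M := fun u => J (segL2 t (φ u) k)) (K := gaussFourth * ENNReal.ofReal (B ^ 4 * (T - t) ^ 2))
    (ENNReal.mul_ne_top gaussFourth_ne_top ENNReal.ofReal_ne_top)
    (fun u _ => Lp.aestronglyMeasurable _) fun u hu v hv => by
      have e : ∫⁻ ω, ‖J (segL2 t (φ u) k) ω - J (segL2 t (φ v) k) ω‖ₑ ^ (4 : ℕ) ∂P
          = ∫⁻ ω, ‖J (segL2 t (φ u) k - segL2 t (φ v) k) ω‖ₑ ^ (4 : ℕ) ∂P := by
        refine lintegral_congr_ae ?_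
        rw [map_sub]
        filter_upwards [Lp.coeFn_sub (J (segL2 t (φ u) k)) (J (segL2 t (φ v) k))] with ω hω
        rw [hω, Pi.sub_apply]
      rw [e, hJ.lintegral_pow_four, mul_assoc, ← ENNReal.ofReal_mul (by positivity),
        ← ofReal_norm, ← ENNReal.ofReal_pow (norm_nonneg _)]
      gcongr
      have h1 := hdiff' _ (hφm v hv) _ (hφm u hu)
      have e2 : φ u - φ v = (T - t) * (u - v) := by simp only [hφ]; ring
      calc ‖segL2 t (φ u) k - segL2 t (φ v) k‖ ^ 4 ≤ (B * √|φ u - φ v|) ^ 4 := by gcongr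
        _ = B ^ 4 * ((√|φ u - φ v|) ^ 2) ^ 2 := by ring
        _ = B ^ 4 * (T - t) ^ 2 * |u - v| ^ 2 := by
          rw [Real.sq_sqrt (abs_nonneg _), e2, abs_mul, mul_pow, sq_abs (T - t)]
          ring
  refine ⟨fun s => N ((s - t) / (T - t)), fun ω => (hN ω).comp (by fun_prop), fun s hs => ?_⟩
  have h1 : (s - t) / (T - t) ∈ Icc (0 : ℝ) 1 :=
    ⟨div_nonneg (by linarith [hs.1]) (by linarith [hs.1, hs.2]),
      div_le_one_of_le₀ (by linarith [hs.2]) (by linarith [hs.1, hs.2])⟩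
  -- When t = T the quotient is 0 by convention, and φ 0 = t = s.
  have h2 : φ ((s - t) / (T - t)) = s := by
    rcases eq_or_lt_of_le ht.2 with h | h
    · have : s = t := le_antisymm (h ▸ hs.2) hs.1
      simp [hφ, this]
    · simp only [hφ]
      have : T - t ≠ 0 := by linarith
      field_simp
      ring
  have h3 := hNM _ h1
  rwa [h2] at h3

/-- The integral over `(t, s]` is measurable for the completed history up to time `s`. -/
theorem aestronglyMeasurable_history (hW : IsBrownian W P) {t s : ℝ} (ht : 0 ≤ t) {k : ℝ → Vec d}
    (hk : MemLp k 2 (volume.restrict (Ioc t s))) :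
    AEStronglyMeasurable[history W s] (J (segL2 t s k)) P := by
  set S : Set (L2 d) := stepL2 d '' {p | (p.2 : ℝ) ≤ s}
  set K : Submodule ℝ (L2 d) := (Submodule.span ℝ S).topologicalClosure with hKdef
  -- By double orthogonality: a function orthogonal to all steps ending by time s vanishes almost
  -- everywhere on (0, s].
  have hmem : segL2 t s k ∈ K := by
    rw [hKdef, ← Submodule.orthogonal_orthogonal_eq_closure, Submodule.mem_orthogonal']
    intro f hf
    rw [inner_segL2_left ht hk]
    have hzero : (Ioc 0 s).indicator f =ᵐ[volume.restrict (Ioi (0 : ℝ))] 0 := by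
      refine ae_eq_zero_of_setIntegral_Ioc ((Lp.memLp f).indicator measurableSet_Ioc) fun u hu => ?_
      rw [setIntegral_indicator measurableSet_Ioc, Ioc_inter_Ioc, max_self]
      rcases le_total s 0 with h0 | h0
      · rw [Ioc_eq_empty (by simp [h0])]
        simp
      refine ext_inner_left ℝ fun c => ?_
      rw [inner_zero_right, ← (EuclideanSpace.basisFun (Fin d) ℝ).sum_repr c, sum_inner]
      refine Finset.sum_eq_zero fun i _ => ?_
      have h1 := (Submodule.mem_orthogonal _ _).1 hf (stepL2 d (i, ⟨min u s, le_min hu h0⟩))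
        (Submodule.subset_span ⟨_, min_le_right u s, rfl⟩)
      rw [stepL2, L2.inner_indicatorConstLp_eq_inner_setIntegral] at h1
      rw [real_inner_smul_left]
      simp only [EuclideanSpace.basisFun_apply]
      exact mul_eq_zero_of_right _ h1
    have hsub : Ioc t s ⊆ Ioi 0 := fun r hr => ht.trans_lt hr.1
    refine integral_eq_zero_of_ae ?_
    filter_upwards [ae_restrict_of_ae_restrict_of_subset hsub hzero,
      ae_restrict_mem measurableSet_Ioc] with r hr hr'
    rw [indicator_of_mem (show r ∈ Ioc 0 s from ⟨ht.trans_lt hr'.1, hr'.2⟩)] at hr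
    rw [hr]
    simp
  -- Classes measurable for the completed history form a closed subspace, so containing the images
  -- of the steps is enough.
  have hle : K ≤ (lpMeas ℝ ℝ (history W s) 2 P).comap J.toLinearMap := by
    refine Submodule.topologicalClosure_minimal _ (Submodule.span_le.2 ?_) ?_
    · rintro _ ⟨p, hp, rfl⟩
      change J (stepL2 d p) ∈ lpMeas ℝ ℝ (history W s) 2 P
      rw [mem_lpMeas_iff_aestronglyMeasurable]
      have h1 : Measurable[history W s] (W p.2) := by
        rw [measurable_iff_comap_le]
        exact le_iSup₂_of_le p.2 hp le_rfl
      have h2 : Measurable[history W s] fun ω => W p.2 ω p.1 :=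
        (by fun_prop : Continuous fun v : Vec d => v p.1).measurable.comp h1
      exact ⟨_, h2.stronglyMeasurable, hJ.apply_step p⟩
    · have h1 : IsClosed {f : Lp ℝ 2 P | AEStronglyMeasurable[history W s] f P} :=
        isClosed_aestronglyMeasurable (history_le hW s)
      exact h1.preimage J.continuous
  have h2 : J (segL2 t s k) ∈ lpMeas ℝ ℝ (history W s) 2 P := hle hmem
  exact mem_lpMeas_iff_aestronglyMeasurable.1 h2

end IsWienerMap

/-! ### The time integral of the noise -/

theorem PW.of_continuous {E : Type*} [TopologicalSpace E] {T τ : ℝ} {k : ℝ → E}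
    (hk : Continuous k) : PW T τ k :=
  ⟨k, k, hk, hk, fun _ _ => rfl, fun _ _ => rfl⟩

/-- Riemann sums with a matrix valued density. -/
theorem PW.tendsto_sum_integral_apply {T τ t s : ℝ} {D : ℝ → Mat d} (hD : PW T τ D)
    (ht : 0 ≤ t) (hts : t ≤ s) (hs : s ≤ T) {y : ℝ → Vec d} (hy : Continuous y) :
    Tendsto (fun n => ∑ i ∈ Finset.range (n + 1),
      (∫ r in uniformPartition t s n i..uniformPartition t s n (i + 1), D r)
        (y (uniformPartition t s n (i + 1)))) atTop (𝓝 (∫ r in t..s, D r (y r))) := by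
  obtain ⟨B, hB, hDB⟩ := hD.exists_bound
  have hDy : PW T τ fun r => D r (y r) :=
    (hD.prodMk (PW.of_continuous hy)).comp (φ := fun z : Mat d × Vec d => z.1 z.2) (by fun_prop)
  have hpm : ∀ n, ∀ i ≤ n + 1, uniformPartition t s n i ∈ Icc t s := by
    intro n i hi
    constructor
    · exact (uniformPartition_zero t s n).symm.trans_le (monotone_uniformPartition hts n i.zero_le)
    · exact (monotone_uniformPartition hts n hi).trans_eq (uniformPartition_last t s n)
  have hpT : ∀ n, ∀ i ≤ n + 1, uniformPartition t s n i ∈ Icc 0 T := fun n i hi =>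
    ⟨ht.trans (hpm n i hi).1, (hpm n i hi).2.trans hs⟩
  have huc := (isCompact_Icc (a := t) (b := s)).uniformContinuousOn_of_continuous hy.continuousOn
  rw [Metric.uniformContinuousOn_iff] at huc
  have hmesh : Tendsto (fun n : ℕ => (s - t) / ((n : ℝ) + 1)) atTop (𝓝 0) :=
    (tendsto_const_div_atTop_nhds_zero_nat (s - t)).comp (tendsto_add_atTop_nat 1) |>.congr
      fun n => by simp
  rw [Metric.tendsto_atTop]
  intro ε hε
  obtain ⟨δ, hδ, hδy⟩ := huc (ε / (B * (s - t) + 1)) (by have := sub_nonneg.2 hts; positivity)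
  obtain ⟨n₀, hn₀⟩ := (Metric.tendsto_atTop.1 hmesh) δ hδ
  refine ⟨n₀, fun n hn => ?_⟩
  have hn' := hn₀ n hn
  have hm0 : 0 ≤ (s - t) / ((n : ℝ) + 1) := div_nonneg (by linarith) (by positivity)
  rw [Real.dist_eq, sub_zero, abs_of_nonneg hm0] at hn'
  have hsplit := intervalIntegral.sum_integral_adjacent_intervals (a := uniformPartition t s n)
    (f := fun r => D r (y r)) (μ := volume) (n := n + 1) fun i hi =>
      hDy.intervalIntegrable (hpT n i hi.le) (hpT n (i + 1) hi)
  rw [uniformPartition_zero, uniformPartition_last] at hsplit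
  rw [← hsplit, dist_eq_norm, ← Finset.sum_sub_distrib]
  have hterm : ∀ i ∈ Finset.range (n + 1),
      ‖(∫ r in uniformPartition t s n i..uniformPartition t s n (i + 1), D r)
        (y (uniformPartition t s n (i + 1))) -
        ∫ r in uniformPartition t s n i..uniformPartition t s n (i + 1), D r (y r)‖
      ≤ B * (ε / (B * (s - t) + 1)) * ((s - t) / (n + 1)) := by
    intro i hi
    have hi := Finset.mem_range.1 hi
    have h1 := hpT n i hi.le
    have h2 := hpT n (i + 1) hi
    have hle := monotone_uniformPartition hts n (Nat.le_succ i)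
    rw [ContinuousLinearMap.intervalIntegral_apply (hD.intervalIntegrable h1 h2),
      ← intervalIntegral.integral_sub ?_ (hDy.intervalIntegrable h1 h2)]
    · have := intervalIntegral.norm_integral_le_of_norm_le_const
        (a := uniformPartition t s n i) (b := uniformPartition t s n (i + 1))
        (C := B * (ε / (B * (s - t) + 1)))
        (f := fun r => D r (y (uniformPartition t s n (i + 1))) - D r (y r)) fun r hr => by
          rw [uIoc_of_le hle] at hr
          rw [← map_sub]
          refine (ContinuousLinearMap.le_opNorm _ _).trans ?_
          have hr' : r ∈ Icc t s := ⟨(hpm n i hi.le).1.trans hr.1.le, hr.2.trans (hpm n (i + 1) hi).2⟩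
          refine mul_le_mul (hDB r ⟨ht.trans hr'.1, hr'.2.trans hs⟩) ?_ (norm_nonneg _) hB
          rw [← dist_eq_norm]
          refine (hδy _ (hpm n (i + 1) hi) _ hr' ?_).le
          rw [Real.dist_eq, abs_of_nonneg (by linarith [hr.2])]
          have := uniformPartition_succ t s n i
          linarith [hr.1]
      refine this.trans (le_of_eq ?_)
      rw [uniformPartition_succ, add_sub_cancel_left, abs_of_nonneg hm0]
    · exact (hD.comp (φ := fun A : Mat d => A (y (uniformPartition t s n (i + 1))))
        (by fun_prop)).intervalIntegrable h1 h2
  refine (norm_sum_le_of_le _ hterm).trans_lt ?_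
  rw [Finset.sum_const, Finset.card_range, nsmul_eq_mul]
  have h0 := sub_nonneg.2 hts
  have e : ((n + 1 : ℕ) : ℝ) * (B * (ε / (B * (s - t) + 1)) * ((s - t) / (n + 1)))
      = ε * (B * (s - t) / (B * (s - t) + 1)) := by
    push_cast
    field_simp
  rw [e]
  refine mul_lt_of_lt_one_right hε ?_
  rw [div_lt_one (by positivity)]
  linarith

variable {d : ℕ} {b : Coefficients d} {θ : ℝ → State d} {T τ Λ C c₀ : ℝ}

namespace FrozenReg

variable (h : FrozenReg b θ T τ Λ C c₀)
include h

theorem pw_σ_adjoint (v : Vec d) : PW T τ fun r => (b.σ r (θ r)).adjoint v :=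
  h.pw_σ.comp (φ := fun A : Mat d => A.adjoint v) (by fun_prop)

theorem noise_split {r u v : ℝ} (hr : r ∈ Icc 0 T) (hu : u ∈ Icc 0 T) (hv : v ∈ Icc 0 T)
    (ζ : Vec d) : noise b θ v (0, ζ) r
      = noise b θ u (0, ζ) r + (b.σ r (θ r)).adjoint ((R b θ u v).adjoint ζ) := by
  have e := h.R_sub hr hu hv
  rw [sub_eq_iff_eq_add] at e
  simp only [noise, zero_add, e, map_add, add_apply]

/-- The parts on (t, u] cancel by additivity of R. On (u, v] both integrands are O(v-u), and the L²
norm brings one more factor √(v-u). -/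
theorem norm_segL2_increment_le {B t u v : ℝ} (hB : 0 ≤ B)
    (hσB : ∀ r ∈ Icc 0 T, ‖b.σ r (θ r)‖ ≤ B) (ht : 0 ≤ t) (htu : t ≤ u) (huv : u ≤ v) (hv : v ≤ T)
    (ζ : Vec d) :
    ‖segL2 t v (fun r => (b.σ r (θ r)).adjoint ((R b θ u v).adjoint ζ)) -
        (segL2 t v (noise b θ v (0, ζ)) - segL2 t u (noise b θ u (0, ζ)))‖
      ≤ 2 * (B * (C * (v - u) * ‖ζ‖)) * √(v - u) := by
  have hu0 : 0 ≤ u := ht.trans htu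
  have hu : u ∈ Icc 0 T := ⟨hu0, huv.trans hv⟩
  have hv' : v ∈ Icc 0 T := ⟨hu0.trans huv, hv⟩
  have hpn := h.pw_noise hv' (0, ζ)
  have hps := h.pw_σ_adjoint ((R b θ u v).adjoint ζ)
  have e1 : segL2 t u (noise b θ v (0, ζ)) = segL2 t u (noise b θ u (0, ζ)) +
      segL2 t u (fun r => (b.σ r (θ r)).adjoint ((R b θ u v).adjoint ζ)) := by
    rw [← segL2_add ((h.pw_noise hu (0, ζ)).memLp ht hu.2 2) (hps.memLp ht hu.2 2)]
    exact segL2_congr fun r hr =>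
      h.noise_split ⟨ht.trans hr.1.le, hr.2.trans hu.2⟩ hu hv' ζ
  have e2 : segL2 t v (fun r => (b.σ r (θ r)).adjoint ((R b θ u v).adjoint ζ)) -
        (segL2 t v (noise b θ v (0, ζ)) - segL2 t u (noise b θ u (0, ζ)))
      = segL2 u v (fun r => (b.σ r (θ r)).adjoint ((R b θ u v).adjoint ζ)) -
        segL2 u v (noise b θ v (0, ζ)) := by
    rw [segL2_split htu huv (hps.memLp ht hv 2), segL2_split htu huv (hpn.memLp ht hv 2), e1]
    abel
  have hC := h.C_pos.le
  have hvu := sub_nonneg.2 huv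
  have hσ : ∀ r ∈ Icc 0 T, ∀ w : Vec d, ‖(b.σ r (θ r)).adjoint w‖ ≤ B * ‖w‖ := by
    intro r hr w
    refine (ContinuousLinearMap.le_opNorm _ _).trans ?_
    rw [LinearIsometryEquiv.norm_map]
    exact mul_le_mul_of_nonneg_right (hσB r hr) (norm_nonneg _)
  have hn1 := norm_segL2_le (B := B * (C * (v - u) * ‖ζ‖)) hu0 huv (by positivity)
    (hps.memLp hu0 hv 2) fun r hr =>
      (hσ r ⟨hu0.trans hr.1.le, hr.2.trans hv⟩ _).trans
        (mul_le_mul_of_nonneg_left (h.norm_R_adjoint_le hu0 huv hv ζ) hB)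
  have hn2 := norm_segL2_le (B := B * (C * (v - u) * ‖ζ‖)) hu0 huv (by positivity)
    (hpn.memLp hu0 hv 2) fun r hr => by
      have hr0 : 0 ≤ r := hu0.trans hr.1.le
      refine (hσ r ⟨hr0, hr.2.trans hv⟩ _).trans (mul_le_mul_of_nonneg_left ?_ hB)
      rw [zero_add]
      refine (h.norm_R_adjoint_le hr0 hr.2 hv ζ).trans ?_
      have := hr.1.le
      gcongr
  rw [e2]
  refine (norm_sub_le _ _).trans ((add_le_add hn1 hn2).trans (le_of_eq ?_))
  ring

/-- With G(u) the restriction to (t, u] of `noise b θ u (0, ζ)`, the limit is G(s) - G(t), a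
telescoping sum. Each summand is an increment of G up to O(mesh^{3/2}), and the n + 1 errors add up
to O(mesh^{1/2}). -/
theorem tendsto_sum_segL2 {t s : ℝ} (ht : 0 ≤ t) (hts : t ≤ s) (hs : s ≤ T) (ζ : Vec d) :
    Tendsto (fun n => ∑ i ∈ Finset.range (n + 1),
      segL2 t (uniformPartition t s n (i + 1)) fun r => (b.σ r (θ r)).adjoint
        ((R b θ (uniformPartition t s n i) (uniformPartition t s n (i + 1))).adjoint ζ))
      atTop (𝓝 (segL2 t s (noise b θ s (0, ζ)))) := by
  obtain ⟨B, hB, hσB⟩ := h.pw_σ.exists_bound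
  have hC := h.C_pos.le
  have h0 := sub_nonneg.2 hts
  rw [tendsto_iff_norm_sub_tendsto_zero]
  have hb : ∀ n : ℕ, ‖∑ i ∈ Finset.range (n + 1),
      segL2 t (uniformPartition t s n (i + 1)) (fun r => (b.σ r (θ r)).adjoint
        ((R b θ (uniformPartition t s n i) (uniformPartition t s n (i + 1))).adjoint ζ))
      - segL2 t s (noise b θ s (0, ζ))‖
      ≤ 2 * (B * (C * (s - t) * ‖ζ‖)) * √((s - t) / (n + 1)) := by
    intro n
    have htel := Finset.sum_range_sub (fun i => segL2 t (uniformPartition t s n i)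
      (noise b θ (uniformPartition t s n i) (0, ζ))) (n + 1)
    rw [uniformPartition_last, uniformPartition_zero, segL2_self, sub_zero] at htel
    rw [← htel, ← Finset.sum_sub_distrib]
    refine (norm_sum_le_of_le _ fun i hi => h.norm_segL2_increment_le hB hσB ht
      ((uniformPartition_zero t s n).symm.trans_le (monotone_uniformPartition hts n i.zero_le))
      (monotone_uniformPartition hts n i.le_succ)
      (((monotone_uniformPartition hts n (Finset.mem_range.1 hi)).trans_eq
        (uniformPartition_last t s n)).trans hs) ζ).trans ?_
    simp only [uniformPartition_succ, add_sub_cancel_left]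
    rw [Finset.sum_const, Finset.card_range, nsmul_eq_mul]
    refine le_of_eq ?_
    push_cast
    field_simp
  refine squeeze_zero (fun _ => norm_nonneg _) hb ?_
  have hmesh : Tendsto (fun n : ℕ => (s - t) / ((n : ℝ) + 1)) atTop (𝓝 0) :=
    (tendsto_const_div_atTop_nhds_zero_nat (s - t)).comp (tendsto_add_atTop_nat 1) |>.congr
      fun n => by simp
  have h1 := (Real.continuous_sqrt.tendsto 0).comp hmesh
  rw [Real.sqrt_zero] at h1
  simpa using h1.const_mul (2 * (B * (C * (s - t) * ‖ζ‖)))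

end FrozenReg

variable {Ω : Type*} {mΩ : MeasurableSpace Ω} {P : Measure Ω} {W : ℝ≥0 → Ω → Vec d}
  {J : L2 d →ₗᵢ[ℝ] Lp ℝ 2 P}

/-- A continuous version of the martingale part of the first component. -/
theorem FrozenReg.exists_noise_process (h : FrozenReg b θ T τ Λ C c₀) (hW : IsBrownian W P)
    (hJ : IsWienerMap P W J) {t : ℝ} (ht : t ∈ Icc 0 T) :
    ∃ N : ℝ → Ω → Vec d, (∀ ω, Continuous fun s => N s ω) ∧
      ∀ s ∈ Icc t T, IsWienerIntegral P W (fun r => b.σ r (θ r)) t s (N s) := by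
  choose N hN hNJ using fun j : Fin d =>
    hJ.exists_continuous_version ht (h.pw_σ_adjoint (EuclideanSpace.single j 1))
  refine ⟨fun s ω => WithLp.toLp 2 fun j => N j s ω, fun ω =>
    (PiLp.continuous_toLp 2 _).comp (continuous_pi fun j => hN j ω), fun s hs => ?_⟩
  refine hJ.isWienerIntegral_of_inner_ae_eq hW ht.1 hs.1 hs.2 h.pw_σ ?_ fun j => hNJ j s hs
  have : AEMeasurable (fun ω => WithLp.toLp 2 fun j => N j s ω) P :=
    (WithLp.measurable_toLp 2 (Fin d → ℝ)).comp_aemeasurable (aemeasurable_pi_lambda _ fun j =>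
      (Lp.aestronglyMeasurable _).aemeasurable.congr (hNJ j s hs).symm)
  exact this.aestronglyMeasurable

/-- An L² limit is an almost sure limit along a subsequence, which must agree with the pointwise
limit. -/
theorem ae_eq_of_tendsto_of_tendsto_L2 {f : ℕ → Ω → ℝ} {g g' : Ω → ℝ} {F : ℕ → Lp ℝ 2 P}
    {G : Lp ℝ 2 P} (hF : ∀ n, f n =ᵐ[P] F n) (hG : Tendsto F atTop (𝓝 G))
    (hfg : ∀ ω, Tendsto (fun n => f n ω) atTop (𝓝 (g ω))) (hG' : g' =ᵐ[P] G) : g =ᵐ[P] g' := by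
  have h1 : TendstoInMeasure P (fun n => F n) atTop G :=
    tendstoInMeasure_of_tendsto_Lp hG
  obtain ⟨ns, hns, hlim⟩ := h1.exists_seq_tendsto_ae
  filter_upwards [hlim, ae_all_iff.2 hF, hG'] with ω h2 h3 h4
  rw [h4]
  refine tendsto_nhds_unique ((hfg ω).comp hns.tendsto_atTop) (h2.congr fun n => ?_)
  exact (h3 (ns n)).symm

theorem sum_ae_eq_coeFn {ι : Type*} {s : Finset ι} {f : ι → Ω → ℝ} {F : ι → Lp ℝ 2 P}
    (hf : ∀ i ∈ s, f i =ᵐ[P] F i) : (fun ω => ∑ i ∈ s, f i ω) =ᵐ[P] ⇑(∑ i ∈ s, F i) := by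
  filter_upwards [(Filter.eventually_all_finset s).2 hf, Lp.coeFn_finsetSum s F] with ω h1 h2
  rw [h2, Finset.sum_apply]
  exact Finset.sum_congr rfl h1

/-- A stochastic Fubini theorem: the same Riemann sums converge pathwise to the time integral, as N
is continuous, and in L² to the Wiener integral whose integrand contains R_{r,s}. -/
theorem FrozenReg.inner_integral_noise_ae_eq (h : FrozenReg b θ T τ Λ C c₀) (hW : IsBrownian W P)
    (hJ : IsWienerMap P W J) {t : ℝ} (ht : 0 ≤ t) {N : ℝ → Ω → Vec d}
    (hN : ∀ ω, Continuous fun s => N s ω)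
    (hNW : ∀ s ∈ Icc t T, IsWienerIntegral P W (fun r => b.σ r (θ r)) t s (N s))
    {s : ℝ} (hs : s ∈ Icc t T) (ζ : Vec d) :
    (fun ω => inner ℝ ζ (∫ r in t..s, b.D₁F₂ r (θ r) (N r ω))) =ᵐ[P]
      J (segL2 t s (noise b θ s (0, ζ))) := by
  refine ae_eq_of_tendsto_of_tendsto_L2
    (f := fun n ω => inner ℝ ζ (∑ i ∈ Finset.range (n + 1),
      R b θ (uniformPartition t s n i) (uniformPartition t s n (i + 1))
        (N (uniformPartition t s n (i + 1)) ω)))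
    (fun n => ?_) ((J.continuous.tendsto _).comp (h.tendsto_sum_segL2 ht hs.1 hs.2 ζ))
    (fun ω => ?_) EventuallyEq.rfl
  · simp only [Function.comp_apply, map_sum, inner_sum]
    refine sum_ae_eq_coeFn fun i hi => ?_
    have hmem : uniformPartition t s n (i + 1) ∈ Icc t T :=
      ⟨(uniformPartition_zero t s n).symm.trans_le
        (monotone_uniformPartition hs.1 n (Nat.zero_le _)),
        ((monotone_uniformPartition hs.1 n (Finset.mem_range.1 hi)).trans_eq
          (uniformPartition_last t s n)).trans hs.2⟩
    filter_upwards [hJ.inner_ae_eq_of_isWienerIntegral hW ht (h.pw_σ.memLp ht hmem.2 2)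
      (hNW _ hmem) ((R b θ (uniformPartition t s n i)
        (uniformPartition t s n (i + 1))).adjoint ζ)] with ω hω
    rw [← hω, ContinuousLinearMap.adjoint_inner_left]
  · have h5 := h.pw_D.tendsto_sum_integral_apply ht hs.1 hs.2 (hN ω)
    simp only [R]
    exact tendsto_const_nhds.inner h5

/-! ### Conditioning on an independent σ-algebra -/

/-- The pair formed by the event E, as a `Prop`-valued variable, and Y is independent of N. Their
joint law is a product and the formula is Fubini's theorem. -/
theorem setLIntegral_measure_of_indep {Ω β γ : Type*} [MeasurableSpace β] [MeasurableSpace γ]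
    {m mΩ : MeasurableSpace Ω} {P : Measure Ω} [IsProbabilityMeasure P] (hm : m ≤ mΩ) {Y : Ω → β} {N : Ω → γ}
    (hY : Measurable[m] Y) (hN : Measurable N)
    (hind : Indep (MeasurableSpace.comap N inferInstance) m P) {B : Set (β × γ)}
    (hB : MeasurableSet B) {E : Set Ω} (hE : MeasurableSet[m] E) :
    ∫⁻ ω in E, (P.map N) (Prod.mk (Y ω) ⁻¹' B) ∂P = P ((fun ω => (Y ω, N ω)) ⁻¹' B ∩ E) := by
  let U : Ω → Prop × β := fun ω => (ω ∈ E, Y ω)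
  have hUm : Measurable[m] U :=
    Measurable.prodMk (m := m) (@measurableSet_setOfPred _ m _ |>.1 hE) hY
  have hU : Measurable U := hUm.mono hm le_rfl
  have hUN : IndepFun U N P := by
    rw [IndepFun_iff_Indep]
    exact (indep_of_indep_of_le_right hind hUm.comap_le).symm
  have hprod := (indepFun_iff_map_prod_eq_prod_map_map hU.aemeasurable hN.aemeasurable).1 hUN
  let S : Set ((Prop × β) × γ) := {z | z.1.1 ∧ (z.1.2, z.2) ∈ B}
  have hS : MeasurableSet S := by
    refine MeasurableSet.inter ?_ ?_
    · exact measurableSet_setOfPred.2 (measurable_fst.comp measurable_fst)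
    · exact ((measurable_snd.comp measurable_fst).prodMk measurable_snd) hB
  have hNp : IsProbabilityMeasure (P.map N) := Measure.isProbabilityMeasure_map hN.aemeasurable
  have h1 := congrArg (fun μ => μ S) hprod
  beta_reduce at h1
  rw [Measure.map_apply (hU.prodMk hN) hS, Measure.prod_apply hS,
    lintegral_map (measurable_measure_prodMk_left hS) hU] at h1
  have hE' : MeasurableSet E := hm _ hE
  rw [← lintegral_indicator hE']
  have e1 : (fun ω => (U ω, N ω)) ⁻¹' S = (fun ω => (Y ω, N ω)) ⁻¹' B ∩ E := by
    ext ω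
    exact and_comm
  rw [← e1, h1]
  refine lintegral_congr fun ω => ?_
  by_cases hω : ω ∈ E
  · rw [indicator_of_mem hω]
    congr 1
    ext n
    simp [S, U, hω]
  · rw [indicator_of_notMem hω]
    have : Prod.mk (U ω) ⁻¹' S = ∅ := by
      ext n
      simp [S, U, hω]
    rw [this, measure_empty]

/-- The freezing lemma: Y is known given `m` and N is independent of `m`, so N is integrated out
with Y held fixed. -/
theorem condExp_indicator_of_indep {Ω β γ : Type*} [MeasurableSpace β] [MeasurableSpace γ]
    {m mΩ : MeasurableSpace Ω} {P : Measure Ω} [IsProbabilityMeasure P] (hm : m ≤ mΩ) {Y : Ω → β} {N : Ω → γ}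
    (hY : Measurable[m] Y) (hN : Measurable N)
    (hind : Indep (MeasurableSpace.comap N inferInstance) m P) {B : Set (β × γ)}
    (hB : MeasurableSet B) :
    P[((fun ω => (Y ω, N ω)) ⁻¹' B).indicator (fun _ => (1 : ℝ)) | m] =ᵐ[P]
      fun ω => (P.map N).real (Prod.mk (Y ω) ⁻¹' B) := by
  have hNp : IsProbabilityMeasure (P.map N) := Measure.isProbabilityMeasure_map hN.aemeasurable
  have hA : MeasurableSet ((fun ω => (Y ω, N ω)) ⁻¹' B) := ((hY.mono hm le_rfl).prodMk hN) hB
  have hψ : Measurable fun y => (P.map N) (Prod.mk y ⁻¹' B) := measurable_measure_prodMk_left hB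
  have hg : Measurable[m] fun ω => (P.map N).real (Prod.mk (Y ω) ⁻¹' B) :=
    hψ.ennreal_toReal.comp hY
  symm
  refine ae_eq_condExp_of_forall_setIntegral_eq hm ((integrable_const 1).indicator hA)
    (fun E _ _ => Integrable.integrableOn ?_) (fun E hE _ => ?_)
    hg.stronglyMeasurable.aestronglyMeasurable
  · refine Integrable.of_bound (hg.mono hm le_rfl).aestronglyMeasurable 1 (ae_of_all _ fun ω => ?_)
    rw [Real.norm_of_nonneg measureReal_nonneg]
    exact measureReal_le_one
  · have h1 := setLIntegral_measure_of_indep hm hY hN hind hB hE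
    rw [integral_indicator_const _ hA, measureReal_restrict_apply hA, smul_eq_mul, mul_one]
    simp only [Measure.real]
    rw [integral_toReal (f := fun ω => (P.map N) (Prod.mk (Y ω) ⁻¹' B))
      ((hψ.comp (hY.mono hm le_rfl)).aemeasurable) (ae_of_all _ fun ω => measure_lt_top _ _), h1]

/-! ### Existence and uniqueness for the frozen system -/

variable {d : ℕ} {b : Coefficients d} {θ : ℝ → State d} {T τ Λ C c₀ : ℝ}
  {Ω : Type*} {mΩ : MeasurableSpace Ω} {P : Measure Ω} {W : ℝ≥0 → Ω → Vec d}
  {J : L2 d →ₗᵢ[ℝ] Lp ℝ 2 P}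

/-- The marginals of `X` on `[t, T]` are the Gaussian ones, in terms of the Wiener integral `J`. -/
def IsNoiseForm (b : Coefficients d) (θ : ℝ → State d) (T : ℝ) (J : L2 d →ₗᵢ[ℝ] Lp ℝ 2 P) (t : ℝ)
    (x : State d) (X : ℝ → Ω → State d) : Prop :=
  ∀ s ∈ Icc t T, ∀ ζ : State d,
    (fun ω => inner ℝ ζ.1 (X s ω).1 + inner ℝ ζ.2 (X s ω).2) =ᵐ[P] fun ω =>
      (inner ℝ ζ.1 (mean₁ b θ t s x) + inner ℝ ζ.2 (mean₂ b θ t s x))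
        + J (segL2 t s (noise b θ s ζ)) ω

theorem FrozenReg.continuousOn_mean₁_right (h : FrozenReg b θ T τ Λ C c₀) {t : ℝ}
    (ht : t ∈ Icc 0 T) (x : State d) : ContinuousOn (fun s => mean₁ b θ t s x) (Icc 0 T) :=
  continuousOn_const.add (h.pw_F₁.continuousOn_integral_right t ht)

/-- X¹ is the mean plus the continuous noise N, and X² is defined by its equation. What remains of
X² after subtracting the mean is ∫ D₁F₂ N dr, which the Fubini argument turns into a Wiener
integral. -/
theorem FrozenReg.exists_isSolution (h : FrozenReg b θ T τ Λ C c₀) (hW : IsBrownian W P)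
    (hJ : IsWienerMap P W J) {t : ℝ} (ht : t ∈ Icc 0 T) (x : State d) :
    ∃ X : ℝ → Ω → State d, IsSolution b θ T P W t x X ∧ IsNoiseForm b θ T J t x X := by
  obtain ⟨N, hN, hNW⟩ := h.exists_noise_process hW hJ ht
  have hX1 : ∀ ω, PW T τ fun r => mean₁ b θ t r x + N r ω := fun ω =>
    PW.of_continuousOn h.T_pos.le ((h.continuousOn_mean₁_right ht x).add (hN ω).continuousOn) h.τ_mem
  have hX2 : ∀ ω, PW T τ fun r =>
      b.F₂ r (θ r) + b.D₁F₂ r (θ r) ((mean₁ b θ t r x + N r ω) - (θ r).1) := fun ω =>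
    (h.pw_F₂.prodMk (h.pw_D.prodMk ((hX1 ω).prodMk h.pw_θ))).comp
      (φ := fun z : Vec d × Mat d × Vec d × State d => z.1 + z.2.1 (z.2.2.1 - z.2.2.2.1))
      (by fun_prop)
  set X : ℝ → Ω → State d := fun s ω => (mean₁ b θ t s x + N s ω, x.2 +
    ∫ r in t..s, (b.F₂ r (θ r) + b.D₁F₂ r (θ r) ((mean₁ b θ t r x + N r ω) - (θ r).1))) with hX
  have hsub : Icc t T ⊆ Icc 0 T := Icc_subset_Icc_left ht.1
  have htt : t ∈ Icc t T := ⟨le_rfl, ht.2⟩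
  refine ⟨X, ⟨ae_of_all _ fun ω => ?_, ?_, fun s hs => ?_, ae_of_all _ fun ω s _ => rfl⟩,
    fun s hs ζ => ?_⟩
  · refine ContinuousOn.prodMk ?_ ?_
    · exact ((h.continuousOn_mean₁_right ht x).mono hsub).add (hN ω).continuousOn
    · exact continuousOn_const.add (((hX2 ω).continuousOn_integral_right t ht).mono hsub)
  · have h1 : ∀ᵐ ω ∂P, ∀ j : Fin d, N t ω j = 0 := by
      rw [ae_all_iff]
      intro j
      have h2 := hJ.inner_ae_eq_of_isWienerIntegral hW ht.1 (h.pw_σ.memLp ht.1 ht.2 2)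
        (hNW t htt) (EuclideanSpace.single j 1)
      rw [segL2_self, map_zero] at h2
      filter_upwards [h2, Lp.coeFn_zero ℝ 2 P] with ω h3 h4
      rw [h4] at h3
      simpa [EuclideanSpace.inner_single_left] using h3
    filter_upwards [h1] with ω hω
    have h3 : N t ω = 0 := by
      ext j
      exact hω j
    ext1
    · simp [hX, mean₁, h3]
    · simp [hX]
  · have e : (fun ω => (X s ω).1 - x.1 - ∫ r in t..s, b.F₁ r (θ r)) = N s := by
      funext ω
      simp only [hX, mean₁]
      abel
    rw [e]
    exact hNW s hs
  · have hs0 : s ∈ Icc 0 T := hsub hs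
    have hDN : ∀ ω, PW T τ fun r => b.D₁F₂ r (θ r) (N r ω) := fun ω =>
      (h.pw_D.prodMk (PW.of_continuous (hN ω))).comp (φ := fun z : Mat d × Vec d => z.1 z.2)
        (by fun_prop)
    have h2 : ∀ ω, (X s ω).2 = mean₂ b θ t s x + ∫ r in t..s, b.D₁F₂ r (θ r) (N r ω) := by
      intro ω
      simp only [hX, mean₂]
      rw [add_assoc, ← intervalIntegral.integral_add ((h.pw_mean₂ ht x).intervalIntegrable ht hs0)
        ((hDN ω).intervalIntegrable ht hs0)]
      congr 1
      refine intervalIntegral.integral_congr fun r _ => ?_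
      simp only [mean₁, map_add, map_sub]
      abel
    have e1 := hJ.inner_ae_eq_of_isWienerIntegral hW ht.1 (h.pw_σ.memLp ht.1 hs.2 2) (hNW s hs) ζ.1
    have e2 := h.inner_integral_noise_ae_eq hW hJ ht.1 hN hNW hs ζ.2
    have e3 : segL2 t s (noise b θ s ζ) = segL2 t s (fun r => (b.σ r (θ r)).adjoint ζ.1) +
        segL2 t s (noise b θ s (0, ζ.2)) := by
      rw [← segL2_add ((h.pw_σ_adjoint ζ.1).memLp ht.1 hs.2 2)
        ((h.pw_noise hs0 (0, ζ.2)).memLp ht.1 hs.2 2)]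
      refine segL2_congr fun r _ => ?_
      simp only [noise, zero_add, map_add]
    rw [e3, map_add]
    filter_upwards [e1, e2, Lp.coeFn_add (J (segL2 t s fun r => (b.σ r (θ r)).adjoint ζ.1))
      (J (segL2 t s (noise b θ s (0, ζ.2))))] with ω h3 h4 h5
    rw [h5, Pi.add_apply, ← h3, ← h4, h2 ω]
    simp only [hX, inner_add_right]
    ring

/-- Uniqueness of Wiener integrals fixes X¹ at each time up to a null set. A countable dense set of
times and continuity give one null set for all times, and the second equation expresses X² through
X¹. -/
theorem FrozenReg.isSolution_unique (h : FrozenReg b θ T τ Λ C c₀) (hW : IsBrownian W P)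
    (hJ : IsWienerMap P W J) {t : ℝ} (ht : t ∈ Icc 0 T) {x : State d} {X Y : ℝ → Ω → State d}
    (hX : IsSolution b θ T P W t x X) (hY : IsSolution b θ T P W t x Y) :
    ∀ᵐ ω ∂P, ∀ s ∈ Icc t T, Y s ω = X s ω := by
  have h1 : ∀ s ∈ Icc t T, ∀ᵐ ω ∂P, (Y s ω).1 = (X s ω).1 := by
    intro s hs
    have h2 : ∀ᵐ ω ∂P, ∀ j : Fin d, (Y s ω).1 j = (X s ω).1 j := by
      rw [ae_all_iff]
      intro j
      have hm := h.pw_σ.memLp (τ := τ) ht.1 hs.2 2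
      filter_upwards [hJ.inner_ae_eq_of_isWienerIntegral hW ht.1 hm (hX.eq₁ s hs)
        (EuclideanSpace.single j 1), hJ.inner_ae_eq_of_isWienerIntegral hW ht.1 hm (hY.eq₁ s hs)
        (EuclideanSpace.single j 1)] with ω h3 h4
      have h5 := h4.trans h3.symm
      simpa [EuclideanSpace.inner_single_left] using h5
    filter_upwards [h2] with ω hω
    ext j
    exact hω j
  obtain ⟨S, hSc, hSd⟩ := TopologicalSpace.exists_countable_dense (Icc t T)
  have h2 : ∀ᵐ ω ∂P, ∀ s ∈ S, (Y (s : ℝ) ω).1 = (X (s : ℝ) ω).1 :=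
    (ae_ball_iff hSc).2 fun s _ => h1 s s.2
  filter_upwards [h2, hX.continuous, hY.continuous, hX.eq₂, hY.eq₂] with ω e hXc hYc hX2 hY2
  have h3 : ∀ s ∈ Icc t T, (Y s ω).1 = (X s ω).1 := by
    intro s hs
    have hc : ∀ {Z : ℝ → Ω → State d}, ContinuousOn (fun s => Z s ω) (Icc t T) →
        Continuous fun s : Icc t T => (Z (s : ℝ) ω).1 := fun hZ =>
      (continuous_fst.comp_continuousOn hZ).comp_continuous continuous_subtype_val fun s => s.2
    exact congrFun (Continuous.ext_on hSd (hc hYc) (hc hXc) fun s hs => e s hs) ⟨s, hs⟩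
  intro s hs
  refine Prod.ext (h3 s hs) ?_
  rw [hX2 s hs, hY2 s hs]
  congr 1
  refine intervalIntegral.integral_congr fun r hr => ?_
  rw [uIcc_of_le hs.1] at hr
  simp only [h3 r ⟨hr.1, hr.2.trans hs.2⟩]

/-! ### Law of the solution and Markov property -/

theorem isGaussianProcess_const_add {ι E Ω : Type*} {mΩ : MeasurableSpace Ω} {P : Measure Ω}
    [NormedAddCommGroup E] [NormedSpace ℝ E] [MeasurableSpace E] [BorelSpace E]
    [SecondCountableTopology E] {N : ι → Ω → E} (hN : IsGaussianProcess N P) (c : ι → E) :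
    IsGaussianProcess (fun i ω => c i + N i ω) P := by
  refine ⟨fun I => ?_⟩
  have hg := (hN.hasGaussianLaw I).isGaussian_map
  have hm := (hN.hasGaussianLaw I).aemeasurable
  refine ⟨?_⟩
  have e : (fun ω => I.restrict fun i => c i + N i ω) =
      (fun z => I.restrict c + z) ∘ fun ω => I.restrict fun i => N i ω := rfl
  rw [e, ← AEMeasurable.map_map_of_aemeasurable (by fun_prop) hm]
  infer_instance

theorem multivariateGaussian_eq_map_add {ι : Type*} [Fintype ι] [DecidableEq ι]
    (μ : EuclideanSpace ℝ ι) (S : Matrix ι ι ℝ) :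
    multivariateGaussian μ S = (multivariateGaussian 0 S).map (fun z => μ + z) := by
  rw [multivariateGaussian, multivariateGaussian, Measure.map_map (by fun_prop) (by fun_prop)]
  congr 1
  funext z
  simp

variable {d : ℕ} {b : Coefficients d} {θ : ℝ → State d} {T τ Λ C c₀ : ℝ}
  {Ω : Type*} {mΩ : MeasurableSpace Ω} {P : Measure Ω} {W : ℝ≥0 → Ω → Vec d}
  {J : L2 d →ₗᵢ[ℝ] Lp ℝ 2 P} {t s r : ℝ} {x : State d} {X : ℝ → Ω → State d}

/-- The mean `m_{t,s}(x)`, as a point of the state space. -/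
def meanState (b : Coefficients d) (θ : ℝ → State d) (t s : ℝ) (x : State d) : State d :=
  (mean₁ b θ t s x, mean₂ b θ t s x)

/-- The centred part of the solution at time `s`. -/
def noiseVec (b : Coefficients d) (θ : ℝ → State d) (J : L2 d →ₗᵢ[ℝ] Lp ℝ 2 P) (t s : ℝ) (ω : Ω) :
    State d :=
  ofCoords d (WithLp.toLp 2 fun i => J (segL2 t s (noise b θ s (stdBasis d i))) ω)

theorem coords_noiseVec (i : Fin d ⊕ Fin d) (ω : Ω) :
    coords (noiseVec b θ J t s ω) i = J (segL2 t s (noise b θ s (stdBasis d i))) ω := by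
  rw [noiseVec, coords_ofCoords]

theorem inner_stdBasis (i : Fin d ⊕ Fin d) (z : State d) :
    inner ℝ (stdBasis d i).1 z.1 + inner ℝ (stdBasis d i).2 z.2 = coords z i := by
  rw [← coords_dotProduct, coords_stdBasis, single_one_dotProduct]

theorem state_ae_eq {X Y : Ω → State d} (h : ∀ i, (fun ω => coords (X ω) i) =ᵐ[P]
    fun ω => coords (Y ω) i) : X =ᵐ[P] Y := by
  filter_upwards [ae_all_iff.2 h] with ω hω
  exact (coordsEquiv d).injective (funext hω)

theorem IsNoiseForm.coords_ae_eq (hX : IsNoiseForm b θ T J t x X) (hs : s ∈ Icc t T)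
    (i : Fin d ⊕ Fin d) : (fun ω => coords (X s ω) i) =ᵐ[P] fun ω =>
      coords (meanState b θ t s x) i + J (segL2 t s (noise b θ s (stdBasis d i))) ω := by
  filter_upwards [hX s hs (stdBasis d i)] with ω hω
  rw [← inner_stdBasis, hω, ← inner_stdBasis]
  rfl

theorem IsNoiseForm.ae_eq (hX : IsNoiseForm b θ T J t x X) (hs : s ∈ Icc t T) :
    X s =ᵐ[P] fun ω => meanState b θ t s x + noiseVec b θ J t s ω := by
  refine state_ae_eq fun i => ?_
  filter_upwards [hX.coords_ae_eq hs i] with ω hω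
  rw [hω, ← coords_noiseVec]
  exact (congrFun (map_add (coordsEquiv d) _ _) i).symm

theorem measurable_noiseVec : Measurable (noiseVec b θ J t s) :=
  continuous_ofCoords.measurable.comp ((WithLp.measurable_toLp 2 _).comp
    (measurable_pi_lambda _ fun _ => (Lp.stronglyMeasurable _).measurable))

theorem FrozenReg.memLp_noise (h : FrozenReg b θ T τ Λ C c₀) (ht : 0 ≤ t) (hr : r ≤ s)
    (hs : s ∈ Icc 0 T) (ζ : State d) :
    MemLp (noise b θ s ζ) 2 (volume.restrict (Ioc t r)) :=
  (h.pw_noise hs ζ).memLp ht (hr.trans hs.2) 2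

theorem FrozenReg.aestronglyMeasurable_history (h : FrozenReg b θ T τ Λ C c₀)
    (hW : IsBrownian W P) (hJ : IsWienerMap P W J) [IsProbabilityMeasure P] (ht : 0 ≤ t)
    (hs : s ∈ Icc t T) (hX : IsNoiseForm b θ T J t x X) :
    AEStronglyMeasurable[history W s] (X s) P := by
  have h1 : ∀ i, ∃ g : Ω → ℝ, StronglyMeasurable[history W s] g ∧
      J (segL2 t s (noise b θ s (stdBasis d i))) =ᵐ[P] g := fun i =>
    hJ.aestronglyMeasurable_history hW ht
      (h.memLp_noise ht le_rfl ⟨ht.trans hs.1, hs.2⟩ (stdBasis d i))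
  choose g hg hgJ using h1
  refine ⟨fun ω => meanState b θ t s x + ofCoords d (WithLp.toLp 2 fun i => g i ω), ?_, ?_⟩
  · have h2 : Measurable[history W s] fun ω i => g i ω :=
      @measurable_pi_lambda _ _ _ (_) _ _ fun i => (hg i).measurable
    exact (continuous_const.add
      (continuous_ofCoords.comp (PiLp.continuous_toLp 2 _))).measurable.comp h2 |>.stronglyMeasurable
  · filter_upwards [hX.ae_eq hs, ae_all_iff.2 hgJ] with ω h2 h3
    rw [h2, noiseVec]
    simp only [h3]

/-- Each state is almost surely an affine image of finitely many values of `J`, which form a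
Gaussian family. -/
theorem IsNoiseForm.isGaussianProcess [IsProbabilityMeasure P] (hJ : IsWienerMap P W J)
    (hX : IsNoiseForm b θ T J t x X) : IsGaussianProcess (fun (s : Icc t T) => X s) P := by
  classical
  have h1 : IsGaussianProcess (fun (s : Icc t T) => noiseVec b θ J t s) P := by
    have hcoord := hJ.isGaussianProcess.comp_right fun p : Icc t T × (Fin d ⊕ Fin d) =>
      segL2 t p.1 (noise b θ p.1 (stdBasis d p.2))
    refine hcoord.of_isGaussianProcess fun s => ?_
    refine ⟨Finset.univ.image fun i => (s, i), LinearMap.toContinuousLinearMap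
      ((coordsEquiv d).symm.toLinearMap ∘ₗ LinearMap.funLeft ℝ ℝ fun i =>
        (⟨(s, i), Finset.mem_image_of_mem _ (Finset.mem_univ i)⟩ :
          Finset.univ.image fun i => (s, i))), fun ω => rfl⟩
  exact (isGaussianProcess_const_add h1 fun s : Icc t T => meanState b θ t s x).congr
    fun s => (hX.ae_eq s.2).symm

theorem IsNoiseForm.memLp [IsProbabilityMeasure P] (hJ : IsWienerMap P W J)
    (hX : IsNoiseForm b θ T J t x X) (hs : s ∈ Icc t T) : MemLp (X s) 2 P :=
  ((hX.isGaussianProcess hJ).hasGaussianLaw_eval ⟨s, hs⟩).memLp_two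

theorem IsNoiseForm.integral_eq [IsProbabilityMeasure P] (hJ : IsWienerMap P W J)
    (hX : IsNoiseForm b θ T J t x X) (hs : s ∈ Icc t T) :
    ∫ ω, X s ω ∂P = (mean₁ b θ t s x, mean₂ b θ t s x) := by
  have hi := (hX.memLp hJ hs).integrable (by norm_num)
  refine (coordsEquiv d).injective (funext fun i => ?_)
  have h1 := (coordL d i).integral_comp_comm hi
  have h2 : ∫ ω, coordL d i (X s ω) ∂P = ∫ ω, (coords (meanState b θ t s x) i +
      J (segL2 t s (noise b θ s (stdBasis d i))) ω) ∂P := integral_congr_ae (hX.coords_ae_eq hs i)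
  rw [integral_add (integrable_const _) ((Lp.memLp _).integrable (by norm_num)),
    hJ.integral_apply, integral_const, probReal_univ, one_smul, add_zero] at h2
  exact h1.symm.trans h2

theorem FrozenReg.covariance_eq [IsProbabilityMeasure P] (h : FrozenReg b θ T τ Λ C c₀)
    (hJ : IsWienerMap P W J) (hX : IsNoiseForm b θ T J t x X) (ht : 0 ≤ t) (hs : s ∈ Icc t T)
    (i j : Fin d ⊕ Fin d) :
    covariance (fun ω => coords (X s ω) i) (fun ω => coords (X s ω) j) P
      = covMatrix b θ t s i j := by
  have hs0 : s ∈ Icc 0 T := ⟨ht.trans hs.1, hs.2⟩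
  have hint : ∀ k : L2 d, Integrable (fun ω => J k ω) P := fun k =>
    (Lp.memLp _).integrable (by norm_num)
  rw [covariance_congr_ae (hX.coords_ae_eq hs i) (hX.coords_ae_eq hs j),
    covariance_const_add_left (hint _), covariance_const_add_right (hint _), hJ.covariance_apply,
    inner_segL2 ht hs.1 (h.memLp_noise ht le_rfl hs0 _) (h.memLp_noise ht le_rfl hs0 _),
    h.covMatrix_apply ⟨ht, hs.1.trans hs.2⟩ hs0]

/-- The flow property of the means. -/
theorem FrozenReg.meanState_meanState (h : FrozenReg b θ T τ Λ C c₀) (ht : t ∈ Icc 0 T)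
    (hr : r ∈ Icc 0 T) (hs : s ∈ Icc 0 T) (x : State d) :
    meanState b θ r s (meanState b θ t r x) = meanState b θ t s x := by
  have h1 : ∀ v ∈ Icc 0 T, (∫ u in t..r, b.F₁ u (θ u)) + ∫ u in r..v, b.F₁ u (θ u)
      = ∫ u in t..v, b.F₁ u (θ u) := fun v hv => intervalIntegral.integral_add_adjacent_intervals
    (h.pw_F₁.intervalIntegrable ht hr) (h.pw_F₁.intervalIntegrable hr hv)
  refine Prod.ext ?_ ?_
  · simp only [meanState, mean₁]
    rw [add_assoc, h1 s hs]
  · have h2 := intervalIntegral.integral_add_adjacent_intervals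
      ((h.pw_mean₂ ht x).intervalIntegrable ht hr) ((h.pw_mean₂ ht x).intervalIntegrable hr hs)
    simp only [meanState]
    rw [mean₂, mean₂, mean₂, ← h2, add_assoc]
    congr 2
    refine intervalIntegral.integral_congr fun v hv => ?_
    have hv' : v ∈ Icc 0 T := uIcc_subset_Icc hr hs hv
    simp only [mean₁, ← h1 v hv', map_add, map_sub]
    abel

/-- The mean is affine in the starting point with linear part (z₁, z₂) ↦ (z₁, z₂ + Rz₁); its adjoint
acts on ζ. -/
theorem FrozenReg.inner_meanState (h : FrozenReg b θ T τ Λ C c₀) (hr : r ∈ Icc 0 T)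
    (hs : s ∈ Icc 0 T) (ζ y z : State d) :
    inner ℝ ζ.1 ((meanState b θ r s y).1 - (meanState b θ r s z).1)
      + inner ℝ ζ.2 ((meanState b θ r s y).2 - (meanState b θ r s z).2)
      = inner ℝ (ζ.1 + (R b θ r s).adjoint ζ.2) (y.1 - z.1) + inner ℝ ζ.2 (y.2 - z.2) := by
  simp only [meanState]
  rw [FrozenReg.mean₁_eq r s y, FrozenReg.mean₁_eq r s z, h.mean₂_eq hr hs y, h.mean₂_eq hr hs z]
  simp only [inner_add_left, inner_sub_right, inner_add_right,
    ContinuousLinearMap.adjoint_inner_left]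
  ring

/-- R_{v,s} = R_{v,r} + R_{r,s}: noise produced at time v and seen at s in the direction ζ is the
same noise seen at r in the direction transported by the adjoint flow. -/
theorem FrozenReg.noise_eq_noise (h : FrozenReg b θ T τ Λ C c₀) {v : ℝ} (hv : v ∈ Icc 0 T)
    (hr : r ∈ Icc 0 T) (hs : s ∈ Icc 0 T) (ζ : State d) :
    noise b θ s ζ v = noise b θ r (ζ.1 + (R b θ r s).adjoint ζ.2, ζ.2) v := by
  have e := h.R_sub hv hr hs
  rw [sub_eq_iff_eq_add] at e
  simp only [noise, e, map_add, add_apply]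
  abel

/-- Cut the integral at r. The part on (t, r] is the noise of X_r in the transported direction, and
by the flow property of the means it recombines into the mean started from X_r; only the noise on
(r, s] is left over. -/
theorem FrozenReg.ae_eq_meanState_add (h : FrozenReg b θ T τ Λ C c₀)
    (hX : IsNoiseForm b θ T J t x X) (ht : 0 ≤ t) (htr : t ≤ r) (hrs : r ≤ s) (hsT : s ≤ T) :
    X s =ᵐ[P] fun ω => meanState b θ r s (X r ω) + noiseVec b θ J r s ω := by
  have hr0 : r ∈ Icc 0 T := ⟨ht.trans htr, hrs.trans hsT⟩
  have hs0 : s ∈ Icc 0 T := ⟨hr0.1.trans hrs, hsT⟩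
  refine state_ae_eq fun i => ?_
  set ζ := stdBasis d i
  have e1 : segL2 t s (noise b θ s ζ) = segL2 t r (noise b θ r (ζ.1 + (R b θ r s).adjoint ζ.2, ζ.2))
      + segL2 r s (noise b θ s ζ) := by
    rw [segL2_split htr hrs (h.memLp_noise ht le_rfl hs0 ζ)]
    congr 1
    exact segL2_congr fun v hv =>
      h.noise_eq_noise ⟨ht.trans hv.1.le, hv.2.trans hr0.2⟩ hr0 hs0 ζ
  filter_upwards [hX.coords_ae_eq ⟨htr.trans hrs, hsT⟩ i,
    hX r ⟨htr, hr0.2⟩ (ζ.1 + (R b θ r s).adjoint ζ.2, ζ.2),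
    Lp.coeFn_add (J (segL2 t r (noise b θ r (ζ.1 + (R b θ r s).adjoint ζ.2, ζ.2))))
      (J (segL2 r s (noise b θ s ζ)))] with ω h1 h2 h3
  have h4 := h.inner_meanState hr0 hs0 ζ (X r ω) (meanState b θ t r x)
  rw [h.meanState_meanState ⟨ht, htr.trans hr0.2⟩ hr0 hs0] at h4
  have h5 : coords (meanState b θ r s (X r ω) + noiseVec b θ J r s ω) i =
      coords (meanState b θ r s (X r ω)) i + J (segL2 r s (noise b θ s ζ)) ω := by
    rw [← coords_noiseVec]
    exact congrFun (map_add (coordsEquiv d) _ _) i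
  rw [e1, map_add, h3, Pi.add_apply] at h1
  rw [h1, h5, ← inner_stdBasis, ← inner_stdBasis]
  simp only [inner_sub_right] at h4
  simp only [meanState] at h4 h2 ⊢
  linarith

theorem FrozenReg.continuous_meanState (h : FrozenReg b θ T τ Λ C c₀) (hr : r ∈ Icc 0 T)
    (hs : s ∈ Icc 0 T) : Continuous (meanState b θ r s) := by
  have e : meanState b θ r s = fun y =>
      (y.1 + mean₁ b θ r s 0, y.2 + R b θ r s y.1 + mean₂ b θ r s 0) := by
    funext y
    rw [meanState, FrozenReg.mean₁_eq, h.mean₂_eq hr hs]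
  rw [e]
  fun_prop

/-- The law of `m + N`, for the noise `N` accumulated on `[r, s]`, has the frozen density. -/
theorem FrozenReg.map_noiseVec_real [IsProbabilityMeasure P] (h : FrozenReg b θ T τ Λ C c₀)
    (hJ : IsWienerMap P W J) (hr : 0 ≤ r) (hrs : r < s) (hsT : s ≤ T) (y : State d)
    {B : Set (State d)} (hB : MeasurableSet B) :
    (P.map (noiseVec b θ J r s)).real ((fun n => meanState b θ r s y + n) ⁻¹' B)
      = ∫ z in B, density b θ r y s z := by
  have hs0 : s ∈ Icc 0 T := ⟨hr.trans hrs.le, hsT⟩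
  have hm := hJ.map_toLp (fun i => segL2 r s (noise b θ s (stdBasis d i)))
    (h.scaledBounds hr hrs hsT).posDef.posSemidef fun i j => by
      rw [h.covMatrix_apply ⟨hr, hrs.le.trans hsT⟩ hs0, inner_segL2 hr hrs.le
        (h.memLp_noise hr le_rfl hs0 _) (h.memLp_noise hr le_rfl hs0 _)]
  have hmeas : Measurable fun ω => WithLp.toLp 2 fun i =>
      J (segL2 r s (noise b θ s (stdBasis d i))) ω :=
    (WithLp.measurable_toLp 2 _).comp
      (measurable_pi_lambda _ fun _ => (Lp.stronglyMeasurable _).measurable)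
  have hN : P.map (noiseVec b θ J r s) =
      (multivariateGaussian 0 (covMatrix b θ r s)).map (ofCoords d) := by
    rw [← hm, Measure.map_map continuous_ofCoords.measurable hmeas]
    rfl
  have hlaw : volume.withDensity (fun z => ENNReal.ofReal (density b θ r y s z)) =
      (P.map (noiseVec b θ J r s)).map fun n => meanState b θ r s y + n := by
    rw [h.withDensity_density hr hrs hsT, multivariateGaussian_eq_map_add, hN,
      Measure.map_map continuous_ofCoords.measurable (by fun_prop),
      Measure.map_map (by fun_prop) continuous_ofCoords.measurable]
    congr 1
  have h1 := congrArg (fun μ => μ B) hlaw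
  beta_reduce at h1
  rw [withDensity_apply _ hB, Measure.map_apply (by fun_prop) hB] at h1
  rw [Measure.real, ← h1, integral_eq_lintegral_of_nonneg_ae
    (ae_of_all _ fun z => FrozenReg.density_nonneg r s y z)
    (h.integrable_density hr hrs hsT y).aestronglyMeasurable.restrict]

/-- The integrands live on (r, s] and are orthogonal to the steps ending by r. -/
theorem FrozenReg.indep_noiseVec_history [IsProbabilityMeasure P] (h : FrozenReg b θ T τ Λ C c₀)
    (hJ : IsWienerMap P W J) (hr : 0 ≤ r) (hs : s ∈ Icc 0 T) :
    Indep (MeasurableSpace.comap (noiseVec b θ J r s) inferInstance) (history W r) P := by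
  refine indep_of_indep_of_le_left
    (hJ.indep_history (fun i => segL2 r s (noise b θ s (stdBasis d i))) r fun p hp i => ?_) ?_
  · rw [stepL2_eq_segL2]
    exact inner_segL2_disjoint le_rfl (Ioc_disjoint_Ioc_of_le hp) (memLp_const _)
      (h.memLp_noise hr le_rfl hs _)
  · exact ((continuous_ofCoords.comp (PiLp.continuous_toLp 2 _)).measurable.comp
      (comap_measurable _)).comap_le

theorem FrozenReg.hasTransitionDensity [IsProbabilityMeasure P] (h : FrozenReg b θ T τ Λ C c₀)
    (hW : IsBrownian W P) (hJ : IsWienerMap P W J) (hX : IsNoiseForm b θ T J t x X) (ht : 0 ≤ t) :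
    HasTransitionDensity T P W t X (density b θ) := by
  intro r s htr hrs hsT B hB
  have hr0 : r ∈ Icc 0 T := ⟨ht.trans htr, hrs.le.trans hsT⟩
  have hs0 : s ∈ Icc 0 T := ⟨hr0.1.trans hrs.le, hsT⟩
  -- X_r is measurable for the history only up to a null set; conditioning needs a version Y that is
  -- measurable without completion.
  obtain ⟨Y, hY, hXY⟩ := h.aestronglyMeasurable_history hW hJ ht ⟨htr, hr0.2⟩ hX
  have hB' : MeasurableSet ((fun z : State d × State d => meanState b θ r s z.1 + z.2) ⁻¹' B) :=
    (((h.continuous_meanState hr0 hs0).comp continuous_fst).add continuous_snd).measurable hB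
  have h1 := condExp_indicator_of_indep (history_le hW r) hY.measurable
    (measurable_noiseVec (b := b) (θ := θ) (J := J) (t := r) (s := s))
    (h.indep_noiseVec_history hJ hr0.1 hs0) hB'
  refine (condExp_congr_ae ?_).trans (h1.trans ?_)
  · filter_upwards [h.ae_eq_meanState_add hX ht htr hrs.le hsT, hXY] with ω h2 h3
    have h4 : ω ∈ X s ⁻¹' B ↔ ω ∈ (fun ω => (Y ω, noiseVec b θ J r s ω)) ⁻¹'
        ((fun z : State d × State d => meanState b θ r s z.1 + z.2) ⁻¹' B) := by
      simp only [mem_preimage, h2, h3]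
    by_cases hω : ω ∈ X s ⁻¹' B
    · rw [indicator_of_mem hω, indicator_of_mem (h4.1 hω)]
    · rw [indicator_of_notMem hω, indicator_of_notMem (fun hn => hω (h4.2 hn))]
  · filter_upwards [hXY] with ω h3
    rw [h3]
    exact h.map_noiseVec_real hJ hr0.1 hrs hsT (Y ω) hB

end FrozenSystem

end

/-! ### The proposition -/

theorem proposition3p1 {d : ℕ} (hd : 0 < d) (p : KnownParameters d) :
    ∃ κ c C : ℝ, 0 < κ ∧ 0 < c ∧ 0 < C ∧
    ∀ (T : ℝ) (b : Coefficients d), 0 < T → AssumptionHR p T b →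
    ∀ τ ∈ Icc 0 T, ∀ ξ : State d,
      -- the transport exists and is unique
      (∃ θ, IsTransport b T τ ξ θ) ∧
      (∀ θ θ', IsTransport b T τ ξ θ → IsTransport b T τ ξ θ' → EqOn θ θ' (Iic T)) ∧
      ∀ θ, IsTransport b T τ ξ θ →
        -- unique strong solution, its mean and covariance, Gaussian process, transition density
        (∀ (Ω : Type*) (mΩ : MeasurableSpace Ω) (P : Measure Ω) (W : ℝ≥0 → Ω → Vec d),
          IsProbabilityMeasure P → IsBrownian W P → ∀ t ∈ Icc 0 T, ∀ x : State d,
          ∃ X : ℝ → Ω → State d, IsStrongSolution b θ T P W t x X ∧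
            (∀ Y : ℝ → Ω → State d, IsSolution b θ T P W t x Y →
              ∀ᵐ ω ∂P, ∀ s ∈ Icc t T, Y s ω = X s ω) ∧
            (∀ s ∈ Icc t T, MemLp (X s) 2 P ∧
              ∫ ω, X s ω ∂P = (mean₁ b θ t s x, mean₂ b θ t s x) ∧
              ∀ i j, covariance (fun ω => coords (X s ω) i) (fun ω => coords (X s ω) j) P
                = covMatrix b θ t s i j) ∧
            IsGaussianProcess (fun (s : Icc t T) => X s) P ∧
            HasTransitionDensity T P W t X (density b θ)) ∧
        -- uniform non-degeneracy of the covariance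
        (∀ t s, 0 ≤ t → t < s → s ≤ T → ∀ ζ : State d,
          κ * ((s - t) * ‖ζ.1‖ ^ 2 + (s - t) ^ 3 * ‖ζ.2‖ ^ 2)
            ≤ coords ζ ⬝ᵥ (covMatrix b θ t s).mulVec (coords ζ)) ∧
        -- fundamental solution
        IsFundamentalSolution T τ (frozenOperator b θ) (density b θ) ∧
        -- Gaussian bounds
        (∀ t s, 0 ≤ t → t < s → s ≤ T →
          ContDiff ℝ (⊤ : ℕ∞) (fun z : State d × State d => density b θ t z.1 s z.2) ∧
          ∀ x y : State d,
            density b θ t x s y ≤ C * boundKernel b θ c t x s y ∧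
            ∀ Nx₁ Nx₂ Ny₁ : ℕ, Nx₁ ≤ 2 → Nx₂ ≤ 2 → Ny₁ ≤ 2 →
              mixedDerivNorm Nx₁ Nx₂ Ny₁ (fun x' y' => density b θ t x' s y') x y
                ≤ C * (s - t) ^ (-((3 * Nx₂ + Nx₁ + Ny₁ : ℕ) : ℝ) / 2)
                  * boundKernel b θ c t x s y) := by
  -- Closedness of 𝓔, invertibility and the signs of the constants are hypotheses on p that are
  -- available only through some admissible pair (T, b). Without such a pair the statement is void;
  -- with one, c₀ is extracted from p alone and then serves all pairs.
  by_cases hex : ∃ (T : ℝ) (b : Coefficients d), 0 < T ∧ AssumptionHR p T b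
  · obtain ⟨T₀, b₀, hT₀, hb₀⟩ := hex
    obtain ⟨c₀, hreg⟩ := exists_frozenReg p hb₀.𝓔_closed hb₀.𝓔_invertible
    -- This particular transport serves only to obtain the positivity of the constants.
    obtain ⟨θ₀, hθ₀⟩ := exists_isTransport hT₀ hb₀ ⟨le_rfl, hT₀.le⟩ 0
    have h₀ := hreg T₀ b₀ hT₀ hb₀ 0 ⟨le_rfl, hT₀.le⟩ 0 θ₀ hθ₀
    have hκ := h₀.lowerConst_pos
    have hK := h₀.upperConst_pos
    have hC := h₀.C_pos
    have hG := ScaledBounds.gaussConst_pos (d := d) hκ hK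
    refine ⟨lowerConst p.Λ p.C₂ c₀, (4 * upperConst p.Λ p.C₂)⁻¹,
      (1 + p.C₂) ^ 2 * ScaledBounds.gaussConst d (lowerConst p.Λ p.C₂ c₀) (upperConst p.Λ p.C₂) *
        (4 * upperConst p.Λ p.C₂), hκ, by positivity, by positivity,
      fun T b hT hb τ hτ ξ => ⟨exists_isTransport hT hb hτ ξ,
        fun θ θ' hθ hθ' => hθ.eqOn hb hτ hθ', fun θ hθ => ?_⟩⟩
    have h := hreg T b hT hb τ hτ ξ θ hθ
    refine ⟨fun Ω mΩ P W hP hW t ht x => ?_, fun t s h0 hts hsT ζ => h.le_covMatrix h0 hts.le hsT ζ,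
      h.isFundamentalSolution, fun t s h0 hts hsT =>
        ⟨h.contDiff_density ⟨h0, hts.le.trans hsT⟩ ⟨h0.trans hts.le, hsT⟩, fun x y =>
          ⟨h.density_le h0 hts hsT x y, fun k₁ k₂ l hk₁ hk₂ hl =>
            h.mixedDerivNorm_le h0 hts hsT x y hk₁ hk₂ hl⟩⟩⟩
    obtain ⟨J, hJ⟩ := hW.exists_isWienerMap
    obtain ⟨X, hX, hXJ⟩ := h.exists_isSolution hW hJ ht x
    exact ⟨X, ⟨hX, fun s hs => h.aestronglyMeasurable_history hW hJ ht.1 hs hXJ⟩,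
      fun Y hY => h.isSolution_unique hW hJ ht hX hY,
      fun s hs => ⟨hXJ.memLp hJ hs, hXJ.integral_eq hJ hs, fun i j => h.covariance_eq hJ hXJ ht.1 hs i j⟩,
      hXJ.isGaussianProcess hJ, h.hasTransitionDensity hW hJ hXJ ht.1⟩
  · exact ⟨1, 1, 1, one_pos, one_pos, one_pos, fun T b hT hb => (hex ⟨T, b, hT, hb⟩).elim⟩
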